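/- **Setting.** Let $(M,g_{ab},F_{ab})$ be a smooth time-oriented four-dimensional spacetime of signature $(+,-,-,-)$ satisfying the source-free Einstein–Maxwell equations $\nabla^aF_{ab}=0$, $\nabla_{[a}F_{bc]}=0$, $R_{ab}-\tfrac12 g_{ab}R+\tilde\Lambda g_{ab}=-8\pi T_{ab}$, $T_{ab}=-\tfrac1{4\pi}\big[F_{ae}F_b{}^e-\tfrac14 g_{ab}F_{ef}F^{ef}\big]$, with a cosmological constant $\tilde\Lambda\in\mathbb R$. The curvature signs are those of Newman and Penrose: $(\nabla_d\nabla_c-\nabla_c\nabla_d)X_b=X_aR^a{}_{bcd}$, $R_{ab}=R^c{}_{abc}$, and $C_{abcd}$ is the trace-free part of $R_{abcd}$. Let $\mathcal H_1,\mathcal H_2$ be null hypersurfaces generated by expansion and shear free, geodesically complete null congruences, intersecting in a spacelike surface $\mathcal Z=\mathcal H_1\cap\mathcal H_2$. Let $(u,r,x^3,x^4)$ be Gaussian null coordinates: on $\mathcal H_2=\{r=0\}$ the field $\partial_u$ is the affinely parametrized future directed tangent of the generators, with $u=0$ on $\mathcal Z$; on $\mathcal H_2$ the field $\ell=\partial_r$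 is future directed, null, orthogonal to the sections $u=\mathrm{const}$, and $g(\partial_r,\partial_u)=1$; the curves on which $u,x^3,x^4$ are constant are affinely parametrized null geodesics starting on $\mathcal H_2$; and $\mathcal H_1=\{u=0\}$. With each point of $\mathcal Z$ the coordinate domain contains the complete generators of $\mathcal H_1$ and $\mathcal H_2$ through it. Let $$\ell=\partial_r,\qquad n=\partial_u+U\partial_r+X^A\partial_A,\qquad m=\omega\partial_r+\xi^A\partial_A$$ be a smooth complex null tetrad ($\ell\cdot n=1$, $m\cdot\bar m=-1$, all other products zero) which is parallelly propagated along $\ell$, with $U=X^A=\omega=0$ and $\gamma=\tfrac12n^a(n^b\nabla_a\ell_b-\bar m^b\nabla_am_b)=0$ on $\mathcal H_2$. Put $\delta=m^a\partial_a$, $\bar\delta=\bar m^a\partial_a$ on scalars, $k=2$, and $$\alpha=\tfrac12\bar m^a(n^b\nabla_a\ell_b-\bar m^b\nabla_am_b),\quad \beta=\tfrac12m^a(n^b\nabla_a\ell_b-\bar m^b\nabla_am_b),\quad \tau=n^am^b\nabla_a\ell_b,$$ $$\Psi_2=-\tfrac12C_{abcd}(\ell^an^b\ell^cn^d-\ell^an^bm^c\bar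 m^d),\qquad \phi_1=\tfrac12F_{ab}(\ell^an^b+\bar m^am^b),$$ $$\tilde\Psi_0'=\delta^2\Psi_2+(\tau-2\beta)\delta\Psi_2+2k\big[\delta^2\phi_1-(\tau+2\beta)\delta\phi_1\big]\bar\phi_1+k(\delta\phi_1)\delta\bar\phi_1,\qquad \tilde\Psi_1'=\delta\Psi_2+k(\delta\phi_1)\bar\phi_1,$$ $$\tilde\Psi_4=\bar\delta^2\Psi_2+2\alpha\bar\delta\Psi_2+2k\big[\bar\delta^2\phi_1+2\alpha\bar\delta\phi_1\big]\bar\phi_1+k(\bar\delta\phi_1)\bar\delta\bar\phi_1,\qquad \tilde\Psi_3=\bar\delta\Psi_2+k(\bar\delta\phi_1)\bar\phi_1.$$ On $\mathcal H_2$ put $m'=m+u\tau n$ and $\ell'=\ell+u\bar\tau m+u\tau\bar m+u^2\tau\bar\tau n$. **Proposition.** The complex null tetrad $(\ell,n,m,\bar m)$ is parallelly propagated along the generators of $\mathcal H_1$, and $(\ell',n,m',\bar m')$ is a complex null tetrad parallelly propagated along the generators of $\mathcal H_2$. For every $z\in\mathcal Z$ in the coordinate domain: 1. If $\tilde\Psi_3$,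 $\tilde\Psi_4$ or $\bar\delta\phi_1$ is nonzero at $z$, then along the generator of $\mathcal H_1$ through $z$ a component of the Weyl tensor or a component of the Ricci tensor in $(\ell,n,m,\bar m)$ tends to infinity in absolute value both to the future ($r\to+\infty$) and to the past ($r\to-\infty$). 2. If $\tilde\Psi_0'$, $\tilde\Psi_1'$ or $\delta\phi_1$ is nonzero at $z$, then along the generator of $\mathcal H_2$ through $z$ a component of the Weyl tensor or a component of the Ricci tensor in $(\ell',n,m',\bar m')$ tends to infinity in absolute value both to the future ($u\to+\infty$) and to the past ($u\to-\infty$). 3. The following components are linear, respectively quadratic, in the affine parameters, with the right-hand brackets evaluated at $z$. On the generator of $\mathcal H_1$ through $z$, $$\Psi_3=-C_{abcd}n^a\ell^bn^c\bar m^d=r\,\tilde\Psi_3,\qquad \Phi_{12}=-\tfrac12R_{ab}n^am^b=r\,[k\,\phi_1\overline{\bar\delta\phi_1}],$$ $$\Psi_4=-C_{abcd}n^a\bar m^bn^c\bar m^d=\tfrac12r^2\big[\tilde\Psi_4-\bar\tau(\tilde\Psi_3+k(\bar\delta\phi_1)\bar\phi_1)\big],\qquad \Phi_{22}=-\tfrac12R_{ab}n^an^b=r^2[k\,|\bar\delta\phi_1|^2].$$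 On the generator of $\mathcal H_2$ through $z$, $$\Psi_1'=-C_{abcd}\ell'^an^b\ell'^cm'^d=u\,\tilde\Psi_1',\qquad \Phi_{01}'=-\tfrac12R_{ab}\ell'^am'^b=u\,[k(\delta\phi_1)\bar\phi_1],$$ $$\Psi_0'=-C_{abcd}\ell'^am'^b\ell'^cm'^d=\tfrac12u^2\big[\tilde\Psi_0'+4k\tau(\delta\phi_1)\bar\phi_1\big],\qquad \Phi_{00}'=-\tfrac12R_{ab}\ell'^a\ell'^b=u^2[k\,|\delta\phi_1|^2].$$ -/

import Mathlib

open scoped Manifold ContDiff ComplexConjugate Topology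
open Filter

/-! ## Tensor calculus in a coordinate domain of dimension four

Coordinates are numbered `0, 1, 2, 3`; in Gaussian null coordinates they are `u, r, x³, x⁴`.
A metric on a coordinate domain is the matrix of its components. Vectors have complex components,
and real tensors are extended complex-linearly. -/

/-- The model space `ℝ⁴`. -/
abbrev R4 := EuclideanSpace ℝ (Fin 4)

/-- The point with coordinates `(u, r, x³, x⁴) = (u, r, a, b)`. -/
noncomputable def pt (u r a b : ℝ) : R4 := !₂[u, r, a, b]

/-- The partial derivative `∂_μ f`. -/
noncomputable def pd {F : Type*} [NormedAddCommGroup F] [NormedSpace ℝ F]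
    (μ : Fin 4) (f : R4 → F) (x : R4) : F :=
  fderiv ℝ f x (EuclideanSpace.single μ 1)

/-- The components `G a b` of a metric, as functions of the coordinates. -/
abbrev MetricComp := R4 → Matrix (Fin 4) (Fin 4) ℝ

/-- The Christoffel symbols `Γ^a_{bc}`. -/
noncomputable def christoffel (G : MetricComp) (a b c : Fin 4) (x : R4) : ℝ :=
  (1 / 2) * ∑ k, (G x)⁻¹ a k *
    (pd b (fun y => G y k c) x + pd c (fun y => G y k b) x - pd k (fun y => G y b c) x)

/-- The curvature tensor with one index up,
`R^a_{bcd} = ∂_c Γ^a_{db} - ∂_d Γ^a_{cb} + Γ^a_{ce} Γ^e_{db} - Γ^a_{de} Γ^e_{cb}`, i.e.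
`(∇_d ∇_c - ∇_c ∇_d) X_b = X_a R^a_{bcd}`. -/
noncomputable def riemannUp (G : MetricComp) (a b c d : Fin 4) (x : R4) : ℝ :=
  pd c (christoffel G a d b) x - pd d (christoffel G a c b) x +
    ∑ e, (christoffel G a c e x * christoffel G e d b x -
      christoffel G a d e x * christoffel G e c b x)

/-- The curvature tensor `R_{abcd}` with all indices down. -/
noncomputable def riemannDown (G : MetricComp) (a b c d : Fin 4) (x : R4) : ℝ :=
  ∑ e, G x a e * riemannUp G e b c d x

/-- The Ricci tensor with the Newman-Penrose sign, `R_{ab} = R^c_{abc}` (minus one times the Ricci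
tensor `R^c_{acb}` of the same curvature tensor). -/
noncomputable def ricci (G : MetricComp) (a b : Fin 4) (x : R4) : ℝ :=
  ∑ c, riemannUp G c a b c x

/-- The scalar curvature `R = g^{ab} R_{ab}`. -/
noncomputable def scalarCurv (G : MetricComp) (x : R4) : ℝ :=
  ∑ a, ∑ b, (G x)⁻¹ a b * ricci G a b x

/-- The Weyl tensor `C_{abcd}`, the trace-free part of `R_{abcd}`. -/
noncomputable def weyl (G : MetricComp) (a b c d : Fin 4) (x : R4) : ℝ :=
  riemannDown G a b c d x +
    (1 / 2) * (G x a c * ricci G b d x - G x a d * ricci G b c x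
      - G x b c * ricci G a d x + G x b d * ricci G a c x) -
    scalarCurv G x / 6 * (G x a c * G x b d - G x a d * G x b c)

/-- The covariant derivative `∇_c F_{ab}` of a covariant 2-tensor. -/
noncomputable def covDerivTwo (G : MetricComp) (F : R4 → Matrix (Fin 4) (Fin 4) ℝ)
    (c a b : Fin 4) (x : R4) : ℝ :=
  pd c (fun y => F y a b) x -
    ∑ d, (christoffel G d c a x * F x d b + christoffel G d c b x * F x a d)

/-- The Maxwell energy-momentum tensor
`T_{ab} = -(1/4π) [F_{ae} F_b^e - (1/4) g_{ab} F_{ef} F^{ef}]`. -/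
noncomputable def maxwellStress (G : MetricComp) (F : R4 → Matrix (Fin 4) (Fin 4) ℝ)
    (a b : Fin 4) (x : R4) : ℝ :=
  -(1 / (4 * Real.pi)) *
    ((∑ e, ∑ f, (G x)⁻¹ e f * F x a e * F x b f) -
      (1 / 4) * G x a b *
        ∑ e, ∑ f, ∑ c, ∑ d, (G x)⁻¹ e c * (G x)⁻¹ f d * F x e f * F x c d)

/-- `g(v, w)`. -/
noncomputable def ip (G : MetricComp) (x : R4) (v w : Fin 4 → ℂ) : ℂ :=
  ∑ a, ∑ b, (G x a b : ℂ) * v a * w b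

/-- The contraction `T_{ab} v^a w^b` of a real tensor. -/
noncomputable def contr2 (T : Fin 4 → Fin 4 → ℝ) (v w : Fin 4 → ℂ) : ℂ :=
  ∑ a, ∑ b, (T a b : ℂ) * v a * w b

/-- The Weyl contraction `C_{abcd} v^a w^b y^c z^d`. -/
noncomputable def weylC (G : MetricComp) (x : R4) (v w y z : Fin 4 → ℂ) : ℂ :=
  ∑ a, ∑ b, ∑ c, ∑ d, (weyl G a b c d x : ℂ) * v a * w b * y c * z d

/-- The Ricci contraction `R_{ab} v^a w^b`. -/
noncomputable def ricciC (G : MetricComp) (x : R4) (v w : Fin 4 → ℂ) : ℂ :=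
  contr2 (fun a b => ricci G a b x) v w

/-- The complex conjugate vector. -/
noncomputable def conjV (v : Fin 4 → ℂ) : Fin 4 → ℂ := fun a => conj (v a)

/-- The covariant derivative `W^b ∇_b V^a` at `x` of a vector field `V`. -/
noncomputable def covDeriv (G : MetricComp) (W : Fin 4 → ℂ) (V : R4 → Fin 4 → ℂ)
    (x : R4) : Fin 4 → ℂ := fun a =>
  ∑ b, W b * (pd b (fun y => V y a) x + ∑ c, (christoffel G a b c x : ℂ) * V x c)

/-- `(ℓ, n, m, m̄)` is a complex null tetrad at `x`: `ℓ, n` are real, `ℓ·n = 1`, `m·m̄ = -1`, and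
the other products vanish. -/
def IsNullTetradAt (G : MetricComp) (x : R4) (l n m : Fin 4 → ℂ) : Prop :=
  conjV l = l ∧ conjV n = n ∧
  ip G x l l = 0 ∧ ip G x n n = 0 ∧ ip G x m m = 0 ∧
  ip G x l n = 1 ∧ ip G x m (conjV m) = -1 ∧ ip G x l m = 0 ∧ ip G x n m = 0

/-- The vector field `V` along the curve `c` is parallelly propagated:
`dV^a/ds + Γ^a_{bc} (dc^b/ds) V^c = 0`. -/
def IsParallelAlong (G : MetricComp) (c : ℝ → R4) (V : ℝ → Fin 4 → ℂ) : Prop :=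
  ∀ s a, HasDerivAt (fun t => V t a)
    (-∑ b, ∑ d, (christoffel G a b d (c s) : ℂ) * (deriv (fun t => c t b) s : ℂ) * V s d) s

/-- `(ℓ, n, m, m̄)` is a parallelly propagated complex null tetrad along the curve `c`. -/
def IsParallelNullTetrad (G : MetricComp) (c : ℝ → R4) (l n m : ℝ → Fin 4 → ℂ) : Prop :=
  (∀ s, IsNullTetradAt G (c s) (l s) (n s) (m s)) ∧
  IsParallelAlong G c l ∧ IsParallelAlong G c n ∧ IsParallelAlong G c m

/-- Some component of the Weyl tensor in the tetrad `(ℓ, n, m, m̄)` along the curve `c` blows up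
both as the parameter tends to `+∞` and as it tends to `-∞`. -/
def WeylBlowsUp (G : MetricComp) (c : ℝ → R4) (l n m : ℝ → Fin 4 → ℂ) : Prop :=
  ∃ i j k h : Fin 4,
    let E : ℝ → Fin 4 → Fin 4 → ℂ := fun s => ![l s, n s, m s, conjV (m s)]
    let f : ℝ → ℝ := fun s => ‖weylC G (c s) (E s i) (E s j) (E s k) (E s h)‖
    Tendsto f atTop atTop ∧ Tendsto f atBot atTop

/-- Some component of the Ricci tensor in the tetrad `(ℓ, n, m, m̄)` along the curve `c` blows up
both as the parameter tends to `+∞` and as it tends to `-∞`. -/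
def RicciBlowsUp (G : MetricComp) (c : ℝ → R4) (l n m : ℝ → Fin 4 → ℂ) : Prop :=
  ∃ i j : Fin 4,
    let E : ℝ → Fin 4 → Fin 4 → ℂ := fun s => ![l s, n s, m s, conjV (m s)]
    let f : ℝ → ℝ := fun s => ‖ricciC G (c s) (E s i) (E s j)‖
    Tendsto f atTop atTop ∧ Tendsto f atBot atTop

/-! ## Electrovacuum spacetimes -/

section Manifold

variable {M : Type*} [TopologicalSpace M] [ChartedSpace R4 M]

/-- The coordinate vector `∂_μ` of the chart `φ` at the point with coordinates `x`. -/
noncomputable def coordVec (φ : OpenPartialHomeomorph M R4) (x : R4) (μ : Fin 4) :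
    TangentSpace 𝓘(ℝ, R4) (φ.symm x) :=
  mfderiv 𝓘(ℝ, R4) 𝓘(ℝ, R4) φ.symm x (EuclideanSpace.single μ (1 : ℝ))

/-- The components of a covariant 2-tensor field in the chart `φ`. -/
noncomputable def chartComp
    (T : ∀ p : M, TangentSpace 𝓘(ℝ, R4) p →ₗ[ℝ] TangentSpace 𝓘(ℝ, R4) p →ₗ[ℝ] ℝ)
    (φ : OpenPartialHomeomorph M R4) (x : R4) : Matrix (Fin 4) (Fin 4) ℝ :=
  Matrix.of fun μ ν => T (φ.symm x) (coordVec φ x μ) (coordVec φ x ν)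

end Manifold

/-- A smooth time-oriented solution of the source-free Einstein-Maxwell equations with
cosmological constant, signature `(+,-,-,-)`. Smoothness and the (tensorial) field equations are
expressed by the components in the charts of the smooth structure. -/
structure Electrovacuum (M : Type*) [TopologicalSpace M] [ChartedSpace R4 M]
    [IsManifold 𝓘(ℝ, R4) ∞ M] where
  /-- the metric -/
  g : ∀ p : M, TangentSpace 𝓘(ℝ, R4) p →ₗ[ℝ] TangentSpace 𝓘(ℝ, R4) p →ₗ[ℝ] ℝ
  /-- the electromagnetic field -/
  F : ∀ p : M, TangentSpace 𝓘(ℝ, R4) p →ₗ[ℝ] TangentSpace 𝓘(ℝ, R4) p →ₗ[ℝ] ℝ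
  /-- a timelike vector field fixing the time orientation -/
  T : ∀ p : M, TangentSpace 𝓘(ℝ, R4) p
  /-- the cosmological constant -/
  cosm : ℝ
  g_symm : ∀ p v w, g p v w = g p w v
  g_lorentz : ∀ p : M, ∃ e : Module.Basis (Fin 4) ℝ (TangentSpace 𝓘(ℝ, R4) p),
    ∀ i j, g p (e i) (e j) = if i = j then (if i = 0 then 1 else -1) else 0
  F_antisymm : ∀ p v w, F p v w = -F p w v
  T_timelike : ∀ p, 0 < g p (T p) (T p)
  g_smooth : ∀ φ ∈ IsManifold.maximalAtlas 𝓘(ℝ, R4) ∞ M, ∀ μ ν,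
    ContDiffOn ℝ ∞ (fun x => chartComp g φ x μ ν) φ.target
  F_smooth : ∀ φ ∈ IsManifold.maximalAtlas 𝓘(ℝ, R4) ∞ M, ∀ μ ν,
    ContDiffOn ℝ ∞ (fun x => chartComp F φ x μ ν) φ.target
  T_smooth : ∀ φ ∈ IsManifold.maximalAtlas 𝓘(ℝ, R4) ∞ M, ∀ μ,
    ContDiffOn ℝ ∞ (fun x => g (φ.symm x) (T (φ.symm x)) (coordVec φ x μ)) φ.target
  /-- `∇^a F_{ab} = 0` -/
  maxwell_div : ∀ φ ∈ IsManifold.maximalAtlas 𝓘(ℝ, R4) ∞ M, ∀ x ∈ φ.target, ∀ b,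
    ∑ a, ∑ c, (chartComp g φ x)⁻¹ a c *
      covDerivTwo (chartComp g φ) (chartComp F φ) c a b x = 0
  /-- `∇_{[a} F_{bc]} = 0` -/
  maxwell_closed : ∀ φ ∈ IsManifold.maximalAtlas 𝓘(ℝ, R4) ∞ M, ∀ x ∈ φ.target, ∀ a b c,
    covDerivTwo (chartComp g φ) (chartComp F φ) a b c x +
      covDerivTwo (chartComp g φ) (chartComp F φ) b c a x +
      covDerivTwo (chartComp g φ) (chartComp F φ) c a b x = 0
  /-- `R_{ab} - (1/2) g_{ab} R + Λ̃ g_{ab} = -8π T_{ab}` -/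
  einstein : ∀ φ ∈ IsManifold.maximalAtlas 𝓘(ℝ, R4) ∞ M, ∀ x ∈ φ.target, ∀ a b,
    ricci (chartComp g φ) a b x - (1 / 2) * chartComp g φ x a b * scalarCurv (chartComp g φ) x +
      cosm * chartComp g φ x a b =
    -(8 * Real.pi) * maxwellStress (chartComp g φ) (chartComp F φ) a b x

/-! ## Gaussian null coordinates on a pair of intersecting null hypersurfaces -/

/-- Gaussian null coordinates `(u, r, x³, x⁴)` adapted to a pair of null hypersurfaces `H₁`, `H₂`
which are generated by complete null geodesics through the spacelike surface `Z = H₁ ∩ H₂`.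
On `H₂ = {r = 0}` the vector field `∂_u` is the affinely parametrized future directed generator,
with `u = 0` on `Z`. On `H₂` the field `∂_r` is the future directed null normal of the
cross-sections `u = const` with `g(∂_r, ∂_u) = 1`, and the lines on which `u, x³, x⁴` are constant
are affinely parametrized null geodesics starting on `H₂` with tangent `∂_r`. The null hypersurface
`H₁` is `{u = 0}`. With `Z` the patch contains the complete generators of `H₁` and `H₂` through
its points. -/
structure GaussianNullPatch {M : Type*} [TopologicalSpace M] [ChartedSpace R4 M]
    [IsManifold 𝓘(ℝ, R4) ∞ M] (S : Electrovacuum M) (H₁ H₂ : Set M) where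
  chart : OpenPartialHomeomorph M R4
  chart_mem : chart ∈ IsManifold.maximalAtlas 𝓘(ℝ, R4) ∞ M
  mem_H₁ : ∀ p ∈ chart.source, (p ∈ H₁ ↔ chart p 0 = 0)
  mem_H₂ : ∀ p ∈ chart.source, (p ∈ H₂ ↔ chart p 1 = 0)
  /-- every point lies on a null geodesic with tangent `∂_r` starting on `H₂` -/
  from_H₂ : ∀ u r a b, pt u r a b ∈ chart.target →
    ∀ t ∈ Set.Icc (0 : ℝ) 1, pt u (t * r) a b ∈ chart.target
  /-- every generator of `H₂` meets `Z` -/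
  from_Z : ∀ u a b, pt u 0 a b ∈ chart.target → pt 0 0 a b ∈ chart.target
  /-- the generators of `H₁` are complete -/
  complete_H₁ : ∀ a b, pt 0 0 a b ∈ chart.target → ∀ r, pt 0 r a b ∈ chart.target
  /-- the generators of `H₂` are complete -/
  complete_H₂ : ∀ a b, pt 0 0 a b ∈ chart.target → ∀ u, pt u 0 a b ∈ chart.target
  /-- on `H₂` the vector `∂_u` is null and orthogonal to `H₂` -/
  u_null : ∀ x ∈ chart.target, x 1 = 0 → ∀ a : Fin 4, a ≠ 1 → chartComp S.g chart x 0 a = 0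
  /-- `∂_u` is geodesic on `H₂`, with affine parameter `u` -/
  u_geodesic : ∀ x ∈ chart.target, x 1 = 0 → ∀ a, christoffel (chartComp S.g chart) a 0 0 x = 0
  /-- on `H₂`, `∂_r` is null, orthogonal to the cross-sections, and normalized -/
  r_null : ∀ x ∈ chart.target, x 1 = 0 → ∀ a : Fin 4,
    chartComp S.g chart x 1 a = if a = 0 then 1 else 0
  /-- `∂_r` is geodesic, with affine parameter `r` -/
  r_geodesic : ∀ x ∈ chart.target, ∀ a, christoffel (chartComp S.g chart) a 1 1 x = 0
  u_future : ∀ x ∈ chart.target, x 1 = 0 →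
    0 < S.g (chart.symm x) (S.T (chart.symm x)) (coordVec chart x 0)
  r_future : ∀ x ∈ chart.target, x 1 = 0 →
    0 < S.g (chart.symm x) (S.T (chart.symm x)) (coordVec chart x 1)

/-- The indices of the two coordinates `x³, x⁴` on the cross-sections. -/
def crossIdx (A : Fin 2) : Fin 4 := ![2, 3] A

/-- The metric `q_{AB} = g(∂_A, ∂_B)` of the cross-sections. -/
def crossMetric (G : MetricComp) (x : R4) : Matrix (Fin 2) (Fin 2) ℝ :=
  Matrix.of fun A B => G x (crossIdx A) (crossIdx B)

/-- The deformation tensor `B_{AB} = (∂_A)^a (∂_B)^b ∇_a k_b` of the generators with tangent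
`k = ∂_κ`. -/
noncomputable def nullDeformation (G : MetricComp) (κ : Fin 4) (x : R4) :
    Matrix (Fin 2) (Fin 2) ℝ :=
  Matrix.of fun A B => ∑ c, G x (crossIdx B) c * christoffel G c (crossIdx A) κ x

/-- The expansion `θ = q^{AB} B_{AB}`. -/
noncomputable def nullExpansion (G : MetricComp) (κ : Fin 4) (x : R4) : ℝ :=
  ∑ A, ∑ B, (crossMetric G x)⁻¹ A B * nullDeformation G κ x A B

/-- The shear `B_{(AB)} - (1/2) θ q_{AB}`. -/
noncomputable def nullShear (G : MetricComp) (κ : Fin 4) (x : R4) : Matrix (Fin 2) (Fin 2) ℝ :=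
  (1 / 2 : ℝ) • (nullDeformation G κ x + (nullDeformation G κ x).transpose) -
    (nullExpansion G κ x / 2) • crossMetric G x

/-- The coefficients of a tetrad
`ℓ = ∂_r`, `n = ∂_u + U ∂_r + X^A ∂_A`, `m = ω ∂_r + ξ^A ∂_A` (`om`, `xi` are `ω`, `ξ`). -/
structure TetradCoeffs where
  U : R4 → ℝ
  X : R4 → Fin 2 → ℝ
  om : R4 → ℂ
  xi : R4 → Fin 2 → ℂ

namespace TetradCoeffs

variable (t : TetradCoeffs)

/-- `ℓ = ∂_r` -/
def l (_ : TetradCoeffs) (_ : R4) : Fin 4 → ℂ := ![0, 1, 0, 0]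

/-- `n = ∂_u + U ∂_r + X^A ∂_A` -/
noncomputable def n (x : R4) : Fin 4 → ℂ := ![1, (t.U x : ℂ), (t.X x 0 : ℂ), (t.X x 1 : ℂ)]

/-- `m = ω ∂_r + ξ^A ∂_A` -/
def m (x : R4) : Fin 4 → ℂ := ![0, t.om x, t.xi x 0, t.xi x 1]

/-- `m̄` -/
noncomputable def mbar (x : R4) : Fin 4 → ℂ := conjV (t.m x)

/-- The operator `δ = m^a ∂_a` on scalars. -/
noncomputable def dlt (f : R4 → ℂ) (x : R4) : ℂ := ∑ a, t.m x a * pd a f x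

/-- The operator `δ̄ = m̄^a ∂_a` on scalars. -/
noncomputable def dltbar (f : R4 → ℂ) (x : R4) : ℂ := ∑ a, t.mbar x a * pd a f x

variable (G : MetricComp)

/-- The spin coefficient `α = (1/2) m̄^a (n^b ∇_a ℓ_b - m̄^b ∇_a m_b)`. -/
noncomputable def alpha (x : R4) : ℂ :=
  (1 / 2) * (ip G x (t.n x) (covDeriv G (t.mbar x) t.l x) -
    ip G x (t.mbar x) (covDeriv G (t.mbar x) t.m x))

/-- The spin coefficient `β = (1/2) m^a (n^b ∇_a ℓ_b - m̄^b ∇_a m_b)`. -/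
noncomputable def beta (x : R4) : ℂ :=
  (1 / 2) * (ip G x (t.n x) (covDeriv G (t.m x) t.l x) -
    ip G x (t.mbar x) (covDeriv G (t.m x) t.m x))

/-- The spin coefficient `γ = (1/2) n^a (n^b ∇_a ℓ_b - m̄^b ∇_a m_b)`. -/
noncomputable def gamma (x : R4) : ℂ :=
  (1 / 2) * (ip G x (t.n x) (covDeriv G (t.n x) t.l x) -
    ip G x (t.mbar x) (covDeriv G (t.n x) t.m x))

/-- The spin coefficient `τ = n^a m^b ∇_a ℓ_b`. -/
noncomputable def tau (x : R4) : ℂ := ip G x (t.m x) (covDeriv G (t.n x) t.l x)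

/-- The Weyl spinor component
`Ψ₂ = -(1/2) C_{abcd} (ℓ^a n^b ℓ^c n^d - ℓ^a n^b m^c m̄^d)`. -/
noncomputable def Psi2 (x : R4) : ℂ :=
  -(1 / 2) * (weylC G x (t.l x) (t.n x) (t.l x) (t.n x) -
    weylC G x (t.l x) (t.n x) (t.m x) (t.mbar x))

/-- The Maxwell spinor component `φ₁ = (1/2) F_{ab} (ℓ^a n^b + m̄^a m^b)`. -/
noncomputable def phi1 (F : R4 → Matrix (Fin 4) (Fin 4) ℝ) (x : R4) : ℂ :=
  (1 / 2) * (contr2 (F x) (t.l x) (t.n x) + contr2 (F x) (t.mbar x) (t.m x))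

/-- The parallelly propagated `m' = m + u τ n` along `H₂`. -/
noncomputable def m' (x : R4) : Fin 4 → ℂ := fun a =>
  t.m x a + (x 0 : ℂ) * t.tau G x * t.n x a

/-- The parallelly propagated `ℓ' = ℓ + u τ̄ m + u τ m̄ + u² τ τ̄ n` along `H₂`. -/
noncomputable def l' (x : R4) : Fin 4 → ℂ := fun a =>
  t.l x a + (x 0 : ℂ) * conj (t.tau G x) * t.m x a + (x 0 : ℂ) * t.tau G x * t.mbar x a +
    (x 0 : ℂ) ^ 2 * t.tau G x * conj (t.tau G x) * t.n x a

/-- The constant `k` in `Φ_{ij} = k φ_i φ̄_j`, in geometric units. -/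
def k : ℂ := 2

variable (F : R4 → Matrix (Fin 4) (Fin 4) ℝ)

/-- `Ψ̃'₀ = δ²Ψ₂ + (τ - 2β) δΨ₂ + 2k [δ²φ₁ - (τ + 2β) δφ₁] φ̄₁ + k (δφ₁) δφ̄₁` -/
noncomputable def Psit0' (x : R4) : ℂ :=
  t.dlt (t.dlt (t.Psi2 G)) x + (t.tau G x - 2 * t.beta G x) * t.dlt (t.Psi2 G) x +
    2 * k * (t.dlt (t.dlt (t.phi1 F)) x -
      (t.tau G x + 2 * t.beta G x) * t.dlt (t.phi1 F) x) * conj (t.phi1 F x) +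
    k * t.dlt (t.phi1 F) x * t.dlt (fun y => conj (t.phi1 F y)) x

/-- `Ψ̃'₁ = δΨ₂ + k (δφ₁) φ̄₁` -/
noncomputable def Psit1' (x : R4) : ℂ :=
  t.dlt (t.Psi2 G) x + k * t.dlt (t.phi1 F) x * conj (t.phi1 F x)

/-- `Ψ̃₃ = δ̄Ψ₂ + k (δ̄φ₁) φ̄₁` -/
noncomputable def Psit3 (x : R4) : ℂ :=
  t.dltbar (t.Psi2 G) x + k * t.dltbar (t.phi1 F) x * conj (t.phi1 F x)

/-- `Ψ̃₄ = δ̄²Ψ₂ + 2α δ̄Ψ₂ + 2k (δ̄²φ₁ + 2α δ̄φ₁) φ̄₁ + k (δ̄φ₁) δ̄φ̄₁` -/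
noncomputable def Psit4 (x : R4) : ℂ :=
  t.dltbar (t.dltbar (t.Psi2 G)) x + 2 * t.alpha G x * t.dltbar (t.Psi2 G) x +
    2 * k * (t.dltbar (t.dltbar (t.phi1 F)) x +
      2 * t.alpha G x * t.dltbar (t.phi1 F) x) * conj (t.phi1 F x) +
    k * t.dltbar (t.phi1 F) x * t.dltbar (fun y => conj (t.phi1 F y)) x

end TetradCoeffs

/-- The gauge conditions on the tetrad: it is a smooth complex null tetrad on the coordinate
domain, `U = X^A = ω = 0` on `H₂`, it is parallelly propagated along the geodesics with tangent
`ℓ = ∂_r`, and `γ = 0` on `H₂`. -/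
structure IsAdaptedTetrad {M : Type*} [TopologicalSpace M] [ChartedSpace R4 M]
    [IsManifold 𝓘(ℝ, R4) ∞ M] {S : Electrovacuum M} {H₁ H₂ : Set M}
    (P : GaussianNullPatch S H₁ H₂) (t : TetradCoeffs) : Prop where
  U_smooth : ContDiffOn ℝ ∞ t.U P.chart.target
  X_smooth : ContDiffOn ℝ ∞ t.X P.chart.target
  om_smooth : ContDiffOn ℝ ∞ t.om P.chart.target
  xi_smooth : ContDiffOn ℝ ∞ t.xi P.chart.target
  nullTetrad : ∀ x ∈ P.chart.target,
    IsNullTetradAt (chartComp S.g P.chart) x (t.l x) (t.n x) (t.m x)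
  on_H₂ : ∀ x ∈ P.chart.target, x 1 = 0 → t.U x = 0 ∧ t.X x = 0 ∧ t.om x = 0
  parallel_l : ∀ x ∈ P.chart.target, covDeriv (chartComp S.g P.chart) (t.l x) t.l x = 0
  parallel_n : ∀ x ∈ P.chart.target, covDeriv (chartComp S.g P.chart) (t.l x) t.n x = 0
  parallel_m : ∀ x ∈ P.chart.target, covDeriv (chartComp S.g P.chart) (t.l x) t.m x = 0
  gamma_H₂ : ∀ x ∈ P.chart.target, x 1 = 0 → t.gamma (chartComp S.g P.chart) x = 0

/-! The argument runs in the Newman-Penrose formalism, with D = ∂_r, Δ = n^a ∂_a, δ = m^a ∂_a. The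
tetrad is parallel along ℓ = ∂_r and ℓ_a = (du)_a, so the spin coefficients κ, ε, π vanish, ρ is
real and τ = ᾱ + β. The Ricci identity `riemC_frame`, together with the field equations in the frame
(`riemann_values`, `maxwell_equations`), yields the system `NPSystem`. Bianchi identities are not
part of that system; derivatives of curvature are obtained instead by differentiating the equations
for the spin coefficients and commuting derivatives.

On u = 0 the congruence has ρ = σ = 0. The Raychaudhuri equation Dρ = ρ² + |σ|² + 2|φ₀|² forces φ₀ =
0, and the equations for Dσ and δρ give Ψ₀ = Ψ₁ = 0. Then τ, α, β, φ₁, Ψ₂ do not depend on r. Since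
[D, δ] = -τD + ρδ + σδ̄, the operators δ and δ̄ preserve independence of r, so the radial equations
have polynomial solutions: λ = 0, while μ, φ₂, Ψ₃ are linear and ν is quadratic. The component Ψ₄ is
read off from the equation for Δλ - δ̄ν, where the transverse derivative Δλ comes from
differentiating the equation for Dλ in u (`Delta_lam₁`).

On r = 0 one has μ = λ = ν = 0, and γ = 0 by the gauge. Raychaudhuri for n gives φ₂ = 0, then Ψ₃ =
Ψ₄ = 0, and α, β, τ, φ₁, Ψ₂ do not depend on u. Now ρ, σ, φ₀, Ψ₁ are linear in u. The hard component
is Ψ₀ = Dσ - 2ρσ: its u-derivative requires the commutator of D and Δ on σ, and the result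
simplifies only after using the commutator of δ and δ̄ on τ (`dl_rhoRate`) and the reality of ∂_u ρ
(`Delta_Psi0_eq₂`).

Along the generators of r = 0 the tetrad is not parallel: ∇_n m = -τ n and ∇_n ℓ = -τ̄ m - τ m̄. The
null rotation about n with parameter b = uτ repairs this, and because Ψ₃ = Ψ₄ = φ₂ = 0 it acts by
Ψ₁' = Ψ₁ + 3bΨ₂, Ψ₀' = Ψ₀ + 4bΨ₁ + 6b²Ψ₂, φ₀' = φ₀ + 2bφ₁ (`weyl_rot`, `ricci_rot`). This removes
the undifferentiated terms in Ψ₂ and φ₁ from the rates.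

The components are therefore monomials in the affine parameter with coefficients fixed at z. If δ̄φ₁
≠ 0 at z, then Φ₂₂ grows quadratically; if it vanishes, all correction terms drop out and Ψ₃ or Ψ₄
diverges according to which of Ψ̃₃, Ψ̃₄ is nonzero. The second horizon is treated in the same way.
-/

/-! ## Calculus of smooth complex functions on an open coordinate domain -/

/-- A complex function which is smooth on the coordinate domain `T`. -/
def Sm (T : Set R4) (f : R4 → ℂ) : Prop := ContDiffOn ℝ ∞ f T

section calculus

variable {T : Set R4} {f g : R4 → ℂ} {x : R4} {μ ν : Fin 4}

namespace Sm

theorem const (c : ℂ) : Sm T (fun _ => c) := contDiffOn_const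

theorem add (hf : Sm T f) (hg : Sm T g) : Sm T (fun x => f x + g x) := ContDiffOn.add hf hg

theorem sub (hf : Sm T f) (hg : Sm T g) : Sm T (fun x => f x - g x) := ContDiffOn.sub hf hg

theorem neg (hf : Sm T f) : Sm T (fun x => -f x) := ContDiffOn.neg hf

theorem mul (hf : Sm T f) (hg : Sm T g) : Sm T (fun x => f x * g x) := ContDiffOn.mul hf hg

theorem sum {ι : Type*} {s : Finset ι} {f : ι → R4 → ℂ} (hf : ∀ i ∈ s, Sm T (f i)) :
    Sm T (fun x => ∑ i ∈ s, f i x) := ContDiffOn.sum hf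

theorem cj (hf : Sm T f) : Sm T (fun x => (starRingEnd ℂ) (f x)) :=
  Complex.conjCLE.contDiff.comp_contDiffOn hf

theorem ofReal {h : R4 → ℝ} (hh : ContDiffOn ℝ ∞ h T) : Sm T (fun x => (h x : ℂ)) :=
  Complex.ofRealCLM.contDiff.comp_contDiffOn hh

theorem coord (μ : Fin 4) : Sm T (fun x => (x μ : ℂ)) :=
  ofReal (EuclideanSpace.proj μ : R4 →L[ℝ] ℝ).contDiff.contDiffOn

theorem congr (hf : Sm T f) (h : ∀ x ∈ T, g x = f x) : Sm T g := ContDiffOn.congr hf h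

theorem diff (hT : IsOpen T) (hf : Sm T f) (hx : x ∈ T) : DifferentiableAt ℝ f x :=
  (ContDiffOn.contDiffAt hf (hT.mem_nhds hx)).differentiableAt (by simp)

theorem pd (hT : IsOpen T) (hf : Sm T f) (μ : Fin 4) : Sm T (pd μ f) := by
  have h := hf.fderiv_of_isOpen hT (m := ∞) (by simp)
  exact h.clm_apply contDiffOn_const

end Sm

theorem pd_congr (hT : IsOpen T) (hx : x ∈ T) (h : ∀ y ∈ T, f y = g y) : pd μ f x = pd μ g x := by
  have : f =ᶠ[𝓝 x] g := Filter.eventuallyEq_of_mem (hT.mem_nhds hx) h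
  simp only [pd, this.fderiv_eq]

theorem pd_const (c : ℂ) : pd μ (fun _ => c) x = 0 := by simp [pd]

theorem pd_add (hf : DifferentiableAt ℝ f x) (hg : DifferentiableAt ℝ g x) :
    pd μ (fun y => f y + g y) x = pd μ f x + pd μ g x := by
  simp [pd, fderiv_fun_add hf hg]

theorem pd_sub (hf : DifferentiableAt ℝ f x) (hg : DifferentiableAt ℝ g x) :
    pd μ (fun y => f y - g y) x = pd μ f x - pd μ g x := by
  simp [pd, fderiv_fun_sub hf hg]

theorem pd_neg : pd μ (fun y => -f y) x = -pd μ f x := by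
  simp [pd]

theorem pd_mul (hf : DifferentiableAt ℝ f x) (hg : DifferentiableAt ℝ g x) :
    pd μ (fun y => f y * g y) x = pd μ f x * g x + f x * pd μ g x := by
  simp [pd, fderiv_fun_mul hf hg]; ring

theorem pd_sum {ι : Type*} {s : Finset ι} {f : ι → R4 → ℂ}
    (hf : ∀ i ∈ s, DifferentiableAt ℝ (f i) x) :
    pd μ (fun y => ∑ i ∈ s, f i y) x = ∑ i ∈ s, pd μ (f i) x := by
  simp [pd, fderiv_fun_sum hf]

theorem pd_conj : pd μ (fun y => conj (f y)) x = conj (pd μ f x) := by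
  have := Complex.conjCLE.comp_fderiv (f := f) (x := x)
  have h2 : (fun y => conj (f y)) = ⇑Complex.conjCLE ∘ f := rfl
  rw [pd, h2, this]; rfl

theorem pd_ofReal {h : R4 → ℝ} (hh : DifferentiableAt ℝ h x) :
    pd μ (fun y => (h y : ℂ)) x = ((pd μ h x : ℝ) : ℂ) := by
  have := (Complex.ofRealCLM.hasFDerivAt.comp x hh.hasFDerivAt).fderiv
  have h2 : (fun y => (h y : ℂ)) = ⇑Complex.ofRealCLM ∘ h := rfl
  rw [pd, h2, this]; rfl

theorem pd_coord : pd μ (fun y => (y ν : ℂ)) x = if ν = μ then 1 else 0 := by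
  have h1 : HasFDerivAt (fun y : R4 => y ν)
      (EuclideanSpace.proj ν : R4 →L[ℝ] ℝ) x :=
    (EuclideanSpace.proj ν : R4 →L[ℝ] ℝ).hasFDerivAt
  rw [pd_ofReal h1.differentiableAt, pd, h1.fderiv]
  simp only [EuclideanSpace.coe_proj, PiLp.single_apply]
  split_ifs <;> simp

theorem pd_comm (hT : IsOpen T) (hf : Sm T f) (hx : x ∈ T) :
    pd μ (pd ν f) x = pd ν (pd μ f) x := by
  have hc : ContDiffAt ℝ ∞ f x := ContDiffOn.contDiffAt hf (hT.mem_nhds hx)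
  have hd : DifferentiableAt ℝ (fderiv ℝ f) x :=
    (hc.fderiv_right (m := ∞) (by simp)).differentiableAt (by simp)
  have hs : IsSymmSndFDerivAt ℝ f x := hc.isSymmSndFDerivAt (by
    rw [minSmoothness_of_isRCLikeNormedField]; exact WithTop.coe_le_coe.2 le_top)
  have key : ∀ a b : Fin 4, pd a (pd b f) x =
      fderiv ℝ (fderiv ℝ f) x (EuclideanSpace.single a 1) (EuclideanSpace.single b 1) := by
    intro a b
    have := (hd.hasFDerivAt.clm_apply
      (hasFDerivAt_const (EuclideanSpace.single b (1 : ℝ)) x)).fderiv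
    simp only [pd] at *
    change fderiv ℝ (fun y => (fderiv ℝ f y) (EuclideanSpace.single b 1)) x _ = _
    rw [this]; simp
  rw [key, key]; exact hs _ _

/-! ### Restriction to coordinate hyperplanes and lines -/

/-- Reduces partial derivatives to derivatives along coordinate lines, so that uniqueness of
one-variable derivatives applies to functions that agree only on a hyperplane. -/
theorem hasDerivAt_shift (hf : DifferentiableAt ℝ f x) :
    HasDerivAt (fun s : ℝ => f (x + s • EuclideanSpace.single μ (1 : ℝ))) (pd μ f x) 0 := by
  have h1 : HasDerivAt (fun s : ℝ => x + s • EuclideanSpace.single μ (1 : ℝ))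
      (EuclideanSpace.single μ (1 : ℝ)) 0 := by
    simpa using ((hasDerivAt_id (0 : ℝ)).smul_const
      (EuclideanSpace.single μ (1 : ℝ))).const_add x
  have h2 : HasFDerivAt f (fderiv ℝ f x) (x + (0 : ℝ) • EuclideanSpace.single μ (1 : ℝ)) := by
    simpa using hf.hasFDerivAt
  exact h2.comp_hasDerivAt 0 h1

/-- Derivatives tangent to a coordinate hyperplane depend only on the restriction to it. -/
theorem pd_slice {i : Fin 4} {c : ℝ} (hT : IsOpen T) (hf : Sm T f) (hg : Sm T g)
    (h : ∀ y ∈ T, y i = c → f y = g y) (hx : x ∈ T) (hxi : x i = c) (hμ : μ ≠ i) :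
    pd μ f x = pd μ g x := by
  have hf' := hasDerivAt_shift (μ := μ) (hf.diff hT hx)
  have hg' := hasDerivAt_shift (μ := μ) (hg.diff hT hx)
  have hc : ContinuousAt (fun s : ℝ => x + s • EuclideanSpace.single μ (1 : ℝ)) 0 := by
    fun_prop
  have hm : ∀ᶠ s in 𝓝 (0 : ℝ), x + s • EuclideanSpace.single μ (1 : ℝ) ∈ T :=
    hc.eventually_mem (by simpa using hT.mem_nhds hx)
  have he : (fun s : ℝ => f (x + s • EuclideanSpace.single μ (1 : ℝ))) =ᶠ[𝓝 0]
      (fun s : ℝ => g (x + s • EuclideanSpace.single μ (1 : ℝ))) := by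
    filter_upwards [hm] with s hs
    refine h _ hs ?_
    simp [hxi, hμ.symm]
  exact hf'.unique (hg'.congr_of_eventuallyEq he)

theorem pd_slice_const {i : Fin 4} {c : ℝ} {k : ℂ} (hT : IsOpen T) (hf : Sm T f)
    (h : ∀ y ∈ T, y i = c → f y = k) (hx : x ∈ T) (hxi : x i = c) (hμ : μ ≠ i) :
    pd μ f x = 0 := by
  rw [pd_slice hT hf (Sm.const k) h hx hxi hμ, pd_const]

theorem pt_eta (x : R4) : pt (x 0) (x 1) (x 2) (x 3) = x := by
  refine PiLp.ext fun i => ?_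
  fin_cases i <;> simp [pt]

theorem hasDerivAt_pt_zero (hf : Sm T f) (hT : IsOpen T) {u r a b : ℝ} (hx : pt u r a b ∈ T) :
    HasDerivAt (fun s : ℝ => f (pt s r a b)) (pd 0 f (pt u r a b)) u := by
  have h := hasDerivAt_shift (μ := 0) (hf.diff hT hx)
  have h2 := HasDerivAt.comp_sub_const (x := u) (a := u) (by simpa using h)
  refine h2.congr_of_eventuallyEq (Eventually.of_forall fun s => ?_)
  refine congrArg f (PiLp.ext fun i => ?_)
  fin_cases i <;> simp [pt]

theorem hasDerivAt_pt_one (hf : Sm T f) (hT : IsOpen T) {u r a b : ℝ} (hx : pt u r a b ∈ T) :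
    HasDerivAt (fun s : ℝ => f (pt u s a b)) (pd 1 f (pt u r a b)) r := by
  have h := hasDerivAt_shift (μ := 1) (hf.diff hT hx)
  have h2 := HasDerivAt.comp_sub_const (x := r) (a := r) (by simpa using h)
  refine h2.congr_of_eventuallyEq (Eventually.of_forall fun s => ?_)
  refine congrArg f (PiLp.ext fun i => ?_)
  fin_cases i <;> simp [pt]

end calculus

/-! ## Complex null tetrads on a coordinate domain -/

/-- The matrix of products of a complex null tetrad `(ℓ, n, m, m̄)`. -/
def eta (i j : Fin 4) : ℂ :=
  ![![0, 1, 0, 0], ![1, 0, 0, 0], ![0, 0, 0, -1], ![0, 0, -1, 0]] i j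

/-- Complex conjugation of tetrad indices. -/
def bar (i : Fin 4) : Fin 4 := ![0, 1, 3, 2] i

theorem eta_sum (f : Fin 4 → Fin 4 → ℂ) :
    ∑ p, ∑ q, eta p q * f p q = f 0 1 + f 1 0 - f 2 3 - f 3 2 := by
  simp [Fin.sum_univ_four, eta]; ring

/-- A smooth complex null tetrad `E 0, E 1, E 2, E 3 = ℓ, n, m, m̄` of a smooth metric. -/
structure SmoothTetrad (T : Set R4) (G : MetricComp) (E : Fin 4 → R4 → Fin 4 → ℂ) : Prop where
  isOpen : IsOpen T
  symm : ∀ x a b, G x a b = G x b a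
  g_smooth : ∀ a b, ContDiffOn ℝ ∞ (fun x => G x a b) T
  e_smooth : ∀ i a, Sm T (fun x => E i x a)
  gram : ∀ x ∈ T, ∀ i j, ip G x (E i x) (E j x) = eta i j
  real : ∀ x i, conjV (E i x) = E (bar i) x

section ip

variable {G : MetricComp} {x : R4}

theorem ip_add_left (v v' w : Fin 4 → ℂ) : ip G x (v + v') w = ip G x v w + ip G x v' w := by
  simp [ip, mul_add, add_mul, Finset.sum_add_distrib]

theorem ip_smul_left (c : ℂ) (v w : Fin 4 → ℂ) : ip G x (c • v) w = c * ip G x v w := by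
  simp only [ip, Pi.smul_apply, smul_eq_mul, Finset.mul_sum]
  refine Finset.sum_congr rfl fun a _ => Finset.sum_congr rfl fun b _ => by ring

theorem ip_comm (h : ∀ x a b, G x a b = G x b a) (v w : Fin 4 → ℂ) :
    ip G x v w = ip G x w v := by
  simp only [ip]
  rw [Finset.sum_comm]
  refine Finset.sum_congr rfl fun a _ => Finset.sum_congr rfl fun b _ => by rw [h x b a]; ring

theorem ip_add_right (v w w' : Fin 4 → ℂ) : ip G x v (w + w') = ip G x v w + ip G x v w' := by
  simp [ip, mul_add, Finset.sum_add_distrib]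

theorem ip_sub_right (v w w' : Fin 4 → ℂ) : ip G x v (w - w') = ip G x v w - ip G x v w' := by
  simp [ip, mul_sub, Finset.sum_sub_distrib]

theorem ip_smul_right (c : ℂ) (v w : Fin 4 → ℂ) : ip G x v (c • w) = c * ip G x v w := by
  simp only [ip, Pi.smul_apply, smul_eq_mul, Finset.mul_sum]
  refine Finset.sum_congr rfl fun a _ => Finset.sum_congr rfl fun b _ => by ring

theorem ip_zero_right (v : Fin 4 → ℂ) : ip G x v 0 = 0 := by simp [ip]

theorem ip_sum_right {ι : Type*} (s : Finset ι) (v : Fin 4 → ℂ) (w : ι → Fin 4 → ℂ) :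
    ip G x v (∑ i ∈ s, w i) = ∑ i ∈ s, ip G x v (w i) := by
  classical
  induction s using Finset.induction_on with
  | empty => simp [ip_zero_right]
  | insert a s ha ih => rw [Finset.sum_insert ha, Finset.sum_insert ha, ip_add_right, ih]

theorem conj_ip (v w : Fin 4 → ℂ) : conj (ip G x v w) = ip G x (conjV v) (conjV w) := by
  simp [ip, conjV]

end ip

/-- The covariant derivative `∇_c V^a`. -/
noncomputable def cov (G : MetricComp) (c : Fin 4) (V : R4 → Fin 4 → ℂ) (x : R4) : Fin 4 → ℂ :=
  fun a => pd c (fun y => V y a) x + ∑ d, (christoffel G a c d x : ℂ) * V x d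

theorem covDeriv_eq (G : MetricComp) (W : Fin 4 → ℂ) (V : R4 → Fin 4 → ℂ) (x : R4) :
    covDeriv G W V x = ∑ b, W b • cov G b V x := by
  funext a; simp [covDeriv, cov]

/-- The derivative of a scalar in the direction of a vector. -/
noncomputable def dir (W : Fin 4 → ℂ) (f : R4 → ℂ) (x : R4) : ℂ := ∑ a, W a * pd a f x

theorem christoffel_symm {G : MetricComp} (h : ∀ x a b, G x a b = G x b a) (a b c : Fin 4)
    (x : R4) : christoffel G a b c x = christoffel G a c b x := by
  unfold christoffel
  congr 1
  refine Finset.sum_congr rfl fun k _ => ?_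
  have : (fun y => G y b c) = fun y => G y c b := funext fun y => h y b c
  rw [this]; ring

/-! ### Inverse metric and metric compatibility in a tetrad -/

namespace SmoothTetrad

variable {T : Set R4} {G : MetricComp} {E : Fin 4 → R4 → Fin 4 → ℂ} (h : SmoothTetrad T G E)

include h

/-- With A the matrix of frame vectors, the products read A g Aᵀ = η. As η² = 1, the matrix g Aᵀ η
is a right inverse of A, hence also a left inverse; this is the completeness relation of the tetrad.
-/
theorem gram_matrix {x : R4} (hx : x ∈ T) :
    (G x).map (fun r : ℝ => (r : ℂ)) *
      Matrix.of (fun a b => ∑ p, ∑ q, eta p q * (E p x a * E q x b)) = 1 := by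
  set A : Matrix (Fin 4) (Fin 4) ℂ := Matrix.of fun i a => E i x a with hA
  set η : Matrix (Fin 4) (Fin 4) ℂ := Matrix.of eta with hη
  set g := (G x).map (fun r : ℝ => (r : ℂ)) with hg
  have h1 : A * (g * A.transpose) = η := by
    ext i j
    rw [hη, Matrix.of_apply, ← h.gram x hx i j]
    simp only [Matrix.mul_apply, hA, hg, ip, Matrix.of_apply, Matrix.transpose_apply,
      Matrix.map_apply, Finset.mul_sum]
    refine Finset.sum_congr rfl fun a _ => Finset.sum_congr rfl fun b _ => by ring
  have h2 : η * η = 1 := by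
    ext i j
    fin_cases i <;> fin_cases j <;>
      simp [hη, Matrix.mul_apply, Fin.sum_univ_four, eta]
  have h3 : A * (g * A.transpose * η) = 1 := by rw [← Matrix.mul_assoc, h1, h2]
  have h4 := mul_eq_one_comm.1 h3
  have h5 : g * (A.transpose * η * A) = 1 := by
    rw [← h4]; simp only [Matrix.mul_assoc]
  rw [← h5]
  congr 1
  ext a b
  simp only [Matrix.mul_apply, hA, hη, Matrix.of_apply, Matrix.transpose_apply, Finset.sum_mul]
  rw [Finset.sum_comm]
  refine Finset.sum_congr rfl fun a _ => Finset.sum_congr rfl fun b _ => by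
    ring

/-- Nondegeneracy of the metric follows from the completeness relation: the determinant of g divides
1. -/
theorem inv_gram {x : R4} (hx : x ∈ T) : G x * (G x)⁻¹ = 1 := by
  have h1 := congrArg Matrix.det (h.gram_matrix hx)
  rw [Matrix.det_mul, Matrix.det_one] at h1
  have h2 : ((G x).map (fun r : ℝ => (r : ℂ))).det = ((G x).det : ℂ) := by
    have := RingHom.map_det Complex.ofRealHom (G x)
    exact this.symm
  refine Matrix.mul_nonsing_inv _ (isUnit_iff_ne_zero.2 fun h0 => ?_)
  rw [h2, h0] at h1
  simp at h1

theorem inv_eq {x : R4} (hx : x ∈ T) (a b : Fin 4) :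
    (((G x)⁻¹ a b : ℝ) : ℂ) = ∑ p, ∑ q, eta p q * (E p x a * E q x b) := by
  have h1 : (G x).map (fun r : ℝ => (r : ℂ)) * ((G x)⁻¹).map (fun r : ℝ => (r : ℂ)) = 1 := by
    have h2 := congrArg (fun M => M.map Complex.ofRealHom) (h.inv_gram hx)
    simp only [Matrix.map_mul] at h2
    refine h2.trans ?_
    simp
  have h3 := mul_eq_one_comm.1 h1
  have h4 : ((G x)⁻¹).map (fun r : ℝ => (r : ℂ)) =
      Matrix.of (fun a b => ∑ p, ∑ q, eta p q * (E p x a * E q x b)) := by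
    calc _ = ((G x)⁻¹).map (fun r : ℝ => (r : ℂ)) * ((G x).map (fun r : ℝ => (r : ℂ)) *
      Matrix.of (fun a b => ∑ p, ∑ q, eta p q * (E p x a * E q x b))) := by
          rw [h.gram_matrix hx, mul_one]
      _ = _ := by rw [← mul_assoc, h3, one_mul]
  exact congrFun (congrFun h4 a) b

theorem expand {x : R4} (hx : x ∈ T) (v : Fin 4 → ℂ) :
    v = ∑ p, ∑ q, (eta p q * ip G x (E p x) v) • E q x := by
  have h1 := mul_eq_one_comm.1 (h.gram_matrix hx)
  funext a
  have h2 := congrFun (congrArg (fun M => M.mulVec v) h1) a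
  rw [Matrix.one_mulVec] at h2
  have hs := h.symm x
  rw [← h2]
  simp only [Matrix.mulVec, dotProduct, Matrix.mul_apply, Matrix.of_apply, Matrix.map_apply, ip,
    Finset.sum_apply, Fin.sum_univ_four, eta]
  rw [hs 1 0, hs 2 0, hs 3 0, hs 2 1, hs 3 1, hs 3 2]
  simp
  ring

theorem g_sm (a b : Fin 4) : Sm T (fun x => (G x a b : ℂ)) := Sm.ofReal (h.g_smooth a b)

theorem g_diff {x : R4} (hx : x ∈ T) (a b : Fin 4) :
    DifferentiableAt ℝ (fun y => G y a b) x :=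
  ((h.g_smooth a b).contDiffAt (h.isOpen.mem_nhds hx)).differentiableAt (by simp)

/-- Smoothness is read from the tetrad formula for the inverse metric; the real part brings that
complex expression back to ℝ. -/
theorem inv_smooth (a b : Fin 4) : ContDiffOn ℝ ∞ (fun x => (G x)⁻¹ a b) T := by
  have h1 : Sm T (fun x => ∑ p, ∑ q, eta p q * (E p x a * E q x b)) :=
    Sm.sum fun p _ => Sm.sum fun q _ => (Sm.const _).mul ((h.e_smooth p a).mul (h.e_smooth q b))
  have h2 : ContDiffOn ℝ ∞ (fun x => (∑ p, ∑ q, eta p q * (E p x a * E q x b)).re) T :=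
    Complex.reCLM.contDiff.comp_contDiffOn h1
  refine h2.congr fun x hx => ?_
  rw [← h.inv_eq hx, Complex.ofReal_re]

theorem pd_smooth_real {f : R4 → ℝ} (hf : ContDiffOn ℝ ∞ f T) (μ : Fin 4) :
    ContDiffOn ℝ ∞ (pd μ f) T :=
  (hf.fderiv_of_isOpen h.isOpen (m := ∞) (by simp)).clm_apply contDiffOn_const

theorem christoffel_smooth (a b c : Fin 4) : ContDiffOn ℝ ∞ (christoffel G a b c) T := by
  refine contDiffOn_const.mul (ContDiffOn.sum fun k _ => (h.inv_smooth a k).mul ?_)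
  exact ((h.pd_smooth_real (h.g_smooth k c) b).add (h.pd_smooth_real (h.g_smooth k b) c)).sub
    (h.pd_smooth_real (h.g_smooth b c) k)

theorem christoffel_sm (a b c : Fin 4) : Sm T (fun x => (christoffel G a b c x : ℂ)) :=
  Sm.ofReal (h.christoffel_smooth a b c)

theorem christoffel_diff {x : R4} (hx : x ∈ T) (a b c : Fin 4) :
    DifferentiableAt ℝ (christoffel G a b c) x :=
  ((h.christoffel_smooth a b c).contDiffAt (h.isOpen.mem_nhds hx)).differentiableAt (by simp)

theorem lower_christoffel {x : R4} (hx : x ∈ T) (k b c : Fin 4) :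
    ∑ a, G x k a * christoffel G a b c x = (1 / 2) *
      (pd b (fun y => G y k c) x + pd c (fun y => G y k b) x - pd k (fun y => G y b c) x) := by
  set S : Fin 4 → ℝ := fun k =>
    pd b (fun y => G y k c) x + pd c (fun y => G y k b) x - pd k (fun y => G y b c) x with hS
  have h1 : (G x * (G x)⁻¹).mulVec S = S := by rw [h.inv_gram hx, Matrix.one_mulVec]
  have h2 := congrFun h1 k
  rw [← Matrix.mulVec_mulVec] at h2
  change _ = 1 / 2 * S k
  rw [← h2]
  simp only [Matrix.mulVec, dotProduct, christoffel, Finset.mul_sum]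
  refine Finset.sum_congr rfl fun a _ => Finset.sum_congr rfl fun b _ => by ring

theorem pd_metric {x : R4} (hx : x ∈ T) (c a b : Fin 4) :
    pd c (fun y => G y a b) x =
      ∑ d, (G x a d * christoffel G d c b x + G x b d * christoffel G d c a x) := by
  rw [Finset.sum_add_distrib, h.lower_christoffel hx, h.lower_christoffel hx]
  have e : ∀ i j, (fun y => G y i j) = fun y => G y j i := fun i j => funext fun y => h.symm y i j
  rw [e b a, e c a, e c b]; ring

/-- Metric compatibility of the Levi-Civita connection, in product-rule form: ∂_c g_{ab} is replaced
by Christoffel symbols, which are exactly those completing the two ordinary derivatives to covariant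
ones. -/
theorem pd_ip {x : R4} (hx : x ∈ T) (c : Fin 4) {V W : R4 → Fin 4 → ℂ}
    (hV : ∀ a, Sm T (fun y => V y a)) (hW : ∀ a, Sm T (fun y => W y a)) :
    pd c (fun y => ip G y (V y) (W y)) x =
      ip G x (cov G c V x) (W x) + ip G x (V x) (cov G c W x) := by
  have d1 : ∀ a b, DifferentiableAt ℝ (fun y => (G y a b : ℂ)) x :=
    fun a b => (h.g_sm a b).diff h.isOpen hx
  have d2 : ∀ a, DifferentiableAt ℝ (fun y => V y a) x := fun a => (hV a).diff h.isOpen hx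
  have d3 : ∀ a, DifferentiableAt ℝ (fun y => W y a) x := fun a => (hW a).diff h.isOpen hx
  have e1 : pd c (fun y => ip G y (V y) (W y)) x = ∑ a, ∑ b,
      ((pd c (fun y => (G y a b : ℂ)) x * V x a + G x a b * pd c (fun y => V y a) x) * W x b
        + G x a b * V x a * pd c (fun y => W y b) x) := by
    simp only [ip]
    rw [pd_sum fun a _ => DifferentiableAt.fun_sum fun b _ => ((d1 a b).fun_mul (d2 a)).fun_mul (d3 b)]
    refine Finset.sum_congr rfl fun a _ => ?_
    rw [pd_sum fun b _ => ((d1 a b).fun_mul (d2 a)).fun_mul (d3 b)]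
    refine Finset.sum_congr rfl fun b _ => ?_
    rw [pd_mul ((d1 a b).fun_mul (d2 a)) (d3 b), pd_mul (d1 a b) (d2 a)]
  rw [e1]
  have e2 : ∀ a b, pd c (fun y => (G y a b : ℂ)) x =
      ∑ d, ((G x a d : ℂ) * christoffel G d c b x + G x b d * christoffel G d c a x) := by
    intro a b
    rw [pd_ofReal (h.g_diff hx a b), h.pd_metric hx]; push_cast; rfl
  have e3 : ∑ a, ∑ b, (∑ d, (G x a d : ℂ) * christoffel G d c b x) * V x a * W x b =
      ∑ a, ∑ b, (G x a b : ℂ) * V x a * ∑ d, (christoffel G b c d x : ℂ) * W x d := by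
    refine Finset.sum_congr rfl fun a _ => ?_
    simp only [Finset.mul_sum, Finset.sum_mul]
    rw [Finset.sum_comm]
    refine Finset.sum_congr rfl fun b _ => Finset.sum_congr rfl fun d _ => by ring
  have e4 : ∑ a, ∑ b, (∑ d, (G x b d : ℂ) * christoffel G d c a x) * V x a * W x b =
      ∑ a, ∑ b, (G x a b : ℂ) * (∑ d, (christoffel G a c d x : ℂ) * V x d) * W x b := by
    rw [Finset.sum_comm]
    conv_rhs => rw [Finset.sum_comm]
    refine Finset.sum_congr rfl fun b _ => ?_
    simp only [Finset.mul_sum, Finset.sum_mul]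
    rw [Finset.sum_comm]
    refine Finset.sum_congr rfl fun a _ => Finset.sum_congr rfl fun d _ => by
      rw [h.symm x b a]; ring
  have e5 : ip G x (cov G c V x) (W x) + ip G x (V x) (cov G c W x) =
      ∑ a, ∑ b, ((G x a b : ℂ) * pd c (fun y => V y a) x * W x b
        + G x a b * V x a * pd c (fun y => W y b) x) +
      (∑ a, ∑ b, (G x a b : ℂ) * (∑ d, (christoffel G a c d x : ℂ) * V x d) * W x b +
       ∑ a, ∑ b, (G x a b : ℂ) * V x a * ∑ d, (christoffel G b c d x : ℂ) * W x d) := by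
    simp only [ip, cov, ← Finset.sum_add_distrib]
    refine Finset.sum_congr rfl fun a _ => Finset.sum_congr rfl fun b _ => by ring
  rw [e5, ← e3, ← e4]
  simp only [← Finset.sum_add_distrib]
  refine Finset.sum_congr rfl fun a _ => Finset.sum_congr rfl fun b _ => ?_
  rw [e2, Finset.sum_add_distrib]; ring

theorem cov_smooth (c : Fin 4) {V : R4 → Fin 4 → ℂ} (hV : ∀ a, Sm T (fun y => V y a)) (a : Fin 4) :
    Sm T (fun y => cov G c V y a) :=
  ((hV a).pd h.isOpen c).add (Sm.sum fun d _ => (h.christoffel_sm a c d).mul (hV d))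

theorem covDeriv_smooth {V W : R4 → Fin 4 → ℂ} (hV : ∀ a, Sm T (fun y => V y a))
    (hW : ∀ a, Sm T (fun y => W y a)) (a : Fin 4) :
    Sm T (fun y => covDeriv G (W y) V y a) :=
  Sm.sum fun b _ => (hW b).mul (h.cov_smooth b hV a)

theorem ip_smooth {V W : R4 → Fin 4 → ℂ} (hV : ∀ a, Sm T (fun y => V y a))
    (hW : ∀ a, Sm T (fun y => W y a)) : Sm T (fun y => ip G y (V y) (W y)) :=
  Sm.sum fun a _ => Sm.sum fun b _ => ((h.g_sm a b).mul (hV a)).mul (hW b)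

end SmoothTetrad

/-! ## Connection coefficients and the Ricci identity -/

/-- The connection coefficients `E_k · ∇_{E_i} E_j` of a tetrad. -/
noncomputable def conn (G : MetricComp) (E : Fin 4 → R4 → Fin 4 → ℂ) (i j k : Fin 4) (x : R4) : ℂ :=
  ip G x (E k x) (covDeriv G (E i x) (E j) x)

/-- The contraction `R_{abcd} v^a w^b y^c z^d`. -/
noncomputable def riemC (G : MetricComp) (x : R4) (v w y z : Fin 4 → ℂ) : ℂ :=
  ∑ a, ∑ b, ∑ c, ∑ d, (riemannDown G a b c d x : ℂ) * v a * w b * y c * z d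

theorem riemC_eq_ip (G : MetricComp) (x : R4) (v w y z : Fin 4 → ℂ) :
    riemC G x v w y z =
      ip G x v (fun e => ∑ b, ∑ c, ∑ d, (riemannUp G e b c d x : ℂ) * w b * y c * z d) := by
  simp only [riemC, ip, riemannDown]
  refine Finset.sum_congr rfl fun a _ => ?_
  push_cast
  simp only [Finset.sum_mul, Finset.mul_sum]
  have e1 : ∀ b : Fin 4, ∑ c, ∑ d, ∑ e, ((G x a e : ℂ) * riemannUp G e b c d x) * v a * w b * y c * z d
      = ∑ e, ∑ c, ∑ d, ((G x a e : ℂ) * riemannUp G e b c d x) * v a * w b * y c * z d := by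
    intro b
    conv_rhs => rw [Finset.sum_comm]
    refine Finset.sum_congr rfl fun c _ => ?_
    rw [Finset.sum_comm]
  simp only [e1]
  rw [Finset.sum_comm]
  refine Finset.sum_congr rfl fun e _ => Finset.sum_congr rfl fun b _ =>
    Finset.sum_congr rfl fun c _ => Finset.sum_congr rfl fun d _ => by ring

namespace SmoothTetrad

variable {T : Set R4} {G : MetricComp} {E : Fin 4 → R4 → Fin 4 → ℂ} (h : SmoothTetrad T G E)

include h

/-- The Ricci identity for second covariant derivatives along coordinate vectors. -/
theorem cov_comm {V : R4 → Fin 4 → ℂ} (hV : ∀ a, Sm T (fun y => V y a)) {x : R4} (hx : x ∈ T)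
    (a c d : Fin 4) :
    cov G c (cov G d V) x a - cov G d (cov G c V) x a =
      ∑ b, (riemannUp G a b c d x : ℂ) * V x b := by
  have dV : ∀ a, DifferentiableAt ℝ (fun y => V y a) x := fun a => (hV a).diff h.isOpen hx
  have dpV : ∀ μ a, DifferentiableAt ℝ (pd μ (fun y => V y a)) x :=
    fun μ a => ((hV a).pd h.isOpen μ).diff h.isOpen hx
  have dΓ : ∀ a b c, DifferentiableAt ℝ (fun y => (christoffel G a b c y : ℂ)) x :=
    fun a b c => (h.christoffel_sm a b c).diff h.isOpen hx
  have key : ∀ c d, pd c (fun y => cov G d V y a) x = pd c (pd d (fun y => V y a)) x +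
      ∑ b, ((pd c (christoffel G a d b) x : ℝ) * V x b +
        (christoffel G a d b x : ℂ) * pd c (fun y => V y b) x) := by
    intro c d
    simp only [cov]
    rw [pd_add (dpV d a) (DifferentiableAt.fun_sum fun b _ => (dΓ a d b).fun_mul (dV b)),
      pd_sum fun b _ => (dΓ a d b).fun_mul (dV b)]
    congr 1
    refine Finset.sum_congr rfl fun b _ => ?_
    rw [pd_mul (dΓ a d b) (dV b), pd_ofReal (h.christoffel_diff hx a d b)]
  have key2 : ∀ c d, cov G c (cov G d V) x a = pd c (fun y => cov G d V y a) x +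
      ∑ e, (christoffel G a c e x : ℂ) *
        (pd d (fun y => V y e) x + ∑ b, (christoffel G e d b x : ℂ) * V x b) := fun c d => rfl
  rw [key2, key2, key, key, pd_comm h.isOpen (hV a) hx (μ := c) (ν := d)]
  simp only [riemannUp, Fin.sum_univ_four]
  push_cast
  ring

/-- Separates the part that differentiates the direction field from the second covariant derivative.
After antisymmetrization the former becomes a Lie bracket and the latter the curvature. -/
theorem covDeriv_covDeriv {V Z : R4 → Fin 4 → ℂ} (hV : ∀ a, Sm T (fun y => V y a))
    (hZ : ∀ a, Sm T (fun y => Z y a)) (Y : Fin 4 → ℂ) {x : R4} (hx : x ∈ T) (a : Fin 4) :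
    covDeriv G Y (fun y => covDeriv G (Z y) V y) x a =
      ∑ d, dir Y (fun y => Z y d) x * cov G d V x a +
        ∑ c, ∑ d, Y c * Z x d * cov G c (cov G d V) x a := by
  have dZ : ∀ a, DifferentiableAt ℝ (fun y => Z y a) x := fun a => (hZ a).diff h.isOpen hx
  have dc : ∀ d a, DifferentiableAt ℝ (fun y => cov G d V y a) x :=
    fun d a => (h.cov_smooth d hV a).diff h.isOpen hx
  have e1 : ∀ c, pd c (fun y => covDeriv G (Z y) V y a) x =
      ∑ d, (pd c (fun y => Z y d) x * cov G d V x a + Z x d * pd c (fun y => cov G d V y a) x) := by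
    intro c
    have : (fun y => covDeriv G (Z y) V y a) = fun y => ∑ d, Z y d * cov G d V y a := rfl
    rw [this, pd_sum fun d _ => (dZ d).fun_mul (dc d a)]
    exact Finset.sum_congr rfl fun d _ => pd_mul (dZ d) (dc d a)
  have e2 : ∀ c d, cov G c (cov G d V) x a = pd c (fun y => cov G d V y a) x +
      ∑ e, (christoffel G a c e x : ℂ) * cov G d V x e := fun c d => rfl
  have e3 : covDeriv G Y (fun y => covDeriv G (Z y) V y) x a =
      ∑ c, Y c * (pd c (fun y => covDeriv G (Z y) V y a) x +
        ∑ e, (christoffel G a c e x : ℂ) * ∑ d, Z x d * cov G d V x e) := rfl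
  rw [e3]
  simp only [e1, e2, dir, Fin.sum_univ_four]
  ring

/-- Torsion-freeness. -/
theorem torsion_free (V W : R4 → Fin 4 → ℂ) (x : R4) (a : Fin 4) :
    covDeriv G (V x) W x a - covDeriv G (W x) V x a =
      dir (V x) (fun y => W y a) x - dir (W x) (fun y => V y a) x := by
  simp only [covDeriv, dir, Fin.sum_univ_four]
  have hs := fun b c => christoffel_symm h.symm a b c x
  rw [hs 1 0, hs 2 0, hs 3 0, hs 2 1, hs 3 1, hs 3 2]
  ring

theorem e_diff {x : R4} (hx : x ∈ T) (i a : Fin 4) : DifferentiableAt ℝ (fun y => E i y a) x :=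
  (h.e_smooth i a).diff h.isOpen hx

/-- R(X, Y)V = ∇_X ∇_Y V - ∇_Y ∇_X V - ∇_{[X,Y]} V, with the bracket written as ∇_X Y - ∇_Y X so
that it can be expanded in connection coefficients. -/
theorem curvature {x : R4} (hx : x ∈ T) (i j k a : Fin 4) :
    ∑ b, ∑ c, ∑ d, (riemannUp G a b c d x : ℂ) * E k x b * E i x c * E j x d =
      covDeriv G (E i x) (fun y => covDeriv G (E j y) (E k) y) x a -
      covDeriv G (E j x) (fun y => covDeriv G (E i y) (E k) y) x a -
      covDeriv G (covDeriv G (E i x) (E j) x - covDeriv G (E j x) (E i) x) (E k) x a := by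
  rw [h.covDeriv_covDeriv (h.e_smooth k) (h.e_smooth j) _ hx,
    h.covDeriv_covDeriv (h.e_smooth k) (h.e_smooth i) _ hx]
  have e1 : covDeriv G (covDeriv G (E i x) (E j) x - covDeriv G (E j x) (E i) x) (E k) x a =
      ∑ d, (dir (E i x) (fun y => E j y d) x - dir (E j x) (fun y => E i y d) x)
        * cov G d (E k) x a := by
    change ∑ d, (covDeriv G (E i x) (E j) x d - covDeriv G (E j x) (E i) x d) * cov G d (E k) x a = _
    refine Finset.sum_congr rfl fun d _ => ?_
    rw [h.torsion_free]
  have e2 : ∑ c, ∑ d, E j x c * E i x d * cov G c (cov G d (E k)) x a =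
      ∑ c, ∑ d, E i x c * E j x d * cov G d (cov G c (E k)) x a := by
    rw [Finset.sum_comm]
    refine Finset.sum_congr rfl fun c _ => Finset.sum_congr rfl fun d _ => by ring
  have e3 : ∑ c, ∑ d, E i x c * E j x d * cov G c (cov G d (E k)) x a -
      ∑ c, ∑ d, E i x c * E j x d * cov G d (cov G c (E k)) x a =
      ∑ c, ∑ d, ∑ b, (riemannUp G a b c d x : ℂ) * E k x b * E i x c * E j x d := by
    simp only [← Finset.sum_sub_distrib]
    refine Finset.sum_congr rfl fun c _ => Finset.sum_congr rfl fun d _ => ?_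
    rw [← mul_sub, h.cov_comm (h.e_smooth k) hx, Finset.mul_sum]
    refine Finset.sum_congr rfl fun b _ => by ring
  have e4 : ∑ b, ∑ c, ∑ d, (riemannUp G a b c d x : ℂ) * E k x b * E i x c * E j x d =
      ∑ c, ∑ d, ∑ b, (riemannUp G a b c d x : ℂ) * E k x b * E i x c * E j x d := by
    rw [Finset.sum_comm]
    refine Finset.sum_congr rfl fun c _ => ?_
    rw [Finset.sum_comm]
  rw [e1, e2, e4, ← e3]
  simp only [sub_mul, Finset.sum_sub_distrib]
  ring

theorem conn_smooth (i j k : Fin 4) : Sm T (conn G E i j k) :=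
  h.ip_smooth (h.e_smooth k) (h.covDeriv_smooth (h.e_smooth j) (h.e_smooth i))

theorem dir_ip {x : R4} (hx : x ∈ T) (Y : Fin 4 → ℂ) {V W : R4 → Fin 4 → ℂ}
    (hV : ∀ a, Sm T (fun y => V y a)) (hW : ∀ a, Sm T (fun y => W y a)) :
    dir Y (fun y => ip G y (V y) (W y)) x =
      ip G x (covDeriv G Y V x) (W x) + ip G x (V x) (covDeriv G Y W x) := by
  simp only [dir, h.pd_ip hx _ hV hW, covDeriv_eq, ip_sum_right, ip_smul_right]
  rw [ip_comm h.symm _ (W x)]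
  simp only [ip_sum_right, ip_smul_right, ← Finset.sum_add_distrib]
  refine Finset.sum_congr rfl fun a _ => ?_
  rw [ip_comm h.symm (W x)]; ring

/-- The products E_j · E_k are constant, so differentiating them along E_i gives zero. -/
theorem conn_antisymm {x : R4} (hx : x ∈ T) (i j k : Fin 4) :
    conn G E i j k x = -conn G E i k j x := by
  have h1 := h.dir_ip hx (E i x) (h.e_smooth j) (h.e_smooth k)
  have h2 : dir (E i x) (fun y => ip G y (E j y) (E k y)) x = 0 := by
    simp only [dir]
    refine Finset.sum_eq_zero fun a _ => ?_
    rw [pd_congr h.isOpen hx (g := fun _ => eta j k) fun y hy => h.gram y hy j k, pd_const,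
      mul_zero]
  rw [h2, ip_comm h.symm] at h1
  simp only [conn]
  linear_combination -h1

theorem conj_conn (i j k : Fin 4) (x : R4) :
    conj (conn G E i j k x) = conn G E (bar i) (bar j) (bar k) x := by
  have hr : ∀ i a y, conj (E i y a) = E (bar i) y a := fun i a y => congrFun (h.real y i) a
  rw [conn, conj_ip, h.real, conn]
  congr 1
  funext a
  simp only [conjV, covDeriv, map_sum, map_mul, map_add, hr, Complex.conj_ofReal]
  refine Finset.sum_congr rfl fun b _ => ?_
  rw [← pd_conj]; simp only [hr]

/-- The frame components of a vector in terms of its products with the tetrad. -/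
theorem expand4 {x : R4} (hx : x ∈ T) (v : Fin 4 → ℂ) :
    v = ip G x (E 1 x) v • E 0 x + ip G x (E 0 x) v • E 1 x
      - ip G x (E 3 x) v • E 2 x - ip G x (E 2 x) v • E 3 x := by
  conv_lhs => rw [h.expand hx v]
  simp only [Fin.sum_univ_four, eta]
  simp
  module

theorem covDeriv_frame {x : R4} (hx : x ∈ T) (i j : Fin 4) :
    covDeriv G (E i x) (E j) x = conn G E i j 1 x • E 0 x + conn G E i j 0 x • E 1 x
      - conn G E i j 3 x • E 2 x - conn G E i j 2 x • E 3 x := h.expand4 hx _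

/-- The derivative is moved off the inner vector by metric compatibility; the remaining product of
two first covariant derivatives is expanded in the frame. -/
theorem ip_covDeriv_covDeriv {x : R4} (hx : x ∈ T) (i j k l : Fin 4) :
    ip G x (E l x) (covDeriv G (E i x) (fun y => covDeriv G (E j y) (E k) y) x) =
      dir (E i x) (conn G E j k l) x -
      (conn G E i l 1 x * conn G E j k 0 x + conn G E i l 0 x * conn G E j k 1 x
      - conn G E i l 3 x * conn G E j k 2 x - conn G E i l 2 x * conn G E j k 3 x) := by
  have h1 := h.dir_ip hx (E i x) (h.e_smooth l) (h.covDeriv_smooth (h.e_smooth k) (h.e_smooth j))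
  have h2 : ip G x (covDeriv G (E i x) (E l) x) (covDeriv G (E j x) (E k) x) =
      conn G E i l 1 x * conn G E j k 0 x + conn G E i l 0 x * conn G E j k 1 x
      - conn G E i l 3 x * conn G E j k 2 x - conn G E i l 2 x * conn G E j k 3 x := by
    rw [h.covDeriv_frame hx i l, sub_eq_add_neg, sub_eq_add_neg, ← neg_smul, ← neg_smul]
    simp only [ip_add_left, ip_smul_left]
    simp only [conn]; ring
  rw [← h2]
  change _ = dir (E i x) (fun y => ip G y (E l y) (covDeriv G (E j y) (E k) y)) x - _
  rw [h1]; ring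

/-- The curvature tensor in terms of the connection coefficients. -/
theorem riemC_frame {x : R4} (hx : x ∈ T) (l k i j : Fin 4) :
    riemC G x (E l x) (E k x) (E i x) (E j x) =
      dir (E i x) (conn G E j k l) x - dir (E j x) (conn G E i k l) x
      - (conn G E i l 1 x * conn G E j k 0 x + conn G E i l 0 x * conn G E j k 1 x
        - conn G E i l 3 x * conn G E j k 2 x - conn G E i l 2 x * conn G E j k 3 x)
      + (conn G E j l 1 x * conn G E i k 0 x + conn G E j l 0 x * conn G E i k 1 x
        - conn G E j l 3 x * conn G E i k 2 x - conn G E j l 2 x * conn G E i k 3 x)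
      - ((conn G E i j 1 x - conn G E j i 1 x) * conn G E 0 k l x
        + (conn G E i j 0 x - conn G E j i 0 x) * conn G E 1 k l x
        - (conn G E i j 3 x - conn G E j i 3 x) * conn G E 2 k l x
        - (conn G E i j 2 x - conn G E j i 2 x) * conn G E 3 k l x) := by
  have e1 : (fun e => ∑ b, ∑ c, ∑ d, (riemannUp G e b c d x : ℂ) * E k x b * E i x c * E j x d) =
      covDeriv G (E i x) (fun y => covDeriv G (E j y) (E k) y) x -
      covDeriv G (E j x) (fun y => covDeriv G (E i y) (E k) y) x -
      covDeriv G (covDeriv G (E i x) (E j) x - covDeriv G (E j x) (E i) x) (E k) x :=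
    funext fun a => h.curvature hx i j k a
  have e2 : covDeriv G (covDeriv G (E i x) (E j) x - covDeriv G (E j x) (E i) x) (E k) x =
      (conn G E i j 1 x - conn G E j i 1 x) • covDeriv G (E 0 x) (E k) x
      + (conn G E i j 0 x - conn G E j i 0 x) • covDeriv G (E 1 x) (E k) x
      - (conn G E i j 3 x - conn G E j i 3 x) • covDeriv G (E 2 x) (E k) x
      - (conn G E i j 2 x - conn G E j i 2 x) • covDeriv G (E 3 x) (E k) x := by
    rw [h.covDeriv_frame hx i j, h.covDeriv_frame hx j i]
    simp only [covDeriv_eq, Fin.sum_univ_four, Pi.sub_apply, Pi.add_apply, Pi.smul_apply,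
      smul_eq_mul]
    module
  rw [riemC_eq_ip, e1, ip_sub_right, ip_sub_right, h.ip_covDeriv_covDeriv hx,
    h.ip_covDeriv_covDeriv hx, e2]
  simp only [ip_sub_right, ip_add_right, ip_smul_right]
  simp only [← conn.eq_1]
  ring

/-- The commutator of two tetrad derivatives of a scalar. -/
theorem dir_comm {x : R4} (hx : x ∈ T) (i j : Fin 4) {f : R4 → ℂ} (hf : Sm T f) :
    dir (E i x) (fun y => dir (E j y) f y) x - dir (E j x) (fun y => dir (E i y) f y) x =
      (conn G E i j 1 x - conn G E j i 1 x) * dir (E 0 x) f x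
      + (conn G E i j 0 x - conn G E j i 0 x) * dir (E 1 x) f x
      - (conn G E i j 3 x - conn G E j i 3 x) * dir (E 2 x) f x
      - (conn G E i j 2 x - conn G E j i 2 x) * dir (E 3 x) f x := by
  have dp : ∀ μ, DifferentiableAt ℝ (pd μ f) x := fun μ => (hf.pd h.isOpen μ).diff h.isOpen hx
  have key : ∀ i j, dir (E i x) (fun y => dir (E j y) f y) x =
      ∑ a, dir (E i x) (fun y => E j y a) x * pd a f x +
      ∑ c, ∑ a, E i x c * E j x a * pd c (pd a f) x := by
    intro i j
    have e1 : ∀ c, pd c (fun y => dir (E j y) f y) x =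
        ∑ a, (pd c (fun y => E j y a) x * pd a f x + E j x a * pd c (pd a f) x) := by
      intro c
      simp only [dir]
      rw [pd_sum fun a _ => (h.e_diff hx j a).fun_mul (dp a)]
      exact Finset.sum_congr rfl fun a _ => pd_mul (h.e_diff hx j a) (dp a)
    rw [dir]
    simp only [e1]
    simp only [dir, Fin.sum_univ_four]
    ring
  have e2 : ∑ c, ∑ a, E j x c * E i x a * pd c (pd a f) x =
      ∑ c, ∑ a, E i x c * E j x a * pd c (pd a f) x := by
    rw [Finset.sum_comm]
    refine Finset.sum_congr rfl fun c _ => Finset.sum_congr rfl fun d _ => ?_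
    rw [pd_comm h.isOpen hf hx]; ring
  rw [key, key, e2, add_sub_add_right_eq_sub, ← Finset.sum_sub_distrib]
  have e3 : ∀ a, dir (E i x) (fun y => E j y a) x * pd a f x -
      dir (E j x) (fun y => E i y a) x * pd a f x =
      (covDeriv G (E i x) (E j) x a - covDeriv G (E j x) (E i) x a) * pd a f x := by
    intro a; rw [h.torsion_free, sub_mul]
  simp only [e3]
  rw [h.covDeriv_frame hx i j, h.covDeriv_frame hx j i]
  simp only [dir, Fin.sum_univ_four, Pi.sub_apply, Pi.add_apply, Pi.smul_apply, smul_eq_mul]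
  ring

end SmoothTetrad

/-! ## Algebra of the curvature tensor and the field equations in a tetrad -/

theorem sum_sum_mul_sum_sum (A B : Fin 4 → Fin 4 → ℂ) (v w y z : Fin 4 → ℂ) :
    ∑ a, ∑ b, ∑ c, ∑ d, (A a c * B b d) * v a * w b * y c * z d =
      (∑ a, ∑ c, A a c * v a * y c) * ∑ b, ∑ d, B b d * w b * z d := by
  rw [Finset.sum_mul]
  refine Finset.sum_congr rfl fun a _ => ?_
  rw [Finset.sum_mul, Finset.sum_comm]
  refine Finset.sum_congr rfl fun c _ => ?_
  rw [Finset.mul_sum]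
  refine Finset.sum_congr rfl fun b _ => ?_
  rw [Finset.mul_sum]
  exact Finset.sum_congr rfl fun d _ => by ring

theorem sum_swap_last (A : Fin 4 → Fin 4 → Fin 4 → Fin 4 → ℂ) :
    ∑ a, ∑ b, ∑ c, ∑ d, A a b c d = ∑ a, ∑ b, ∑ d, ∑ c, A a b c d :=
  Finset.sum_congr rfl fun _ _ => Finset.sum_congr rfl fun _ _ => Finset.sum_comm

theorem weylC_eq (G : MetricComp) (x : R4) (v w y z : Fin 4 → ℂ) :
    weylC G x v w y z = riemC G x v w y z +
      (1 / 2) * (ip G x v y * ricciC G x w z - ip G x v z * ricciC G x w y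
        - ip G x w y * ricciC G x v z + ip G x w z * ricciC G x v y) -
      (scalarCurv G x : ℂ) / 6 * (ip G x v y * ip G x w z - ip G x v z * ip G x w y) := by
  have e : ∀ a b c d : Fin 4, (weyl G a b c d x : ℂ) * v a * w b * y c * z d =
      (riemannDown G a b c d x : ℂ) * v a * w b * y c * z d +
      (1 / 2) * (((G x a c : ℂ) * ricci G b d x) * v a * w b * y c * z d
        - ((G x a d : ℂ) * ricci G b c x) * v a * w b * z d * y c
        - ((G x b c : ℂ) * ricci G a d x) * w b * v a * y c * z d
        + ((G x b d : ℂ) * ricci G a c x) * w b * v a * z d * y c) -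
      (scalarCurv G x : ℂ) / 6 * (((G x a c : ℂ) * G x b d) * v a * w b * y c * z d
        - ((G x a d : ℂ) * G x b c) * v a * w b * z d * y c) := by
    intro a b c d
    simp only [weyl]; push_cast; ring
  simp only [weylC, e, Finset.sum_add_distrib, Finset.sum_sub_distrib, ← Finset.mul_sum]
  have s1 := sum_sum_mul_sum_sum (fun a c => (G x a c : ℂ)) (fun a c => (ricci G a c x : ℂ))
  have s2 := sum_sum_mul_sum_sum (fun a c => (G x a c : ℂ)) (fun a c => (G x a c : ℂ))
  have t1 : ∑ a, ∑ b, ∑ c, ∑ d, ((G x a d : ℂ) * ricci G b c x) * v a * w b * z d * y c =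
      ip G x v z * ricciC G x w y := by
    rw [sum_swap_last]; exact s1 v w z y
  have t2 : ∑ a, ∑ b, ∑ c, ∑ d, ((G x b c : ℂ) * ricci G a d x) * w b * v a * y c * z d =
      ip G x w y * ricciC G x v z := by
    rw [Finset.sum_comm]; exact s1 w v y z
  have t3 : ∑ a, ∑ b, ∑ c, ∑ d, ((G x b d : ℂ) * ricci G a c x) * w b * v a * z d * y c =
      ip G x w z * ricciC G x v y := by
    rw [sum_swap_last, Finset.sum_comm]; exact s1 w v z y
  have t4 : ∑ a, ∑ b, ∑ c, ∑ d, ((G x a d : ℂ) * G x b c) * v a * w b * z d * y c =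
      ip G x v z * ip G x w y := by
    rw [sum_swap_last]; exact s2 v w z y
  rw [t1, t2, t3, t4]
  have t5 : ∑ a, ∑ b, ∑ c, ∑ d, ((G x a c : ℂ) * ricci G b d x) * v a * w b * y c * z d =
      ip G x v y * ricciC G x w z := s1 v w y z
  have t6 : ∑ a, ∑ b, ∑ c, ∑ d, ((G x a c : ℂ) * G x b d) * v a * w b * y c * z d =
      ip G x v y * ip G x w z := s2 v w y z
  rw [t5, t6]
  rfl

/-- With symmetric Christoffel symbols the terms of the cyclic sum cancel in pairs. -/
theorem riemannUp_cyclic {G : MetricComp} (hs : ∀ x a b, G x a b = G x b a)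
    (a b c d : Fin 4) (x : R4) :
    riemannUp G a b c d x + riemannUp G a c d b x + riemannUp G a d b c x = 0 := by
  have s : ∀ a b c, christoffel G a b c = christoffel G a c b :=
    fun a b c => funext fun y => christoffel_symm hs a b c y
  have s1 : ∀ a, christoffel G a b c = christoffel G a c b := fun a => s a b c
  have s2 : ∀ a, christoffel G a d c = christoffel G a c d := fun a => s a d c
  have s3 : ∀ a, christoffel G a b d = christoffel G a d b := fun a => s a b d
  simp only [riemannUp, s1 a, s2 a, s3 a, Fin.sum_univ_four, s1 0, s1 1, s1 2, s1 3, s2 0, s2 1,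
    s2 2, s2 3, s3 0, s3 1, s3 2, s3 3]
  ring

theorem riemC_cyclic {G : MetricComp} (hs : ∀ x a b, G x a b = G x b a) (x : R4)
    (v w y z : Fin 4 → ℂ) : riemC G x v w y z + riemC G x v y z w + riemC G x v z w y = 0 := by
  rw [riemC_eq_ip, riemC_eq_ip, riemC_eq_ip, ← ip_add_right, ← ip_add_right]
  convert ip_zero_right v using 2
  funext e
  have e1 : ∑ b, ∑ c, ∑ d, (riemannUp G e b c d x : ℂ) * y b * z c * w d =
      ∑ b, ∑ c, ∑ d, (riemannUp G e c d b x : ℂ) * y c * z d * w b := by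
    rw [Finset.sum_comm_cycle]
  have e2 : ∑ b, ∑ c, ∑ d, (riemannUp G e b c d x : ℂ) * z b * w c * y d =
      ∑ b, ∑ c, ∑ d, (riemannUp G e d b c x : ℂ) * z d * w b * y c := by
    rw [Finset.sum_comm_cycle]; rw [Finset.sum_comm_cycle]
  simp only [Pi.add_apply, e1, e2, ← Finset.sum_add_distrib, Pi.zero_apply]
  refine Finset.sum_eq_zero fun b _ => Finset.sum_eq_zero fun c _ => Finset.sum_eq_zero fun d _ => ?_
  have := congrArg (fun r : ℝ => (r : ℂ)) (riemannUp_cyclic hs e b c d x)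
  push_cast at this
  linear_combination (w b * y c * z d) * this

theorem contr2_antisymm {F : Matrix (Fin 4) (Fin 4) ℝ} (hF : ∀ a b, F a b = -F b a)
    (v w : Fin 4 → ℂ) : contr2 F v w = -contr2 F w v := by
  simp only [contr2]
  rw [Finset.sum_comm]
  simp only [← Finset.sum_neg_distrib]
  refine Finset.sum_congr rfl fun a _ => Finset.sum_congr rfl fun b _ => by
    rw [hF b a]; push_cast; ring

theorem conj_contr2 (F : Fin 4 → Fin 4 → ℝ) (v w : Fin 4 → ℂ) :
    conj (contr2 F v w) = contr2 F (conjV v) (conjV w) := by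
  simp [contr2, conjV]

/-- The contraction `∇_c F_{ab} v^c w^a y^b`. -/
noncomputable def covF (G : MetricComp) (F : R4 → Matrix (Fin 4) (Fin 4) ℝ) (x : R4)
    (v w y : Fin 4 → ℂ) : ℂ :=
  ∑ c, ∑ a, ∑ b, (covDerivTwo G F c a b x : ℂ) * v c * w a * y b

theorem maxwell_closed_frame {F : R4 → Matrix (Fin 4) (Fin 4) ℝ} {x : R4}
    (hM : ∀ a b c, covDerivTwo G F a b c x + covDerivTwo G F b c a x + covDerivTwo G F c a b x = 0)
    (u v w : Fin 4 → ℂ) :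
    covF G F x u v w + covF G F x v w u + covF G F x w u v = 0 := by
  have e1 : ∀ a b c, (covDerivTwo G F a b c x : ℂ) + covDerivTwo G F b c a x
      + covDerivTwo G F c a b x = 0 := by
    intro a b c; exact_mod_cast congrArg (fun r : ℝ => (r : ℂ)) (hM a b c)
  have e2 : covF G F x v w u =
      ∑ a, ∑ b, ∑ c, (covDerivTwo G F b c a x : ℂ) * u a * v b * w c := by
    simp only [covF]
    rw [Finset.sum_comm_cycle]
    exact Finset.sum_congr rfl fun a _ => Finset.sum_congr rfl fun b _ =>
      Finset.sum_congr rfl fun c _ => by ring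
  have e3 : covF G F x w u v =
      ∑ a, ∑ b, ∑ c, (covDerivTwo G F c a b x : ℂ) * u a * v b * w c := by
    simp only [covF]
    rw [Finset.sum_comm_cycle, Finset.sum_comm_cycle]
    exact Finset.sum_congr rfl fun a _ => Finset.sum_congr rfl fun b _ =>
      Finset.sum_congr rfl fun c _ => by ring
  rw [e2, e3]
  simp only [covF, ← Finset.sum_add_distrib]
  refine Finset.sum_eq_zero fun a _ => Finset.sum_eq_zero fun b _ => Finset.sum_eq_zero fun c _ => ?_
  linear_combination (u a * v b * w c) * e1 a b c

/-! ### Curvature symmetries and the Einstein-Maxwell equations in the frame -/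

namespace SmoothTetrad

variable {T : Set R4} {G : MetricComp} {E : Fin 4 → R4 → Fin 4 → ℂ} (h : SmoothTetrad T G E)

include h

theorem riemC_antisymm_right {x : R4} (hx : x ∈ T) (l k i j : Fin 4) :
    riemC G x (E l x) (E k x) (E i x) (E j x) = -riemC G x (E l x) (E k x) (E j x) (E i x) := by
  rw [h.riemC_frame hx, h.riemC_frame hx]; ring

theorem dir_conn_antisymm {x : R4} (hx : x ∈ T) (Y : Fin 4 → ℂ) (i j k : Fin 4) :
    dir Y (conn G E i j k) x = -dir Y (conn G E i k j) x := by
  simp only [dir, ← Finset.sum_neg_distrib]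
  refine Finset.sum_congr rfl fun a _ => ?_
  rw [pd_congr h.isOpen hx fun y hy => h.conn_antisymm hy i j k, pd_neg, mul_neg]

/-- Metric compatibility enters through the antisymmetry of the connection coefficients in
`riemC_frame`. -/
theorem riemC_antisymm_left {x : R4} (hx : x ∈ T) (l k i j : Fin 4) :
    riemC G x (E l x) (E k x) (E i x) (E j x) = -riemC G x (E k x) (E l x) (E i x) (E j x) := by
  rw [h.riemC_frame hx, h.riemC_frame hx, h.dir_conn_antisymm hx _ i k l,
    h.dir_conn_antisymm hx _ j k l, h.conn_antisymm hx 0 k l, h.conn_antisymm hx 1 k l,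
    h.conn_antisymm hx 2 k l, h.conn_antisymm hx 3 k l]
  ring

theorem riemC_pair {x : R4} (hx : x ∈ T) (l k i j : Fin 4) :
    riemC G x (E l x) (E k x) (E i x) (E j x) = riemC G x (E i x) (E j x) (E l x) (E k x) := by
  have c := riemC_cyclic h.symm x
  have c1 := c (E l x) (E k x) (E i x) (E j x)
  have c2 := c (E k x) (E i x) (E j x) (E l x)
  have c3 := c (E i x) (E j x) (E l x) (E k x)
  have c4 := c (E j x) (E l x) (E k x) (E i x)
  have L := h.riemC_antisymm_left hx
  have R := h.riemC_antisymm_right hx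
  -- The classical octahedron argument: four cyclic identities, one for each choice of first index,
  -- are added with signs, and the antisymmetries cancel all but twice the desired difference.
  linear_combination (1 / 2) * (c1 - c2 - c3 + c4 + L k l i j - L j i l k - L l i j k + R i l j k
    - L j l k i + L i k j l + L k j l i - R j k l i)

/-- A trace can be computed in the frame because the completeness relation resolves the identity;
this is what turns coordinate contractions into the four-term sums over ℓn, nℓ, m m̄, m̄ m. -/
theorem sum_trace {x : R4} (hx : x ∈ T) (A : Fin 4 → Fin 4 → ℂ) :
    ∑ a, A a a = ∑ p, ∑ q, eta p q * ip G x (E p x) (fun e => ∑ d, A e d * E q x d) := by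
  have h1 : ∀ e d, ∑ a, (G x e a : ℂ) * ∑ p, ∑ q, eta p q * (E p x a * E q x d) =
      if e = d then 1 else 0 := by
    intro e d
    have := congrFun (congrFun (h.gram_matrix hx) e) d
    simpa [Matrix.mul_apply, Matrix.one_apply] using this
  have h2 : ∑ a, A a a = ∑ e, ∑ d, A e d * if e = d then 1 else 0 := by simp
  rw [h2]
  simp only [← h1, eta_sum, ip]
  have hs := h.symm x
  simp only [Fin.sum_univ_four]
  rw [hs 1 0, hs 2 0, hs 3 0, hs 2 1, hs 3 1, hs 3 2]
  ring

theorem ricciC_frame {x : R4} (hx : x ∈ T) (v w : Fin 4 → ℂ) :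
    ricciC G x v w = riemC G x (E 0 x) v w (E 1 x) + riemC G x (E 1 x) v w (E 0 x)
      - riemC G x (E 2 x) v w (E 3 x) - riemC G x (E 3 x) v w (E 2 x) := by
  have h1 := h.sum_trace hx (fun e d => ∑ b, ∑ c, (riemannUp G e b c d x : ℂ) * v b * w c)
  have h2 : ricciC G x v w = ∑ e, ∑ b, ∑ c, (riemannUp G e b c e x : ℂ) * v b * w c := by
    simp only [ricciC, contr2, ricci]
    push_cast
    simp only [Finset.sum_mul]
    rw [Finset.sum_comm_cycle]
  have h3 : ∀ q, (fun e => ∑ d, (∑ b, ∑ c, (riemannUp G e b c d x : ℂ) * v b * w c) * E q x d) =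
      fun e => ∑ b, ∑ c, ∑ d, (riemannUp G e b c d x : ℂ) * v b * w c * E q x d := by
    intro q
    funext e
    simp only [Finset.sum_mul]
    rw [Finset.sum_comm_cycle]
    rw [Finset.sum_comm_cycle]
  rw [h2, h1]
  simp only [h3, ← riemC_eq_ip]
  rw [eta_sum (fun p q => riemC G x (E p x) v w (E q x))]

theorem sum_inv {x : R4} (hx : x ∈ T) (A : Fin 4 → Fin 4 → ℂ) :
    ∑ a, ∑ b, (((G x)⁻¹ a b : ℝ) : ℂ) * A a b =
      ∑ p, ∑ q, eta p q * ∑ a, ∑ b, A a b * E p x a * E q x b := by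
  simp only [h.inv_eq hx, eta_sum, ← Finset.sum_sub_distrib,
    ← Finset.sum_add_distrib]
  refine Finset.sum_congr rfl fun a _ => Finset.sum_congr rfl fun b _ => by ring

theorem scalarCurv_frame {x : R4} (hx : x ∈ T) :
    (scalarCurv G x : ℂ) = ricciC G x (E 0 x) (E 1 x) + ricciC G x (E 1 x) (E 0 x)
      - ricciC G x (E 2 x) (E 3 x) - ricciC G x (E 3 x) (E 2 x) := by
  have h1 := h.sum_inv hx (fun a b => (ricci G a b x : ℂ))
  simp only [scalarCurv]
  push_cast
  rw [h1, eta_sum]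
  rfl

/-- The factor 2 is 8π divided by 4π. All index raisings are replaced by `eta`-sums over the tetrad.
-/
theorem stress_frame {x : R4} (hx : x ∈ T) (F : R4 → Matrix (Fin 4) (Fin 4) ℝ)
    (v w : Fin 4 → ℂ) :
    contr2 (fun a b => -(8 * Real.pi) * maxwellStress G F a b x) v w =
      2 * ((∑ p, ∑ q, eta p q * (contr2 (F x) v (E p x) * contr2 (F x) w (E q x))) -
        (1 / 4) * ip G x v w * ∑ p, ∑ q, eta p q * ∑ r, ∑ s, eta r s *
          (contr2 (F x) (E p x) (E r x) * contr2 (F x) (E q x) (E s x))) := by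
  have e1 : ∑ p, ∑ q, eta p q * (contr2 (F x) v (E p x) * contr2 (F x) w (E q x)) =
      ∑ e, ∑ f, (((G x)⁻¹ e f : ℝ) : ℂ) * ((∑ a, F x a e * v a) * ∑ b, F x b f * w b) := by
    rw [h.sum_inv hx]
    refine Finset.sum_congr rfl fun p _ => Finset.sum_congr rfl fun q _ => ?_
    simp only [contr2, Fin.sum_univ_four]
    ring
  have e2 : ∑ p, ∑ q, eta p q * ∑ r, ∑ s, eta r s *
        (contr2 (F x) (E p x) (E r x) * contr2 (F x) (E q x) (E s x)) =
      ∑ e, ∑ f, ∑ c, ∑ d, (((G x)⁻¹ e c : ℝ) : ℂ) * ((G x)⁻¹ f d : ℝ) * F x e f * F x c d := by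
    have e3 : ∀ e c, ∑ f, ∑ d, (((G x)⁻¹ f d : ℝ) : ℂ) * ((F x e f : ℂ) * F x c d) =
        ∑ r, ∑ s, eta r s * ((∑ f, F x e f * E r x f) * ∑ d, F x c d * E s x d) := by
      intro e c
      rw [h.sum_inv hx]
      refine Finset.sum_congr rfl fun p _ => Finset.sum_congr rfl fun q _ => ?_
      simp only [Fin.sum_univ_four]
      ring
    have e4 : ∑ e, ∑ f, ∑ c, ∑ d, (((G x)⁻¹ e c : ℝ) : ℂ) * ((G x)⁻¹ f d : ℝ) * F x e f * F x c d =
        ∑ e, ∑ c, (((G x)⁻¹ e c : ℝ) : ℂ) *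
          ∑ f, ∑ d, (((G x)⁻¹ f d : ℝ) : ℂ) * ((F x e f : ℂ) * F x c d) := by
      refine Finset.sum_congr rfl fun e _ => ?_
      rw [Finset.sum_comm]
      refine Finset.sum_congr rfl fun c _ => ?_
      simp only [Finset.mul_sum]
      refine Finset.sum_congr rfl fun f _ => Finset.sum_congr rfl fun d _ => by ring
    rw [e4]
    simp only [e3]
    rw [h.sum_inv hx]
    refine Finset.sum_congr rfl fun p _ => Finset.sum_congr rfl fun q _ => ?_
    congr 1
    have e5 : ∀ r s, contr2 (F x) (E p x) (E r x) * contr2 (F x) (E q x) (E s x) =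
        ∑ a, ∑ b, ((∑ f, F x a f * E r x f) * ∑ d, F x b d * E s x d) * E p x a * E q x b := by
      intro r s
      simp only [contr2, Fin.sum_univ_four]
      ring
    simp only [e5, eta_sum]
    simp only [← Finset.sum_sub_distrib, ← Finset.sum_add_distrib]
    refine Finset.sum_congr rfl fun a _ => Finset.sum_congr rfl fun b _ => ?_
    ring
  rw [e1, e2]
  have hpi : (Real.pi : ℂ) ≠ 0 := by exact_mod_cast Real.pi_ne_zero
  have e6 : ∀ a b, ((-(8 * Real.pi) * maxwellStress G F a b x : ℝ) : ℂ) =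
      2 * ((∑ e, ∑ f, (((G x)⁻¹ e f : ℝ) : ℂ) * F x a e * F x b f) - (1 / 4) * G x a b *
        ∑ e, ∑ f, ∑ c, ∑ d, (((G x)⁻¹ e c : ℝ) : ℂ) * ((G x)⁻¹ f d : ℝ) * F x e f * F x c d) := by
    intro a b
    simp only [maxwellStress]
    push_cast
    field_simp
    ring
  have e7 : ∑ e, ∑ f, (((G x)⁻¹ e f : ℝ) : ℂ) * ((∑ a, F x a e * v a) * ∑ b, F x b f * w b) =
      ∑ a, ∑ b, (∑ e, ∑ f, (((G x)⁻¹ e f : ℝ) : ℂ) * F x a e * F x b f) * v a * w b := by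
    simp only [Finset.sum_mul, Finset.mul_sum]
    have c1 : ∀ e, ∑ f, ∑ b, ∑ a, (((G x)⁻¹ e f : ℝ) : ℂ) * (F x a e * v a * (F x b f * w b)) =
        ∑ a, ∑ b, ∑ f, (((G x)⁻¹ e f : ℝ) : ℂ) * F x a e * F x b f * v a * w b := by
      intro e
      rw [Finset.sum_comm_cycle]
      refine Finset.sum_congr rfl fun a _ => ?_
      rw [Finset.sum_comm]
      exact Finset.sum_congr rfl fun b _ => Finset.sum_congr rfl fun f _ => by ring
    simp only [c1]
    rw [Finset.sum_comm]
    refine Finset.sum_congr rfl fun a _ => ?_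
    rw [Finset.sum_comm]
  rw [e7]
  set K := ∑ e, ∑ f, ∑ c, ∑ d,
    (((G x)⁻¹ e c : ℝ) : ℂ) * ((G x)⁻¹ f d : ℝ) * F x e f * F x c d with hK
  simp only [contr2, ip]
  rw [mul_sub, mul_assoc (1 / 4 : ℂ), Finset.mul_sum, Finset.sum_mul, Finset.mul_sum, Finset.mul_sum,
    ← Finset.sum_sub_distrib]
  refine Finset.sum_congr rfl fun a _ => ?_
  rw [Finset.mul_sum, Finset.sum_mul, Finset.mul_sum, Finset.mul_sum, ← Finset.sum_sub_distrib]
  refine Finset.sum_congr rfl fun b _ => ?_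
  rw [e6]
  ring

/-- The Einstein-Maxwell equations in a null tetrad. -/
theorem einstein_frame {F : R4 → Matrix (Fin 4) (Fin 4) ℝ} {Λ : ℝ} {x : R4} (hx : x ∈ T)
    (hE : ∀ a b, ricci G a b x - (1 / 2) * G x a b * scalarCurv G x + Λ * G x a b =
      -(8 * Real.pi) * maxwellStress G F a b x)
    (K : ℂ) (hK : K = ∑ p, ∑ q, eta p q * ∑ r, ∑ s, eta r s *
          (contr2 (F x) (E p x) (E r x) * contr2 (F x) (E q x) (E s x))) :
    (scalarCurv G x : ℂ) = 4 * Λ ∧ ∀ i j, ricciC G x (E i x) (E j x) = Λ * eta i j +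
      2 * ((∑ p, ∑ q, eta p q * (contr2 (F x) (E i x) (E p x) * contr2 (F x) (E j x) (E q x))) -
        (1 / 4) * eta i j * K) := by
  have h1 : ∀ v w, ricciC G x v w = ((scalarCurv G x : ℂ) / 2 - Λ) * ip G x v w +
      contr2 (fun a b => -(8 * Real.pi) * maxwellStress G F a b x) v w := by
    intro v w
    simp only [ricciC, contr2, ip, Finset.mul_sum, ← Finset.sum_add_distrib]
    refine Finset.sum_congr rfl fun a _ => Finset.sum_congr rfl fun b _ => ?_
    rw [← hE a b]; push_cast; ring
  have h2 : ∀ i j, ricciC G x (E i x) (E j x) = ((scalarCurv G x : ℂ) / 2 - Λ) * eta i j +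
      2 * ((∑ p, ∑ q, eta p q * (contr2 (F x) (E i x) (E p x) * contr2 (F x) (E j x) (E q x))) -
        (1 / 4) * eta i j * K) := by
    intro i j
    rw [h1, h.stress_frame hx, h.gram x hx, ← hK]
  -- The Maxwell stress tensor is trace-free in dimension four, so the trace of Einstein's equation
  -- fixes the scalar curvature.
  have h3 : (scalarCurv G x : ℂ) = 4 * Λ := by
    have h4 := h.scalarCurv_frame hx
    rw [h2, h2, h2, h2] at h4
    simp only [eta_sum] at h4 hK
    have ee : eta 0 1 = 1 ∧ eta 1 0 = 1 ∧ eta 2 3 = -1 ∧ eta 3 2 = -1 := by simp [eta]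
    obtain ⟨e1, e2, e3, e4⟩ := ee
    rw [e1, e2, e3, e4, hK] at h4
    linear_combination -h4
  refine ⟨h3, fun i j => ?_⟩
  rw [h2, h3]; ring

theorem contr2_smooth {F : R4 → Matrix (Fin 4) (Fin 4) ℝ}
    (hF : ∀ a b, ContDiffOn ℝ ∞ (fun x => F x a b) T) (i j : Fin 4) :
    Sm T (fun x => contr2 (F x) (E i x) (E j x)) :=
  Sm.sum fun a _ => Sm.sum fun b _ => ((Sm.ofReal (hF a b)).mul (h.e_smooth i a)).mul
    (h.e_smooth j b)

/-- The Leibniz rule for a contraction of F with two frame fields. -/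
theorem covF_frame {F : R4 → Matrix (Fin 4) (Fin 4) ℝ}
    (hF : ∀ a b, ContDiffOn ℝ ∞ (fun x => F x a b) T) {x : R4} (hx : x ∈ T) (k i j : Fin 4) :
    covF G F x (E k x) (E i x) (E j x) =
      dir (E k x) (fun y => contr2 (F y) (E i y) (E j y)) x
      - contr2 (F x) (covDeriv G (E k x) (E i) x) (E j x)
      - contr2 (F x) (E i x) (covDeriv G (E k x) (E j) x) := by
  have d1 : ∀ a b, DifferentiableAt ℝ (fun y => (F y a b : ℂ)) x :=
    fun a b => (Sm.ofReal (hF a b)).diff h.isOpen hx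
  have dF : ∀ a b, DifferentiableAt ℝ (fun y => F y a b) x := fun a b =>
    ((hF a b).contDiffAt (h.isOpen.mem_nhds hx)).differentiableAt (by simp)
  have d2 := h.e_diff hx
  have key : ∀ c, pd c (fun y => contr2 (F y) (E i y) (E j y)) x =
      (∑ a, ∑ b, (covDerivTwo G F c a b x : ℂ) * E i x a * E j x b) +
        contr2 (F x) (cov G c (E i) x) (E j x) + contr2 (F x) (E i x) (cov G c (E j) x) := by
    intro c
    have e1 : pd c (fun y => contr2 (F y) (E i y) (E j y)) x = ∑ a, ∑ b,
      (((pd c (fun y => F y a b) x : ℝ) * E i x a + F x a b * pd c (fun y => E i y a) x) * E j x b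
        + F x a b * E i x a * pd c (fun y => E j y b) x) := by
      simp only [contr2]
      rw [pd_sum fun a _ =>
        DifferentiableAt.fun_sum fun b _ => ((d1 a b).fun_mul (d2 i a)).fun_mul (d2 j b)]
      refine Finset.sum_congr rfl fun a _ => ?_
      rw [pd_sum fun b _ => ((d1 a b).fun_mul (d2 i a)).fun_mul (d2 j b)]
      refine Finset.sum_congr rfl fun b _ => ?_
      rw [pd_mul ((d1 a b).fun_mul (d2 i a)) (d2 j b), pd_mul (d1 a b) (d2 i a),
        pd_ofReal (dF a b)]
    rw [e1]
    simp only [covDerivTwo, contr2, cov, Fin.sum_univ_four]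
    push_cast
    ring
  simp only [dir, key, covF, covDeriv_eq]
  simp only [contr2, Fin.sum_univ_four, Pi.add_apply, Pi.smul_apply, smul_eq_mul]
  ring

theorem maxwell_div_frame {F : R4 → Matrix (Fin 4) (Fin 4) ℝ} {x : R4} (hx : x ∈ T)
    (hM : ∀ b, ∑ a, ∑ c, (G x)⁻¹ a c * covDerivTwo G F c a b x = 0) (j : Fin 4) :
    covF G F x (E 1 x) (E 0 x) (E j x) + covF G F x (E 0 x) (E 1 x) (E j x)
      - covF G F x (E 3 x) (E 2 x) (E j x) - covF G F x (E 2 x) (E 3 x) (E j x) = 0 := by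
  have e1 : ∀ b, ∑ a, ∑ c, (((G x)⁻¹ a c : ℝ) : ℂ) * covDerivTwo G F c a b x = 0 := by
    intro b; exact_mod_cast congrArg (fun r : ℝ => (r : ℂ)) (hM b)
  have e2 : ∀ b, ∑ p, ∑ q, eta p q * ∑ a, ∑ c, (covDerivTwo G F c a b x : ℂ) * E p x a * E q x c
      = 0 := by
    intro b
    rw [← h.sum_inv hx (fun a c => (covDerivTwo G F c a b x : ℂ)), e1]
  simp only [eta_sum] at e2
  have e3 : ∀ p q, covF G F x (E q x) (E p x) (E j x) =
      ∑ b, (∑ a, ∑ c, (covDerivTwo G F c a b x : ℂ) * E p x a * E q x c) * E j x b := by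
    intro p q
    simp only [covF, Finset.sum_mul]
    rw [Finset.sum_comm_cycle]
    refine Finset.sum_congr rfl fun b _ => ?_
    rw [Finset.sum_comm]
    exact Finset.sum_congr rfl fun a _ => Finset.sum_congr rfl fun c _ => by ring
  rw [e3, e3, e3, e3, ← Finset.sum_add_distrib, ← Finset.sum_sub_distrib, ← Finset.sum_sub_distrib]
  refine Finset.sum_eq_zero fun b _ => ?_
  linear_combination E j x b * e2 b

end SmoothTetrad

/-! ## The Newman-Penrose equations -/

/-- The Newman-Penrose equations of an electrovacuum spacetime in a null tetrad which is parallelly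
propagated along the geodesic field `ℓ = ∂_r`, where `ℓ_a = (du)_a`. -/
structure NPSystem (T : Set R4) where
  n : R4 → Fin 4 → ℂ
  m : R4 → Fin 4 → ℂ
  rho : R4 → ℂ
  sigma : R4 → ℂ
  tau : R4 → ℂ
  alpha : R4 → ℂ
  beta : R4 → ℂ
  gamma : R4 → ℂ
  mu : R4 → ℂ
  lam : R4 → ℂ
  nu : R4 → ℂ
  Psi0 : R4 → ℂ
  Psi1 : R4 → ℂ
  Psi2 : R4 → ℂ
  Psi3 : R4 → ℂ
  Psi4 : R4 → ℂ
  phi0 : R4 → ℂ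
  phi1 : R4 → ℂ
  phi2 : R4 → ℂ
  L : ℂ
  isOpen : IsOpen T
  n_sm : ∀ a, Sm T (fun x => n x a)
  m_sm : ∀ a, Sm T (fun x => m x a)
  n_zero : ∀ x, n x 0 = 1
  m_zero : ∀ x, m x 0 = 0
  rho_sm : Sm T rho
  sigma_sm : Sm T sigma
  tau_sm : Sm T tau
  alpha_sm : Sm T alpha
  beta_sm : Sm T beta
  gamma_sm : Sm T gamma
  mu_sm : Sm T mu
  lam_sm : Sm T lam
  nu_sm : Sm T nu
  phi0_sm : Sm T phi0
  phi1_sm : Sm T phi1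
  phi2_sm : Sm T phi2
  L_real : conj L = L
  rho_real : ∀ x ∈ T, conj (rho x) = rho x
  tau_eq : ∀ x ∈ T, tau x = conj (alpha x) + beta x
  D_n : ∀ x ∈ T, ∀ a, pd 1 (fun y => n y a) x =
    (if a = 1 then -(gamma x + conj (gamma x)) else 0) + conj (tau x) * m x a +
      tau x * conj (m x a)
  comm_D_delta : ∀ f, Sm T f → ∀ x ∈ T,
    pd 1 (fun y => dir (m y) f y) x - dir (m x) (pd 1 f) x =
      -tau x * pd 1 f x + rho x * dir (m x) f x + sigma x * dir (conjV (m x)) f x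
  comm_Delta_delta : ∀ f, Sm T f → ∀ x ∈ T,
    dir (n x) (fun y => dir (m y) f y) x - dir (m x) (fun y => dir (n y) f y) x =
      conj (nu x) * pd 1 f x + (gamma x - conj (gamma x) - mu x) * dir (m x) f x
        - conj (lam x) * dir (conjV (m x)) f x
  comm_delta_deltabar : ∀ f, Sm T f → ∀ x ∈ T,
    dir (m x) (fun y => dir (conjV (m y)) f y) x - dir (conjV (m x)) (fun y => dir (m y) f y) x =
      (mu x - conj (mu x)) * pd 1 f x + (conj (alpha x) - beta x) * dir (conjV (m x)) f x
        - (alpha x - conj (beta x)) * dir (m x) f x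
  D_rho : ∀ x ∈ T, pd 1 rho x =
    rho x ^ 2 + sigma x * conj (sigma x) + 2 * phi0 x * conj (phi0 x)
  D_sigma : ∀ x ∈ T, pd 1 sigma x = 2 * rho x * sigma x + Psi0 x
  D_tau : ∀ x ∈ T, pd 1 tau x =
    tau x * rho x + conj (tau x) * sigma x + Psi1 x + 2 * phi0 x * conj (phi1 x)
  D_alpha : ∀ x ∈ T, pd 1 alpha x =
    rho x * alpha x + beta x * conj (sigma x) + 2 * phi1 x * conj (phi0 x)
  D_beta : ∀ x ∈ T, pd 1 beta x = alpha x * sigma x + rho x * beta x + Psi1 x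
  D_gamma : ∀ x ∈ T, pd 1 gamma x =
    tau x * alpha x + conj (tau x) * beta x + Psi2 x - L + 2 * phi1 x * conj (phi1 x)
  D_lam : ∀ x ∈ T, pd 1 lam x =
    rho x * lam x + conj (sigma x) * mu x + 2 * phi2 x * conj (phi0 x)
  D_mu : ∀ x ∈ T, pd 1 mu x = rho x * mu x + sigma x * lam x + Psi2 x + 2 * L
  D_nu : ∀ x ∈ T, pd 1 nu x =
    conj (tau x) * mu x + tau x * lam x + Psi3 x + 2 * phi2 x * conj (phi1 x)
  Delta_lam : ∀ x ∈ T, dir (n x) lam x - dir (conjV (m x)) nu x =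
    -(mu x + conj (mu x)) * lam x - (3 * gamma x - conj (gamma x)) * lam x
      + (3 * alpha x + conj (beta x) - conj (tau x)) * nu x - Psi4 x
  delta_rho : ∀ x ∈ T, dir (m x) rho x - dir (conjV (m x)) sigma x =
    rho x * (conj (alpha x) + beta x) - sigma x * (3 * alpha x - conj (beta x)) - Psi1 x
      + 2 * phi0 x * conj (phi1 x)
  delta_alpha : ∀ x ∈ T, dir (m x) alpha x - dir (conjV (m x)) beta x =
    mu x * rho x - lam x * sigma x + alpha x * conj (alpha x) + beta x * conj (beta x)
      - 2 * alpha x * beta x - Psi2 x + L + 2 * phi1 x * conj (phi1 x)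
  delta_lam : ∀ x ∈ T, dir (m x) lam x - dir (conjV (m x)) mu x =
    mu x * (alpha x + conj (beta x)) + lam x * (conj (alpha x) - 3 * beta x) - Psi3 x
      + 2 * phi2 x * conj (phi1 x)
  delta_nu : ∀ x ∈ T, dir (m x) nu x - dir (n x) mu x =
    mu x ^ 2 + lam x * conj (lam x) + (gamma x + conj (gamma x)) * mu x
      + (tau x - 3 * beta x - conj (alpha x)) * nu x + 2 * phi2 x * conj (phi2 x)
  delta_gamma : ∀ x ∈ T, dir (m x) gamma x - dir (n x) beta x =
    mu x * tau x - sigma x * nu x - beta x * (gamma x - conj (gamma x) - mu x)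
      + alpha x * conj (lam x) + 2 * phi1 x * conj (phi2 x)
  delta_tau : ∀ x ∈ T, dir (m x) tau x - dir (n x) sigma x =
    mu x * sigma x + conj (lam x) * rho x + (tau x + beta x - conj (alpha x)) * tau x
      - (3 * gamma x - conj (gamma x)) * sigma x + 2 * phi0 x * conj (phi2 x)
  Delta_rho : ∀ x ∈ T, dir (n x) rho x - dir (conjV (m x)) tau x =
    -(rho x * conj (mu x) + sigma x * lam x)
      + (conj (beta x) - alpha x - conj (tau x)) * tau x
      + (gamma x + conj (gamma x)) * rho x - Psi2 x - 2 * L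
  Delta_alpha : ∀ x ∈ T, dir (n x) alpha x - dir (conjV (m x)) gamma x =
    rho x * nu x - (tau x + beta x) * lam x + (conj (gamma x) - conj (mu x)) * alpha x
      + (conj (beta x) - conj (tau x)) * gamma x - Psi3 x
  D_phi1 : ∀ x ∈ T, pd 1 phi1 x - dir (conjV (m x)) phi0 x =
    -2 * alpha x * phi0 x + 2 * rho x * phi1 x
  D_phi2 : ∀ x ∈ T, pd 1 phi2 x - dir (conjV (m x)) phi1 x = -lam x * phi0 x + rho x * phi2 x
  delta_phi1 : ∀ x ∈ T, dir (m x) phi1 x - dir (n x) phi0 x =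
    (mu x - 2 * gamma x) * phi0 x + 2 * tau x * phi1 x - sigma x * phi2 x
  delta_phi2 : ∀ x ∈ T, dir (m x) phi2 x - dir (n x) phi1 x =
    -nu x * phi0 x + 2 * mu x * phi1 x + (tau x - 2 * beta x) * phi2 x

/-- The components of the Riemann tensor of an electrovacuum in terms of the Weyl and Maxwell
components. -/
theorem riemann_components (R : Fin 4 → Fin 4 → Fin 4 → Fin 4 → ℂ)
    (hL : ∀ i j k l, R i j k l = -R j i k l) (hR : ∀ i j k l, R i j k l = -R i j l k)
    (hP : ∀ i j k l, R i j k l = R k l i j)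
    (hC : R 0 1 2 3 + R 0 2 3 1 + R 0 3 1 2 = 0)
    (Rc : Fin 4 → Fin 4 → ℂ)
    (hRc : ∀ i j, Rc i j = R 0 i j 1 + R 1 i j 0 - R 2 i j 3 - R 3 i j 2)
    (f0 f1 f2 c0 c1 c2 L P0 P1 P2 P3 P4 : ℂ)
    (h00 : Rc 0 0 = -4 * f0 * c0) (h02 : Rc 0 2 = -4 * f0 * c1) (h03 : Rc 0 3 = -4 * f1 * c0)
    (h11 : Rc 1 1 = -4 * f2 * c2) (h12 : Rc 1 2 = -4 * f1 * c2) (h13 : Rc 1 3 = -4 * f2 * c1)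
    (h22 : Rc 2 2 = -4 * f0 * c2) (h33 : Rc 3 3 = -4 * f2 * c0)
    (h01 : Rc 0 1 = 6 * L - 4 * f1 * c1) (h23 : Rc 2 3 = -6 * L - 4 * f1 * c1)
    (p0 : P0 = -R 0 2 0 2) (p1 : P1 = -R 0 1 0 2 + (1 / 2) * Rc 0 2)
    (p2 : P2 = -(1 / 2) * (R 0 1 0 1 - R 0 1 2 3) + (1 / 2) * Rc 0 1 - 2 * L)
    (p3 : P3 = -R 1 0 1 3 + (1 / 2) * Rc 1 3) (p4 : P4 = -R 1 3 1 3) :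
    R 2 0 0 3 = 2 * f0 * c0 ∧ R 2 0 0 2 = P0 ∧ R 2 0 0 1 = P1 + 2 * f0 * c1 ∧
    (1 / 2) * (R 1 0 0 3 - R 3 2 0 3) = 2 * f1 * c0 ∧ (1 / 2) * (R 1 0 0 2 - R 3 2 0 2) = P1 ∧
    (1 / 2) * (R 1 0 0 1 - R 3 2 0 1) = P2 - L + 2 * f1 * c1 ∧
    -R 3 1 0 3 = 2 * f2 * c0 ∧ -R 3 1 0 2 = P2 + 2 * L ∧ -R 3 1 0 1 = P3 + 2 * f2 * c1 ∧
    -R 3 1 1 3 = -P4 ∧ R 2 0 2 3 = -P1 + 2 * f0 * c1 ∧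
    (1 / 2) * (R 1 0 2 3 - R 3 2 2 3) = -P2 + L + 2 * f1 * c1 ∧
    -R 3 1 2 3 = -P3 + 2 * f2 * c1 ∧ -R 3 1 2 1 = 2 * f2 * c2 ∧
    (1 / 2) * (R 1 0 2 1 - R 3 2 2 1) = 2 * f1 * c2 ∧ R 2 0 2 1 = 2 * f0 * c2 ∧
    R 2 0 1 3 = -P2 - 2 * L ∧ (1 / 2) * (R 1 0 1 3 - R 3 2 1 3) = -P3 := by
  have hd : ∀ i k l, R i i k l = 0 := fun i k l => by
    have := hL i i k l
    linear_combination (1 / 2) * this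
  have hd' : ∀ i k l, R k l i i = 0 := fun i k l => by rw [hP, hd]
  -- Normal form: both index pairs increasing and the lexicographically smaller pair first. In these
  -- components the claims become consequences of a linear system.
  have e0121 : R 0 1 2 1 = -R 0 1 1 2 := hR 0 1 2 1
  have e0131 : R 0 1 3 1 = -R 0 1 1 3 := hR 0 1 3 1
  have e0221 : R 0 2 2 1 = -R 0 2 1 2 := hR 0 2 2 1
  have e0231 : R 0 2 3 1 = -R 0 2 1 3 := hR 0 2 3 1
  have e0331 : R 0 3 3 1 = -R 0 3 1 3 := hR 0 3 3 1
  have e1001 : R 1 0 0 1 = -R 0 1 0 1 := hL 1 0 0 1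
  have e1002 : R 1 0 0 2 = -R 0 1 0 2 := hL 1 0 0 2
  have e1003 : R 1 0 0 3 = -R 0 1 0 3 := hL 1 0 0 3
  have e1010 : R 1 0 1 0 = R 0 1 0 1 := by rw [hL 1 0 1 0, hR 0 1 1 0]; ring
  have e1013 : R 1 0 1 3 = -R 0 1 1 3 := hL 1 0 1 3
  have e1020 : R 1 0 2 0 = R 0 1 0 2 := by rw [hL 1 0 2 0, hR 0 1 2 0]; ring
  have e1021 : R 1 0 2 1 = R 0 1 1 2 := by rw [hL 1 0 2 1, hR 0 1 2 1]; ring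
  have e1023 : R 1 0 2 3 = -R 0 1 2 3 := hL 1 0 2 3
  have e1030 : R 1 0 3 0 = R 0 1 0 3 := by rw [hL 1 0 3 0, hR 0 1 3 0]; ring
  have e1220 : R 1 2 2 0 = -R 0 2 1 2 := by rw [hR 1 2 2 0, hP 1 2 0 2]
  have e1230 : R 1 2 3 0 = -R 0 3 1 2 := by rw [hR 1 2 3 0, hP 1 2 0 3]
  have e1330 : R 1 3 3 0 = -R 0 3 1 3 := by rw [hR 1 3 3 0, hP 1 3 0 3]
  have e2001 : R 2 0 0 1 = -R 0 1 0 2 := by rw [hL 2 0 0 1, hP 0 2 0 1]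
  have e2002 : R 2 0 0 2 = -R 0 2 0 2 := hL 2 0 0 2
  have e2003 : R 2 0 0 3 = -R 0 2 0 3 := hL 2 0 0 3
  have e2013 : R 2 0 1 3 = -R 0 2 1 3 := hL 2 0 1 3
  have e2021 : R 2 0 2 1 = R 0 2 1 2 := by rw [hL 2 0 2 1, hR 0 2 2 1]; ring
  have e2023 : R 2 0 2 3 = -R 0 2 2 3 := hL 2 0 2 3
  have e2113 : R 2 1 1 3 = -R 1 2 1 3 := hL 2 1 1 3
  have e2123 : R 2 1 2 3 = -R 1 2 2 3 := hL 2 1 2 3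
  have e3002 : R 3 0 0 2 = -R 0 2 0 3 := by rw [hL 3 0 0 2, hP 0 3 0 2]
  have e3012 : R 3 0 1 2 = -R 0 3 1 2 := hL 3 0 1 2
  have e3032 : R 3 0 3 2 = R 0 3 2 3 := by rw [hL 3 0 3 2, hR 0 3 3 2]; ring
  have e3101 : R 3 1 0 1 = -R 0 1 1 3 := by rw [hL 3 1 0 1, hP 1 3 0 1]
  have e3102 : R 3 1 0 2 = -R 0 2 1 3 := by rw [hL 3 1 0 2, hP 1 3 0 2]
  have e3103 : R 3 1 0 3 = -R 0 3 1 3 := by rw [hL 3 1 0 3, hP 1 3 0 3]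
  have e3112 : R 3 1 1 2 = -R 1 2 1 3 := by rw [hL 3 1 1 2, hP 1 3 1 2]
  have e3113 : R 3 1 1 3 = -R 1 3 1 3 := hL 3 1 1 3
  have e3121 : R 3 1 2 1 = R 1 2 1 3 := by rw [hL 3 1 2 1, hR 1 3 2 1, hP 1 3 1 2]; ring
  have e3123 : R 3 1 2 3 = -R 1 3 2 3 := hL 3 1 2 3
  have e3132 : R 3 1 3 2 = R 1 3 2 3 := by rw [hL 3 1 3 2, hR 1 3 3 2]; ring
  have e3201 : R 3 2 0 1 = -R 0 1 2 3 := by rw [hL 3 2 0 1, hP 2 3 0 1]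
  have e3202 : R 3 2 0 2 = -R 0 2 2 3 := by rw [hL 3 2 0 2, hP 2 3 0 2]
  have e3203 : R 3 2 0 3 = -R 0 3 2 3 := by rw [hL 3 2 0 3, hP 2 3 0 3]
  have e3213 : R 3 2 1 3 = -R 1 3 2 3 := by rw [hL 3 2 1 3, hP 2 3 1 3]
  have e3221 : R 3 2 2 1 = R 1 2 2 3 := by rw [hL 3 2 2 1, hR 2 3 2 1, hP 2 3 1 2]; ring
  have e3223 : R 3 2 2 3 = -R 2 3 2 3 := hL 3 2 2 3
  have e3232 : R 3 2 3 2 = R 2 3 2 3 := by rw [hL 3 2 3 2, hR 2 3 3 2]; ring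
  rw [hRc] at h00 h02 h03 h11 h12 h13 h22 h33 h01 h23 p1 p2 p3
  simp only [hd, hd', e0121, e0131, e0221, e0231, e0331, e1001, e1002, e1003, e1010, e1013,
    e1020, e1021, e1023, e1030, e1220, e1230, e1330, e2001, e2002, e2003, e2013, e2021, e2023,
    e2113, e2123, e3002, e3012, e3032, e3101, e3102, e3103, e3112, e3113, e3121, e3123, e3132,
    e3201, e3202, e3203, e3213, e3221, e3223,
    e3232] at hC h00 h02 h03 h11 h12 h13 h22 h33 h01 h23 p1 p2 p3 ⊢
  clear hL hR hP hd hd' hRc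
  refine ⟨?_, ?_, ?_, ?_, ?_, ?_, ?_, ?_, ?_, ?_, ?_, ?_, ?_, ?_, ?_, ?_, ?_, ?_⟩ <;> grind

/-! ## Spin coefficients of a parallelly propagated tetrad -/

/-- A smooth null tetrad which is parallelly propagated along `ℓ = ∂_r`, with `ℓ_a = (du)_a`. -/
structure GaugedTetrad (T : Set R4) (G : MetricComp) (E : Fin 4 → R4 → Fin 4 → ℂ) : Prop
    extends SmoothTetrad T G E where
  parallel : ∀ x ∈ T, ∀ j k, conn G E 0 j k x = 0
  u_comp : ∀ x i, E i x 0 = if i = 1 then 1 else 0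
  l_eq : ∀ x, E 0 x = ![0, 1, 0, 0]

/-- The source-free Einstein-Maxwell equations on a coordinate domain. -/
structure ElectrovacuumOn (T : Set R4) (G : MetricComp) (F : R4 → Matrix (Fin 4) (Fin 4) ℝ)
    (Λ : ℝ) : Prop where
  F_smooth : ∀ a b, ContDiffOn ℝ ∞ (fun x => F x a b) T
  F_antisymm : ∀ x a b, F x a b = -F x b a
  maxwell_div : ∀ x ∈ T, ∀ b, ∑ a, ∑ c, (G x)⁻¹ a c * covDerivTwo G F c a b x = 0
  maxwell_closed : ∀ x ∈ T, ∀ a b c,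
    covDerivTwo G F a b c x + covDerivTwo G F b c a x + covDerivTwo G F c a b x = 0
  einstein : ∀ x ∈ T, ∀ a b, ricci G a b x - (1 / 2) * G x a b * scalarCurv G x + Λ * G x a b =
    -(8 * Real.pi) * maxwellStress G F a b x

section spin

variable (G : MetricComp) (E : Fin 4 → R4 → Fin 4 → ℂ)

/-- The spin coefficient `α`. -/
noncomputable def spinAlpha (x : R4) : ℂ := (1 / 2) * (conn G E 3 0 1 x - conn G E 3 2 3 x)

/-- The spin coefficient `β`. -/
noncomputable def spinBeta (x : R4) : ℂ := (1 / 2) * (conn G E 2 0 1 x - conn G E 2 2 3 x)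

/-- The spin coefficient `γ`. -/
noncomputable def spinGamma (x : R4) : ℂ := (1 / 2) * (conn G E 1 0 1 x - conn G E 1 2 3 x)

/-- The Weyl component `Ψ₂`. -/
noncomputable def weylPsi2 (x : R4) : ℂ :=
  -(1 / 2) * (weylC G x (E 0 x) (E 1 x) (E 0 x) (E 1 x) - weylC G x (E 0 x) (E 1 x) (E 2 x) (E 3 x))

/-- The Maxwell component `φ₁`. -/
noncomputable def maxwellPhi1 (F : R4 → Matrix (Fin 4) (Fin 4) ℝ) (x : R4) : ℂ :=
  (1 / 2) * (contr2 (F x) (E 0 x) (E 1 x) + contr2 (F x) (E 3 x) (E 2 x))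

end spin

theorem dir_lin {T : Set R4} (hT : IsOpen T) {x : R4} (hx : x ∈ T) (W : Fin 4 → ℂ) {f g : R4 → ℂ}
    (hf : Sm T f) (hg : Sm T g) (c : ℂ) :
    dir W (fun y => c * (f y - g y)) x = c * (dir W f x - dir W g x) := by
  have e : ∀ a, pd a (fun y => c * (f y - g y)) x = c * (pd a f x - pd a g x) := by
    intro a
    rw [pd_mul (Sm.const c |>.diff hT hx) ((hf.sub hg).diff hT hx),
      pd_sub (hf.diff hT hx) (hg.diff hT hx), pd_const]
    ring
  simp only [dir, e, Fin.sum_univ_four]; ring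

theorem dir_neg (x : R4) (W : Fin 4 → ℂ) (f : R4 → ℂ) :
    dir W (fun y => -f y) x = -dir W f x := by
  simp [dir, pd_neg]

theorem dir_r (f : R4 → ℂ) (x : R4) : dir ![0, 1, 0, 0] f x = pd 1 f x := by
  simp [dir, Fin.sum_univ_four]

namespace GaugedTetrad

variable {T : Set R4} {G : MetricComp} {E : Fin 4 → R4 → Fin 4 → ℂ} (h : GaugedTetrad T G E)

include h

theorem spinAlpha_sm : Sm T (spinAlpha G E) :=
  (Sm.const _).mul ((h.conn_smooth 3 0 1).sub (h.conn_smooth 3 2 3))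

theorem spinBeta_sm : Sm T (spinBeta G E) :=
  (Sm.const _).mul ((h.conn_smooth 2 0 1).sub (h.conn_smooth 2 2 3))

theorem spinGamma_sm : Sm T (spinGamma G E) :=
  (Sm.const _).mul ((h.conn_smooth 1 0 1).sub (h.conn_smooth 1 2 3))

theorem conn_self {x : R4} (hx : x ∈ T) (i j : Fin 4) : conn G E i j j x = 0 := by
  have := h.conn_antisymm hx i j j
  linear_combination (1 / 2) * this

/-- Taking the u-component of the frame expansion isolates the coefficient of n, the only frame
vector with a u-component; hence ℓ_a = (du)_a. -/
theorem ip_l {x : R4} (hx : x ∈ T) (v : Fin 4 → ℂ) : ip G x (E 0 x) v = v 0 := by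
  have h1 := congrFun (h.expand4 hx v) 0
  simp only [Pi.add_apply, Pi.sub_apply, Pi.smul_apply, h.u_comp, smul_eq_mul] at h1
  simp at h1
  exact h1.symm

/-- The form ℓ_a = (du)_a is closed: brackets of frame fields have no u-component, because the
u-components of the frame are constant. This is the source of ρ = ρ̄ and τ = ᾱ + β. -/
theorem conn_l {x : R4} (hx : x ∈ T) (i j : Fin 4) : conn G E i j 0 x = conn G E j i 0 x := by
  have h1 := h.torsion_free (E i) (E j) x 0
  simp only [conn, h.ip_l hx]
  have h2 : ∀ i j, dir (E i x) (fun y => E j y 0) x = 0 := by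
    intro i j
    simp only [dir, h.u_comp]
    refine Finset.sum_eq_zero fun a _ => by rw [pd_const, mul_zero]
  rw [h2, h2, sub_zero, sub_eq_zero] at h1
  exact h1

/-- All connection coefficients in terms of the spin coefficients. -/
theorem conn_values {x : R4} (hx : x ∈ T) :
    conn G E 2 0 3 x = conn G E 3 0 2 x ∧ conj (conn G E 3 0 2 x) = conn G E 3 0 2 x ∧
    conn G E 1 0 3 x = conj (conn G E 1 0 2 x) ∧ conn G E 3 0 3 x = conj (conn G E 2 0 2 x) ∧
    conn G E 1 1 2 x = conj (conn G E 1 1 3 x) ∧ conn G E 3 1 2 x = conj (conn G E 2 1 3 x) ∧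
    conn G E 2 1 2 x = conj (conn G E 3 1 3 x) ∧
    conn G E 1 0 1 x = spinGamma G E x + conj (spinGamma G E x) ∧
    conn G E 2 0 1 x = spinBeta G E x + conj (spinAlpha G E x) ∧
    conn G E 3 0 1 x = spinAlpha G E x + conj (spinBeta G E x) ∧
    conn G E 1 2 3 x = conj (spinGamma G E x) - spinGamma G E x ∧
    conn G E 2 2 3 x = conj (spinAlpha G E x) - spinBeta G E x ∧
    conn G E 3 2 3 x = conj (spinBeta G E x) - spinAlpha G E x ∧
    conn G E 1 0 2 x = conj (spinAlpha G E x) + spinBeta G E x := by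
  have c := h.conj_conn
  have a := h.conn_antisymm hx
  have cρ : conn G E 2 0 3 x = conn G E 3 0 2 x := by
    rw [a 2 0 3, a 3 0 2, h.conn_l hx 2 3]
  have c1 := c 3 0 2 x
  have c2 := c 1 0 2 x
  have c3 := c 2 0 2 x
  have c4 := c 1 1 3 x
  have c5 := c 2 1 3 x
  have c6 := c 3 1 3 x
  have g1 := c 1 0 1 x
  have g2 := c 1 2 3 x
  have a1 := c 3 0 1 x
  have a2 := c 3 2 3 x
  have b1 := c 2 0 1 x
  have b2 := c 2 2 3 x
  simp only [bar, Matrix.cons_val] at c1 c2 c3 c4 c5 c6 g1 g2 a1 a2 b1 b2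
  rw [a 1 3 2] at g2
  rw [a 2 3 2] at a2
  rw [a 3 3 2] at b2
  have e201 : conn G E 2 0 1 x = spinBeta G E x + conj (spinAlpha G E x) := by
    simp only [spinBeta, spinAlpha, map_mul, map_sub, a1, a2, map_div₀, map_one, map_ofNat]; ring
  refine ⟨cρ, c1.trans cρ, c2.symm, c3.symm, c4.symm, c5.symm, c6.symm, ?_, e201, ?_, ?_, ?_, ?_,
    ?_⟩
  · simp only [spinGamma, map_mul, map_sub, g1, g2, map_div₀, map_one, map_ofNat]; ring
  · simp only [spinBeta, spinAlpha, map_mul, map_sub, b1, b2, map_div₀, map_one, map_ofNat]; ring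
  · simp only [spinGamma, map_mul, map_sub, g1, g2, map_div₀, map_one, map_ofNat]; ring
  · simp only [spinBeta, spinAlpha, map_mul, map_sub, a1, a2, map_div₀, map_one, map_ofNat]; ring
  · simp only [spinBeta, spinAlpha, map_mul, map_sub, b1, b2, map_div₀, map_one, map_ofNat]; ring
  · rw [a 1 0 2, h.conn_l hx 1 2, a 2 1 0, e201]; ring

end GaugedTetrad

/-! ### Ricci and curvature components of an electrovacuum -/

namespace GaugedTetrad

variable {T : Set R4} {G : MetricComp} {E : Fin 4 → R4 → Fin 4 → ℂ} (h : GaugedTetrad T G E)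
  {F : R4 → Matrix (Fin 4) (Fin 4) ℝ} {Λ : ℝ} (hF : ElectrovacuumOn T G F Λ)

include h hF

/-- The Ricci components and the scalar curvature of an electrovacuum. -/
theorem ricci_values {x : R4} (hx : x ∈ T) (f0 f1 f2 : ℂ)
    (h0 : f0 = contr2 (F x) (E 0 x) (E 2 x)) (h1 : f1 = maxwellPhi1 E F x)
    (h2 : f2 = contr2 (F x) (E 3 x) (E 1 x)) :
    (scalarCurv G x : ℂ) = 4 * Λ ∧
    ricciC G x (E 0 x) (E 0 x) = -4 * f0 * conj f0 ∧
    ricciC G x (E 0 x) (E 2 x) = -4 * f0 * conj f1 ∧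
    ricciC G x (E 0 x) (E 3 x) = -4 * f1 * conj f0 ∧
    ricciC G x (E 1 x) (E 1 x) = -4 * f2 * conj f2 ∧
    ricciC G x (E 1 x) (E 2 x) = -4 * f1 * conj f2 ∧
    ricciC G x (E 1 x) (E 3 x) = -4 * f2 * conj f1 ∧
    ricciC G x (E 2 x) (E 2 x) = -4 * f0 * conj f2 ∧
    ricciC G x (E 3 x) (E 3 x) = -4 * f2 * conj f0 ∧
    ricciC G x (E 0 x) (E 1 x) = Λ - 4 * f1 * conj f1 ∧
    ricciC G x (E 2 x) (E 3 x) = -Λ - 4 * f1 * conj f1 := by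
  have ha : ∀ i j, contr2 (F x) (E i x) (E j x) = -contr2 (F x) (E j x) (E i x) :=
    fun i j => contr2_antisymm (hF.F_antisymm x) _ _
  have hz : ∀ i, contr2 (F x) (E i x) (E i x) = 0 := fun i => by
    have := ha i i
    linear_combination (1 / 2) * this
  have hc : ∀ i j, conj (contr2 (F x) (E i x) (E j x)) =
      contr2 (F x) (E (bar i) x) (E (bar j) x) := by
    intro i j; exact (conj_contr2 _ _ _).trans (by rw [h.real, h.real])
  obtain ⟨hs, hr⟩ := h.einstein_frame hx (hF.einstein x hx) _ rfl
  have c0 : conj f0 = contr2 (F x) (E 0 x) (E 3 x) := by rw [h0, hc]; rfl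
  have c2 : conj f2 = contr2 (F x) (E 2 x) (E 1 x) := by rw [h2, hc]; rfl
  -- The products F(ℓ,n) and F(m̄,m) are the real part and i times the imaginary part of φ₁, up to a
  -- factor 2; thus f₀, f₁, f₂ and their conjugates account for all components of F.
  have c1 : conj f1 = (1 / 2) * (contr2 (F x) (E 0 x) (E 1 x) - contr2 (F x) (E 3 x) (E 2 x)) := by
    rw [h1, maxwellPhi1, map_mul, map_add, hc, hc, map_div₀, map_one, map_ofNat, sub_eq_add_neg,
      ← ha 2 3]; rfl
  rw [maxwellPhi1] at h1
  have b01 : contr2 (F x) (E 0 x) (E 1 x) = f1 + conj f1 := by rw [c1, h1]; ring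
  have b32 : contr2 (F x) (E 3 x) (E 2 x) = f1 - conj f1 := by rw [c1, h1]; ring
  have b10 := ha 1 0
  have b23 := ha 2 3
  have b20 := ha 2 0
  have b30 := ha 3 0
  have b13 := ha 1 3
  have b12 := ha 1 2
  rw [b01] at b10
  rw [b32] at b23
  rw [← h0] at b20
  rw [← c0] at b30
  rw [← h2] at b13
  rw [← c2] at b12
  simp only [eta_sum, hz, ← h0, ← c0, ← h2, ← c2, b01, b32, b10, b23, b20, b30, b13, b12] at hr
  refine ⟨hs, ?_, ?_, ?_, ?_, ?_, ?_, ?_, ?_, ?_, ?_⟩ <;> rw [hr] <;> simp only [eta] <;>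
    simp only [hz, ← h0, ← c0, ← h2, ← c2, b01, b32, b10, b23, b20, b30, b13, b12] <;> simp <;> ring

/-- The curvature components of an electrovacuum. -/
theorem riemann_values {x : R4} (hx : x ∈ T) (f0 f1 f2 L : ℂ)
    (h0 : f0 = contr2 (F x) (E 0 x) (E 2 x)) (h1 : f1 = maxwellPhi1 E F x)
    (h2 : f2 = contr2 (F x) (E 3 x) (E 1 x)) (hL : L = Λ / 6)
    (R : Fin 4 → Fin 4 → Fin 4 → Fin 4 → ℂ)
    (hR : R = fun i j k l => riemC G x (E i x) (E j x) (E k x) (E l x))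
    (P0 P1 P2 P3 P4 : ℂ) (p0 : P0 = -weylC G x (E 0 x) (E 2 x) (E 0 x) (E 2 x))
    (p1 : P1 = -weylC G x (E 0 x) (E 1 x) (E 0 x) (E 2 x)) (p2 : P2 = weylPsi2 G E x)
    (p3 : P3 = -weylC G x (E 1 x) (E 0 x) (E 1 x) (E 3 x))
    (p4 : P4 = -weylC G x (E 1 x) (E 3 x) (E 1 x) (E 3 x)) :
    R 2 0 0 3 = 2 * f0 * conj f0 ∧ R 2 0 0 2 = P0 ∧ R 2 0 0 1 = P1 + 2 * f0 * conj f1 ∧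
    (1 / 2) * (R 1 0 0 3 - R 3 2 0 3) = 2 * f1 * conj f0 ∧
    (1 / 2) * (R 1 0 0 2 - R 3 2 0 2) = P1 ∧
    (1 / 2) * (R 1 0 0 1 - R 3 2 0 1) = P2 - L + 2 * f1 * conj f1 ∧
    -R 3 1 0 3 = 2 * f2 * conj f0 ∧ -R 3 1 0 2 = P2 + 2 * L ∧ -R 3 1 0 1 = P3 + 2 * f2 * conj f1 ∧
    -R 3 1 1 3 = -P4 ∧ R 2 0 2 3 = -P1 + 2 * f0 * conj f1 ∧
    (1 / 2) * (R 1 0 2 3 - R 3 2 2 3) = -P2 + L + 2 * f1 * conj f1 ∧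
    -R 3 1 2 3 = -P3 + 2 * f2 * conj f1 ∧ -R 3 1 2 1 = 2 * f2 * conj f2 ∧
    (1 / 2) * (R 1 0 2 1 - R 3 2 2 1) = 2 * f1 * conj f2 ∧ R 2 0 2 1 = 2 * f0 * conj f2 ∧
    R 2 0 1 3 = -P2 - 2 * L ∧ (1 / 2) * (R 1 0 1 3 - R 3 2 1 3) = -P3 := by
  obtain ⟨hs, r00, r02, r03, r11, r12, r13, r22, r33, r01, r23⟩ := h.ricci_values hF hx f0 f1 f2
    h0 h1 h2
  have g := h.gram x hx
  rw [weylC_eq] at p0 p1 p3 p4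
  rw [weylPsi2, weylC_eq, weylC_eq] at p2
  simp only [g] at p0 p1 p2 p3 p4
  have r20 : ricciC G x (E 1 x) (E 0 x) = ricciC G x (E 0 x) (E 1 x) := by
    have hP := h.riemC_pair hx
    have hA := h.riemC_antisymm_left hx
    have hB := h.riemC_antisymm_right hx
    rw [h.ricciC_frame hx, h.ricciC_frame hx]
    linear_combination hA 0 1 0 1 - hB 1 0 0 1 + (1 / 2) * hA 1 1 0 0 - (1 / 2) * hA 0 0 1 1
      - (hP 2 1 0 3 + hA 0 3 2 1 - hB 3 0 2 1) - (hP 3 1 0 2 + hA 0 2 3 1 - hB 2 0 3 1)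
  refine riemann_components R ?_ ?_ ?_ ?_ (fun i j => ricciC G x (E i x) (E j x)) ?_
    f0 f1 f2 (conj f0) (conj f1) (conj f2) L P0 P1 P2 P3 P4 r00 r02 r03 r11 r12 r13 r22 r33
    ?_ ?_ ?_ ?_ ?_ ?_ ?_
  · intro i j k l; rw [hR]; exact h.riemC_antisymm_left hx i j k l
  · intro i j k l; rw [hR]; exact h.riemC_antisymm_right hx i j k l
  · intro i j k l; rw [hR]; exact h.riemC_pair hx i j k l
  · rw [hR]; exact riemC_cyclic h.symm x _ _ _ _
  · intro i j; rw [hR]; exact h.ricciC_frame hx _ _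
  · simp only [r01, hL]; ring
  · simp only [r23, hL]; ring
  · rw [p0, hR]; simp [eta]
  · rw [p1, hR]; simp [eta]; ring
  · rw [p2, hR, hs, hL, r20]; simp [eta]; ring
  · rw [p3, hR]; simp [eta]; ring
  · rw [p4, hR]; simp [eta]

end GaugedTetrad

/-! ### Derivation of the Newman-Penrose and Maxwell equations -/

namespace GaugedTetrad

variable {T : Set R4} {G : MetricComp} {E : Fin 4 → R4 → Fin 4 → ℂ} (h : GaugedTetrad T G E)
  {F : R4 → Matrix (Fin 4) (Fin 4) ℝ} {Λ : ℝ} (hF : ElectrovacuumOn T G F Λ)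

include h hF

/-- Each equation compares two evaluations of one combination of curvature components: by connection
coefficients in `riemC_frame`, and by Weyl and Maxwell components in `riemann_values`. The minus
signs in the hypotheses on μ, λ, ν arise because these coefficients are defined with derivatives of
n but the opposite sign to ρ, σ, τ. -/
theorem np_equations {x : R4} (hx : x ∈ T) (ρ σ τ α β γ μ lam ν f0 f1 f2 L P0 P1 P2 P3 P4 : ℂ)
    (eρ : conn G E 3 0 2 x = ρ) (eσ : conn G E 2 0 2 x = σ) (eτ : conn G E 1 0 2 x = τ)
    (eα : spinAlpha G E x = α) (eβ : spinBeta G E x = β) (eγ : spinGamma G E x = γ)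
    (eμ : conn G E 2 1 3 x = -μ) (elam : conn G E 3 1 3 x = -lam) (eν : conn G E 1 1 3 x = -ν)
    (h0 : f0 = contr2 (F x) (E 0 x) (E 2 x)) (h1 : f1 = maxwellPhi1 E F x)
    (h2 : f2 = contr2 (F x) (E 3 x) (E 1 x)) (hL : L = Λ / 6)
    (p0 : P0 = -weylC G x (E 0 x) (E 2 x) (E 0 x) (E 2 x))
    (p1 : P1 = -weylC G x (E 0 x) (E 1 x) (E 0 x) (E 2 x)) (p2 : P2 = weylPsi2 G E x)
    (p3 : P3 = -weylC G x (E 1 x) (E 0 x) (E 1 x) (E 3 x))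
    (p4 : P4 = -weylC G x (E 1 x) (E 3 x) (E 1 x) (E 3 x)) :
    dir (E 0 x) (conn G E 3 0 2) x = ρ ^ 2 + σ * conj σ + 2 * f0 * conj f0 ∧
    dir (E 0 x) (conn G E 2 0 2) x = 2 * ρ * σ + P0 ∧
    dir (E 0 x) (conn G E 1 0 2) x = τ * ρ + conj τ * σ + P1 + 2 * f0 * conj f1 ∧
    (1 / 2) * (dir (E 0 x) (conn G E 3 0 1) x - dir (E 0 x) (conn G E 3 2 3) x) =
      ρ * α + β * conj σ + 2 * f1 * conj f0 ∧
    (1 / 2) * (dir (E 0 x) (conn G E 2 0 1) x - dir (E 0 x) (conn G E 2 2 3) x) =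
      α * σ + ρ * β + P1 ∧
    (1 / 2) * (dir (E 0 x) (conn G E 1 0 1) x - dir (E 0 x) (conn G E 1 2 3) x) =
      τ * α + conj τ * β + P2 - L + 2 * f1 * conj f1 ∧
    -dir (E 0 x) (conn G E 3 1 3) x = ρ * lam + conj σ * μ + 2 * f2 * conj f0 ∧
    -dir (E 0 x) (conn G E 2 1 3) x = ρ * μ + σ * lam + P2 + 2 * L ∧
    -dir (E 0 x) (conn G E 1 1 3) x = conj τ * μ + τ * lam + P3 + 2 * f2 * conj f1 ∧
    -dir (E 1 x) (conn G E 3 1 3) x + dir (E 3 x) (conn G E 1 1 3) x =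
      -(μ + conj μ) * lam - (3 * γ - conj γ) * lam + (3 * α + conj β - conj τ) * ν - P4 ∧
    dir (E 2 x) (conn G E 3 0 2) x - dir (E 3 x) (conn G E 2 0 2) x =
      ρ * (conj α + β) - σ * (3 * α - conj β) - P1 + 2 * f0 * conj f1 ∧
    (1 / 2) * (dir (E 2 x) (conn G E 3 0 1) x - dir (E 2 x) (conn G E 3 2 3) x)
      - (1 / 2) * (dir (E 3 x) (conn G E 2 0 1) x - dir (E 3 x) (conn G E 2 2 3) x) =
      μ * ρ - lam * σ + α * conj α + β * conj β - 2 * α * β - P2 + L + 2 * f1 * conj f1 ∧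
    -dir (E 2 x) (conn G E 3 1 3) x + dir (E 3 x) (conn G E 2 1 3) x =
      μ * (α + conj β) + lam * (conj α - 3 * β) - P3 + 2 * f2 * conj f1 ∧
    -dir (E 2 x) (conn G E 1 1 3) x + dir (E 1 x) (conn G E 2 1 3) x =
      μ ^ 2 + lam * conj lam + (γ + conj γ) * μ + (τ - 3 * β - conj α) * ν + 2 * f2 * conj f2 ∧
    (1 / 2) * (dir (E 2 x) (conn G E 1 0 1) x - dir (E 2 x) (conn G E 1 2 3) x)
      - (1 / 2) * (dir (E 1 x) (conn G E 2 0 1) x - dir (E 1 x) (conn G E 2 2 3) x) =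
      μ * τ - σ * ν - β * (γ - conj γ - μ) + α * conj lam + 2 * f1 * conj f2 ∧
    dir (E 2 x) (conn G E 1 0 2) x - dir (E 1 x) (conn G E 2 0 2) x =
      μ * σ + conj lam * ρ + (τ + β - conj α) * τ - (3 * γ - conj γ) * σ + 2 * f0 * conj f2 ∧
    dir (E 1 x) (conn G E 3 0 2) x - dir (E 3 x) (conn G E 1 0 2) x =
      -(ρ * conj μ + σ * lam) + (conj β - α - conj τ) * τ + (γ + conj γ) * ρ - P2 - 2 * L ∧
    (1 / 2) * (dir (E 1 x) (conn G E 3 0 1) x - dir (E 1 x) (conn G E 3 2 3) x)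
      - (1 / 2) * (dir (E 3 x) (conn G E 1 0 1) x - dir (E 3 x) (conn G E 1 2 3) x) =
      ρ * ν - (τ + β) * lam + (conj γ - conj μ) * α + (conj β - conj τ) * γ - P3 := by
  obtain ⟨r1, r2, r3, r4, r5, r6, r7, r8, r9, r10, r11, r12, r13, r14, r15, r16, r17, r18⟩ :=
    h.riemann_values hF hx f0 f1 f2 L h0 h1 h2 hL _ rfl P0 P1 P2 P3 P4 p0 p1 p2 p3 p4
  obtain ⟨v1, v2, v3, v4, v5, v6, v7, v8, v9, v10, v11, v12, v13, v14⟩ := h.conn_values hx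
  rw [eρ] at v1 v2
  rw [eτ] at v3 v14
  rw [eσ] at v4
  rw [eν, map_neg] at v5
  rw [eμ, map_neg] at v6
  rw [elam, map_neg] at v7
  rw [eγ] at v8 v11
  rw [eα, eβ] at v9 v10 v12 v13 v14
  have z := h.parallel x hx
  have s := h.conn_self hx
  have a10 := fun i => h.conn_antisymm hx i 1 0
  have a20 := fun i => h.conn_antisymm hx i 2 0
  have a30 := fun i => h.conn_antisymm hx i 3 0
  have a21 := fun i => h.conn_antisymm hx i 2 1
  have a31 := fun i => h.conn_antisymm hx i 3 1
  have a32 := fun i => h.conn_antisymm hx i 3 2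
  have cτ : conj τ = α + conj β := by rw [v14]; simp
  -- Parallel propagation holds on the whole open domain, so the derivatives of the vanishing
  -- coefficients vanish in every direction.
  have d0 : ∀ Y j k, dir Y (conn G E 0 j k) x = 0 := by
    intro Y j k
    simp only [dir]
    refine Finset.sum_eq_zero fun a _ => ?_
    rw [pd_congr h.isOpen hx (g := fun _ => 0) fun y hy => h.parallel y hy j k, pd_const, mul_zero]
  simp only [h.riemC_frame hx, z, s, a10, a20, a30, a21, a31, a32, v1, v3, v4, v5, v6, v7, v8, v9,
    v10, v11, v12, v13, eρ, eσ, eτ, eμ, elam, eν, d0] at r1 r2 r3 r4 r5 r6 r7 r8 r9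
  simp only [h.riemC_frame hx, z, s, a10, a20, a30, a21, a31, a32, v1, v3, v4, v5, v6, v7, v8, v9,
    v10, v11, v12, v13, eρ, eσ, eτ, eμ, elam, eν] at r10 r11 r12 r13 r14 r15 r16 r17 r18
  rw [v14] at *
  refine ⟨?_, ?_, ?_, ?_, ?_, ?_, ?_, ?_, ?_, ?_, ?_, ?_, ?_, ?_, ?_, ?_, ?_, ?_⟩
  · linear_combination r1
  · linear_combination r2
  · linear_combination r3
  · linear_combination r4
  · linear_combination r5
  · linear_combination r6
  · linear_combination r7
  · linear_combination r8
  · linear_combination r9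
  · linear_combination r10
  · linear_combination r11
  · linear_combination r12
  · linear_combination r13
  · linear_combination r14
  · linear_combination r15
  · linear_combination r16
  · linear_combination r17
  · linear_combination r18

/-- The divergence equations and the cyclic equations each mix φ₀, φ₁, φ₂ with their conjugates;
half their sum or difference isolates the self-dual part of F, which satisfies an equation without
conjugates of the φ_i. -/
theorem maxwell_equations {x : R4} (hx : x ∈ T) (ρ σ τ α β γ μ lam ν f0 f1 f2 : ℂ)
    (eρ : conn G E 3 0 2 x = ρ) (eσ : conn G E 2 0 2 x = σ) (eτ : conn G E 1 0 2 x = τ)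
    (eα : spinAlpha G E x = α) (eβ : spinBeta G E x = β) (eγ : spinGamma G E x = γ)
    (eμ : conn G E 2 1 3 x = -μ) (elam : conn G E 3 1 3 x = -lam) (eν : conn G E 1 1 3 x = -ν)
    (h0 : f0 = contr2 (F x) (E 0 x) (E 2 x)) (h1 : f1 = maxwellPhi1 E F x)
    (h2 : f2 = contr2 (F x) (E 3 x) (E 1 x)) :
    dir (E 0 x) (maxwellPhi1 E F) x - dir (E 3 x) (fun y => contr2 (F y) (E 0 y) (E 2 y)) x =
      -2 * α * f0 + 2 * ρ * f1 ∧
    dir (E 0 x) (fun y => contr2 (F y) (E 3 y) (E 1 y)) x - dir (E 3 x) (maxwellPhi1 E F) x =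
      -lam * f0 + ρ * f2 ∧
    dir (E 2 x) (maxwellPhi1 E F) x - dir (E 1 x) (fun y => contr2 (F y) (E 0 y) (E 2 y)) x =
      (μ - 2 * γ) * f0 + 2 * τ * f1 - σ * f2 ∧
    dir (E 2 x) (fun y => contr2 (F y) (E 3 y) (E 1 y)) x - dir (E 1 x) (maxwellPhi1 E F) x =
      -ν * f0 + 2 * μ * f1 + (τ - 2 * β) * f2 := by
  have ha : ∀ y i j, contr2 (F y) (E i y) (E j y) = -contr2 (F y) (E j y) (E i y) :=
    fun y i j => contr2_antisymm (hF.F_antisymm y) _ _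
  have hz : ∀ i, contr2 (F x) (E i x) (E i x) = 0 := fun i => by
    have := ha x i i
    linear_combination (1 / 2) * this
  have hda : ∀ k i j, dir (E k x) (fun y => contr2 (F y) (E i y) (E j y)) x =
      -dir (E k x) (fun y => contr2 (F y) (E j y) (E i y)) x := by
    intro k i j
    rw [← dir_neg]
    congr 1
    funext y
    exact ha y i j
  have hdz : ∀ k i, dir (E k x) (fun y => contr2 (F y) (E i y) (E i y)) x = 0 := fun k i => by
    have := hda k i i
    linear_combination (1 / 2) * this
  have hc : ∀ k i j, covF G F x (E k x) (E i x) (E j x) =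
      dir (E k x) (fun y => contr2 (F y) (E i y) (E j y)) x
      - (conn G E k i 1 x * contr2 (F x) (E 0 x) (E j x)
        + conn G E k i 0 x * contr2 (F x) (E 1 x) (E j x)
        - conn G E k i 3 x * contr2 (F x) (E 2 x) (E j x)
        - conn G E k i 2 x * contr2 (F x) (E 3 x) (E j x))
      - (conn G E k j 1 x * contr2 (F x) (E i x) (E 0 x)
        + conn G E k j 0 x * contr2 (F x) (E i x) (E 1 x)
        - conn G E k j 3 x * contr2 (F x) (E i x) (E 2 x)
        - conn G E k j 2 x * contr2 (F x) (E i x) (E 3 x)) := by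
    intro k i j
    have l1 : ∀ (a b c d : ℂ) (v : Fin 4 → ℂ),
        contr2 (F x) (a • E 0 x + b • E 1 x - c • E 2 x - d • E 3 x) v =
        a * contr2 (F x) (E 0 x) v + b * contr2 (F x) (E 1 x) v - c * contr2 (F x) (E 2 x) v
        - d * contr2 (F x) (E 3 x) v := by
      intro a b c d v
      simp only [contr2, Finset.mul_sum, ← Finset.sum_add_distrib, ← Finset.sum_sub_distrib]
      refine Finset.sum_congr rfl fun p _ => Finset.sum_congr rfl fun q _ => ?_
      simp only [Pi.add_apply, Pi.sub_apply, Pi.smul_apply, smul_eq_mul]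
      ring
    have l2 : ∀ (a b c d : ℂ) (v : Fin 4 → ℂ),
        contr2 (F x) v (a • E 0 x + b • E 1 x - c • E 2 x - d • E 3 x) =
        a * contr2 (F x) v (E 0 x) + b * contr2 (F x) v (E 1 x) - c * contr2 (F x) v (E 2 x)
        - d * contr2 (F x) v (E 3 x) := by
      intro a b c d v
      simp only [contr2, Finset.mul_sum, ← Finset.sum_add_distrib, ← Finset.sum_sub_distrib]
      refine Finset.sum_congr rfl fun p _ => Finset.sum_congr rfl fun q _ => ?_
      simp only [Pi.add_apply, Pi.sub_apply, Pi.smul_apply, smul_eq_mul]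
      ring
    rw [h.covF_frame hF.F_smooth hx, h.covDeriv_frame hx k i, h.covDeriv_frame hx k j, l1, l2]
  have hd1 : ∀ Y, dir Y (maxwellPhi1 E F) x =
      (1 / 2) * (dir Y (fun y => contr2 (F y) (E 0 y) (E 1 y)) x
        + dir Y (fun y => contr2 (F y) (E 3 y) (E 2 y)) x) := by
    intro Y
    have e1 := dir_lin h.isOpen hx Y (h.contr2_smooth hF.F_smooth 0 1)
      (h.contr2_smooth hF.F_smooth 3 2).neg (1 / 2)
    rw [dir_neg] at e1
    simp only [sub_neg_eq_add] at e1
    exact e1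
  have dv := h.maxwell_div_frame hx (hF.maxwell_div x hx)
  have cl := maxwell_closed_frame (hF.maxwell_closed x hx)
  have dv0 := dv 0
  have dv1 := dv 1
  have dv2 := dv 2
  have dv3 := dv 3
  have cl1 := cl (E 0 x) (E 3 x) (E 2 x)
  have cl2 := cl (E 0 x) (E 1 x) (E 2 x)
  have cl3 := cl (E 0 x) (E 1 x) (E 3 x)
  have cl4 := cl (E 1 x) (E 3 x) (E 2 x)
  obtain ⟨v1, v2, v3, v4, v5, v6, v7, v8, v9, v10, v11, v12, v13, v14⟩ := h.conn_values hx
  rw [eρ] at v1 v2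
  rw [eτ] at v3 v14
  rw [eσ] at v4
  rw [eν, map_neg] at v5
  rw [eμ, map_neg] at v6
  rw [elam, map_neg] at v7
  rw [eγ] at v8 v11
  rw [eα, eβ] at v9 v10 v12 v13 v14
  have z := h.parallel x hx
  have s := h.conn_self hx
  have a10 := fun i => h.conn_antisymm hx i 1 0
  have a20 := fun i => h.conn_antisymm hx i 2 0
  have a30 := fun i => h.conn_antisymm hx i 3 0
  have a21 := fun i => h.conn_antisymm hx i 2 1
  have a31 := fun i => h.conn_antisymm hx i 3 1
  have a32 := fun i => h.conn_antisymm hx i 3 2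
  have f10 := ha x 1 0
  have f20 := ha x 2 0
  have f30 := ha x 3 0
  have f13 := ha x 1 3
  have f21 := ha x 2 1
  have f23 := ha x 2 3
  have g10 := fun k => hda k 1 0
  have g20 := fun k => hda k 2 0
  have g30 := fun k => hda k 3 0
  have g13 := fun k => hda k 1 3
  have g21 := fun k => hda k 2 1
  have g23 := fun k => hda k 2 3
  simp only [hc, z, s, a10, a20, a30, a21, a31, a32, v1, v3, v4, v5, v6, v7, v8, v9, v10, v11, v12,
    v13, eρ, eσ, eτ, eμ, elam, eν, f10, f20, f30, f13, f21, f23, hz, hdz, g10, g20, g30, g13, g21,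
    g23, ← h0, ← h2] at dv0 dv1 dv2 dv3 cl1 cl2 cl3 cl4
  rw [maxwellPhi1] at h1
  simp only [hd1]
  rw [v14] at *
  refine ⟨?_, ?_, ?_, ?_⟩
  · rw [h1]; linear_combination (1 / 2) * (cl1 - dv0)
  · linear_combination -(1 / 2) * (cl3 + dv3)
  · rw [h1]; linear_combination -(1 / 2) * (dv2 - cl2)
  · rw [h1]; linear_combination -(1 / 2) * (dv1 + cl4)

end GaugedTetrad

/-! ### Commutators and assembly of the Newman-Penrose system -/

namespace GaugedTetrad

variable {T : Set R4} {G : MetricComp} {E : Fin 4 → R4 → Fin 4 → ℂ} (h : GaugedTetrad T G E)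
  {F : R4 → Matrix (Fin 4) (Fin 4) ℝ} {Λ : ℝ}

include h

theorem dir_spinAlpha {x : R4} (hx : x ∈ T) (Y : Fin 4 → ℂ) :
    dir Y (spinAlpha G E) x = (1 / 2) * (dir Y (conn G E 3 0 1) x - dir Y (conn G E 3 2 3) x) :=
  dir_lin h.isOpen hx Y (h.conn_smooth _ _ _) (h.conn_smooth _ _ _) _

theorem dir_spinBeta {x : R4} (hx : x ∈ T) (Y : Fin 4 → ℂ) :
    dir Y (spinBeta G E) x = (1 / 2) * (dir Y (conn G E 2 0 1) x - dir Y (conn G E 2 2 3) x) :=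
  dir_lin h.isOpen hx Y (h.conn_smooth _ _ _) (h.conn_smooth _ _ _) _

theorem dir_spinGamma {x : R4} (hx : x ∈ T) (Y : Fin 4 → ℂ) :
    dir Y (spinGamma G E) x = (1 / 2) * (dir Y (conn G E 1 0 1) x - dir Y (conn G E 1 2 3) x) :=
  dir_lin h.isOpen hx Y (h.conn_smooth _ _ _) (h.conn_smooth _ _ _) _

theorem conj_m (x : R4) : conjV (E 2 x) = E 3 x := h.real x 2

theorem dir_l (f : R4 → ℂ) (x : R4) : dir (E 0 x) f x = pd 1 f x := by rw [h.l_eq, dir_r]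

theorem commutators {x : R4} (hx : x ∈ T) {f : R4 → ℂ} (hf : Sm T f)
    (ρ σ τ α β γ μ lam ν : ℂ)
    (eρ : conn G E 3 0 2 x = ρ) (eσ : conn G E 2 0 2 x = σ) (eτ : conn G E 1 0 2 x = τ)
    (eα : spinAlpha G E x = α) (eβ : spinBeta G E x = β) (eγ : spinGamma G E x = γ)
    (eμ : conn G E 2 1 3 x = -μ) (elam : conn G E 3 1 3 x = -lam) (eν : conn G E 1 1 3 x = -ν) :
    dir (E 0 x) (fun y => dir (E 2 y) f y) x - dir (E 2 x) (fun y => dir (E 0 y) f y) x =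
      -τ * dir (E 0 x) f x + ρ * dir (E 2 x) f x + σ * dir (E 3 x) f x ∧
    dir (E 1 x) (fun y => dir (E 2 y) f y) x - dir (E 2 x) (fun y => dir (E 1 y) f y) x =
      conj ν * dir (E 0 x) f x + (γ - conj γ - μ) * dir (E 2 x) f x
        - conj lam * dir (E 3 x) f x ∧
    dir (E 2 x) (fun y => dir (E 3 y) f y) x - dir (E 3 x) (fun y => dir (E 2 y) f y) x =
      (μ - conj μ) * dir (E 0 x) f x + (conj α - β) * dir (E 3 x) f x
        - (α - conj β) * dir (E 2 x) f x := by
  obtain ⟨v1, v2, v3, v4, v5, v6, v7, v8, v9, v10, v11, v12, v13, v14⟩ := h.conn_values hx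
  rw [eρ] at v1 v2
  rw [eτ] at v3 v14
  rw [eσ] at v4
  rw [eν, map_neg] at v5
  rw [eμ, map_neg] at v6
  rw [elam, map_neg] at v7
  rw [eγ] at v8 v11
  rw [eα, eβ] at v9 v10 v12 v13 v14
  have z := h.parallel x hx
  have s := h.conn_self hx
  have a20 := fun i => h.conn_antisymm hx i 2 0
  have a30 := fun i => h.conn_antisymm hx i 3 0
  have a21 := fun i => h.conn_antisymm hx i 2 1
  have a31 := fun i => h.conn_antisymm hx i 3 1
  have a32 := fun i => h.conn_antisymm hx i 3 2
  have e210 : conn G E 2 1 0 x = -τ := by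
    rw [h.conn_l hx 2 1, h.conn_antisymm hx 1 2 0, eτ]
  rw [h.dir_comm hx 0 2 hf, h.dir_comm hx 1 2 hf, h.dir_comm hx 2 3 hf]
  simp only [z, s, a20, a30, a21, a31, a32, v1, v5, v6, v7, v9, v11, v12,
    v13, e210, eρ, eσ, eτ, eμ]
  rw [v14]
  refine ⟨?_, ?_, ?_⟩ <;> ring

/-- The commutator [ℓ, n] in coordinates. Since ℓ = ∂_r has constant components it equals ∂_r n,
while parallel propagation leaves only -∇_n ℓ on the other side. -/
theorem D_n {x : R4} (hx : x ∈ T) (a : Fin 4) :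
    pd 1 (fun y => E 1 y a) x =
    (if a = 1 then -(spinGamma G E x + conj (spinGamma G E x)) else 0)
      + conj (conn G E 1 0 2 x) * E 2 x a + conn G E 1 0 2 x * E 3 x a := by
  obtain ⟨v1, v2, v3, v4, v5, v6, v7, v8, -⟩ := h.conn_values hx
  have t := h.torsion_free (E 0) (E 1) x a
  have l0 : dir (E 1 x) (fun y => E 0 y a) x = 0 := by
    simp only [h.l_eq, dir]
    exact Finset.sum_eq_zero fun b _ => by rw [pd_const, mul_zero]
  rw [l0, h.covDeriv_frame hx, h.covDeriv_frame hx, h.l_eq, dir_r] at t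
  simp only [Pi.add_apply, Pi.sub_apply, Pi.smul_apply, smul_eq_mul, h.parallel x hx,
    h.conn_self hx, v8, v3] at t
  have e : (![0, 1, 0, 0] : Fin 4 → ℂ) a = if a = 1 then 1 else 0 := by
    fin_cases a <;> simp
  rw [e] at t
  have e2 : (if a = 1 then -(spinGamma G E x + conj (spinGamma G E x)) else 0) =
      -(spinGamma G E x + conj (spinGamma G E x)) * if a = 1 then 1 else 0 := by
    split_ifs <;> simp
  rw [e2]
  linear_combination -t

theorem maxwellPhi1_sm (hF : ElectrovacuumOn T G F Λ) : Sm T (maxwellPhi1 E F) :=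
  (Sm.const _).mul ((h.contr2_smooth hF.F_smooth 0 1).add (h.contr2_smooth hF.F_smooth 3 2))

/-- The Newman-Penrose system of an electrovacuum with a parallelly propagated tetrad. -/
noncomputable def npSystem (hF : ElectrovacuumOn T G F Λ) : NPSystem T :=
  have np := fun (x : R4) (hx : x ∈ T) => h.np_equations hF hx (conn G E 3 0 2 x)
    (conn G E 2 0 2 x) (conn G E 1 0 2 x) (spinAlpha G E x) (spinBeta G E x) (spinGamma G E x)
    (-conn G E 2 1 3 x) (-conn G E 3 1 3 x) (-conn G E 1 1 3 x) (contr2 (F x) (E 0 x) (E 2 x))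
    (maxwellPhi1 E F x) (contr2 (F x) (E 3 x) (E 1 x)) (Λ / 6)
    (-weylC G x (E 0 x) (E 2 x) (E 0 x) (E 2 x)) (-weylC G x (E 0 x) (E 1 x) (E 0 x) (E 2 x))
    (weylPsi2 G E x) (-weylC G x (E 1 x) (E 0 x) (E 1 x) (E 3 x))
    (-weylC G x (E 1 x) (E 3 x) (E 1 x) (E 3 x)) rfl rfl rfl rfl rfl rfl
    (neg_neg _).symm (neg_neg _).symm (neg_neg _).symm rfl rfl rfl rfl rfl rfl rfl rfl rfl
  have mx := fun (x : R4) (hx : x ∈ T) => h.maxwell_equations hF hx (conn G E 3 0 2 x)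
    (conn G E 2 0 2 x) (conn G E 1 0 2 x) (spinAlpha G E x) (spinBeta G E x) (spinGamma G E x)
    (-conn G E 2 1 3 x) (-conn G E 3 1 3 x) (-conn G E 1 1 3 x) (contr2 (F x) (E 0 x) (E 2 x))
    (maxwellPhi1 E F x) (contr2 (F x) (E 3 x) (E 1 x)) rfl rfl rfl rfl rfl rfl
    (neg_neg _).symm (neg_neg _).symm (neg_neg _).symm rfl rfl rfl
  { n := E 1
    m := E 2
    rho := conn G E 3 0 2
    sigma := conn G E 2 0 2
    tau := conn G E 1 0 2
    alpha := spinAlpha G E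
    beta := spinBeta G E
    gamma := spinGamma G E
    mu := fun x => -conn G E 2 1 3 x
    lam := fun x => -conn G E 3 1 3 x
    nu := fun x => -conn G E 1 1 3 x
    Psi0 := fun x => -weylC G x (E 0 x) (E 2 x) (E 0 x) (E 2 x)
    Psi1 := fun x => -weylC G x (E 0 x) (E 1 x) (E 0 x) (E 2 x)
    Psi2 := weylPsi2 G E
    Psi3 := fun x => -weylC G x (E 1 x) (E 0 x) (E 1 x) (E 3 x)
    Psi4 := fun x => -weylC G x (E 1 x) (E 3 x) (E 1 x) (E 3 x)
    phi0 := fun x => contr2 (F x) (E 0 x) (E 2 x)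
    phi1 := maxwellPhi1 E F
    phi2 := fun x => contr2 (F x) (E 3 x) (E 1 x)
    -- The Newman-Penrose scalar R/24, as R = 4Λ by the trace of Einstein's equation.
    L := Λ / 6
    isOpen := h.isOpen
    n_sm := h.e_smooth 1
    m_sm := h.e_smooth 2
    n_zero := fun x => h.u_comp x 1
    m_zero := fun x => h.u_comp x 2
    rho_sm := h.conn_smooth _ _ _
    sigma_sm := h.conn_smooth _ _ _
    tau_sm := h.conn_smooth _ _ _
    alpha_sm := h.spinAlpha_sm
    beta_sm := h.spinBeta_sm
    gamma_sm := h.spinGamma_sm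
    mu_sm := (h.conn_smooth _ _ _).neg
    lam_sm := (h.conn_smooth _ _ _).neg
    nu_sm := (h.conn_smooth _ _ _).neg
    phi0_sm := h.contr2_smooth hF.F_smooth _ _
    phi1_sm := h.maxwellPhi1_sm hF
    phi2_sm := h.contr2_smooth hF.F_smooth _ _
    L_real := by rw [map_div₀, Complex.conj_ofReal, map_ofNat]
    rho_real := fun x hx => (h.conn_values hx).2.1
    tau_eq := fun x hx => (h.conn_values hx).2.2.2.2.2.2.2.2.2.2.2.2.2
    D_n := fun x hx a => by
      have := h.D_n hx a
      rw [← h.conj_m x] at this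
      exact this
    comm_D_delta := fun f hf x hx => by
      have := (h.commutators hx hf _ _ _ _ _ _ _ _ _ rfl rfl rfl rfl rfl rfl (neg_neg _).symm
        (neg_neg _).symm (neg_neg _).symm).1
      simp only [h.dir_l] at this
      rw [← h.conj_m x] at this
      exact this
    comm_Delta_delta := fun f hf x hx => by
      have := (h.commutators hx hf _ _ _ _ _ _ _ _ _ rfl rfl rfl rfl rfl rfl (neg_neg _).symm
        (neg_neg _).symm (neg_neg _).symm).2.1
      simp only [h.dir_l] at this
      rw [← h.conj_m x] at this
      exact this
    comm_delta_deltabar := fun f hf x hx => by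
      have := (h.commutators hx hf _ _ _ _ _ _ _ _ _ rfl rfl rfl rfl rfl rfl (neg_neg _).symm
        (neg_neg _).symm (neg_neg _).symm).2.2
      simp only [h.dir_l] at this
      simp only [h.real _ 2]
      exact this
    D_rho := fun x hx => by
      have e := (np x hx).1
      rw [h.dir_l] at e
      exact e
    D_sigma := fun x hx => by
      have e := (np x hx).2.1
      rw [h.dir_l] at e
      exact e
    D_tau := fun x hx => by
      have e := (np x hx).2.2.1
      rw [h.dir_l] at e
      exact e
    D_alpha := fun x hx => by
      have e := (np x hx).2.2.2.1
      rw [← h.dir_spinAlpha hx, h.dir_l] at e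
      exact e
    D_beta := fun x hx => by
      have e := (np x hx).2.2.2.2.1
      rw [← h.dir_spinBeta hx, h.dir_l] at e
      exact e
    D_gamma := fun x hx => by
      have e := (np x hx).2.2.2.2.2.1
      rw [← h.dir_spinGamma hx, h.dir_l] at e
      exact e
    D_lam := fun x hx => by
      have e := (np x hx).2.2.2.2.2.2.1
      rw [h.dir_l] at e
      rw [← pd_neg] at e
      exact e
    D_mu := fun x hx => by
      have e := (np x hx).2.2.2.2.2.2.2.1
      rw [h.dir_l] at e
      rw [← pd_neg] at e
      exact e
    D_nu := fun x hx => by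
      have e := (np x hx).2.2.2.2.2.2.2.2.1
      rw [h.dir_l] at e
      rw [← pd_neg] at e
      exact e
    Delta_lam := fun x hx => by
      have e := (np x hx).2.2.2.2.2.2.2.2.2.1
      rw [dir_neg, dir_neg, h.conj_m x]
      rw [sub_neg_eq_add]
      exact e
    delta_rho := fun x hx => by
      have e := (np x hx).2.2.2.2.2.2.2.2.2.2.1
      rw [h.conj_m x]
      exact e
    delta_alpha := fun x hx => by
      have e := (np x hx).2.2.2.2.2.2.2.2.2.2.2.1
      rw [h.dir_spinAlpha hx, h.dir_spinBeta hx, h.conj_m x]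
      exact e
    delta_lam := fun x hx => by
      have e := (np x hx).2.2.2.2.2.2.2.2.2.2.2.2.1
      rw [dir_neg, dir_neg, h.conj_m x]
      rw [sub_neg_eq_add]
      exact e
    delta_nu := fun x hx => by
      have e := (np x hx).2.2.2.2.2.2.2.2.2.2.2.2.2.1
      rw [dir_neg, dir_neg]
      rw [sub_neg_eq_add]
      exact e
    delta_gamma := fun x hx => by
      have e := (np x hx).2.2.2.2.2.2.2.2.2.2.2.2.2.2.1
      rw [h.dir_spinGamma hx, h.dir_spinBeta hx]
      exact e
    delta_tau := fun x hx => by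
      have e := (np x hx).2.2.2.2.2.2.2.2.2.2.2.2.2.2.2.1
      exact e
    Delta_rho := fun x hx => by
      have e := (np x hx).2.2.2.2.2.2.2.2.2.2.2.2.2.2.2.2.1
      rw [h.conj_m x]
      exact e
    Delta_alpha := fun x hx => by
      have e := (np x hx).2.2.2.2.2.2.2.2.2.2.2.2.2.2.2.2.2
      rw [h.dir_spinAlpha hx, h.dir_spinGamma hx, h.conj_m x]
      exact e
    D_phi1 := fun x hx => by
      have e := (mx x hx).1
      rw [h.dir_l] at e
      rw [h.conj_m x]
      exact e
    D_phi2 := fun x hx => by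
      have e := (mx x hx).2.1
      rw [h.dir_l] at e
      rw [h.conj_m x]
      exact e
    delta_phi1 := fun x hx => by
      have e := (mx x hx).2.2.1
      exact e
    delta_phi2 := fun x hx => by
      have e := (mx x hx).2.2.2
      exact e }

end GaugedTetrad

/-! ## A pair of horizons in the Newman-Penrose formalism -/

section directional

variable {T : Set R4} {f g : R4 → ℂ} {x : R4} (hT : IsOpen T) (hx : x ∈ T) (W : Fin 4 → ℂ)

include hT hx

theorem dir_add (hf : Sm T f) (hg : Sm T g) :
    dir W (fun y => f y + g y) x = dir W f x + dir W g x := by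
  simp only [dir, pd_add (hf.diff hT hx) (hg.diff hT hx), Fin.sum_univ_four]; ring

theorem dir_sub (hf : Sm T f) (hg : Sm T g) :
    dir W (fun y => f y - g y) x = dir W f x - dir W g x := by
  simp only [dir, pd_sub (hf.diff hT hx) (hg.diff hT hx), Fin.sum_univ_four]; ring

theorem dir_mul (hf : Sm T f) (hg : Sm T g) :
    dir W (fun y => f y * g y) x = dir W f x * g x + f x * dir W g x := by
  simp only [dir, pd_mul (hf.diff hT hx) (hg.diff hT hx), Fin.sum_univ_four]; ring

end directional

theorem dir_const (W : Fin 4 → ℂ) (c : ℂ) (x : R4) : dir W (fun _ => c) x = 0 := by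
  simp [dir, pd_const]

theorem conj_dir (W : Fin 4 → ℂ) (f : R4 → ℂ) (x : R4) :
    conj (dir W f x) = dir (conjV W) (fun y => conj (f y)) x := by
  simp [dir, conjV, pd_conj]

theorem conjV_conjV (W : Fin 4 → ℂ) : conjV (conjV W) = W := by
  funext a; simp [conjV]

theorem dir_coord (W : Fin 4 → ℂ) (a : Fin 4) (x : R4) :
    dir W (fun y => (y a : ℂ)) x = W a := by
  simp [dir, pd_coord]

theorem dir_slice {T : Set R4} {f g : R4 → ℂ} {x : R4} {i : Fin 4} {c : ℝ} (hT : IsOpen T)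
    (hf : Sm T f) (hg : Sm T g) (h : ∀ y ∈ T, y i = c → f y = g y)
    (hx : x ∈ T) (hxi : x i = c) {W : Fin 4 → ℂ} (hW : W i = 0) : dir W f x = dir W g x := by
  refine Finset.sum_congr rfl fun a _ => ?_
  by_cases ha : a = i
  · rw [ha, hW, zero_mul, zero_mul]
  · rw [pd_slice hT hf hg h hx hxi ha]

namespace NPSystem

variable {T : Set R4} (N : NPSystem T)

/-- The operator `δ`. -/
noncomputable def dl (f : R4 → ℂ) (x : R4) : ℂ := dir (N.m x) f x

/-- The operator `δ̄`. -/
noncomputable def db (f : R4 → ℂ) (x : R4) : ℂ := dir (conjV (N.m x)) f x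

variable {N} {f g : R4 → ℂ} {x : R4}

theorem dl_sm (hf : Sm T f) : Sm T (N.dl f) :=
  Sm.sum (s := Finset.univ) fun a _ => (N.m_sm a).mul (hf.pd N.isOpen a)

theorem db_sm (hf : Sm T f) : Sm T (N.db f) :=
  Sm.sum (s := Finset.univ) fun a _ => (N.m_sm a).cj.mul (hf.pd N.isOpen a)

theorem conj_dl (f : R4 → ℂ) (x : R4) : conj (N.dl f x) = N.db (fun y => conj (f y)) x :=
  conj_dir _ _ _

theorem conj_db (f : R4 → ℂ) (x : R4) : conj (N.db f x) = N.dl (fun y => conj (f y)) x := by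
  rw [db, conj_dir, conjV_conjV]; rfl

/-- The equation for Dγ expresses Ψ₂ through quantities already known to be smooth, which avoids
differentiating the Weyl tensor. -/
theorem Psi2_sm : Sm T N.Psi2 := by
  refine ((N.gamma_sm.pd N.isOpen 1).sub (((N.tau_sm.mul N.alpha_sm).add
    (N.tau_sm.cj.mul N.beta_sm)).sub (Sm.const N.L) |>.add
    (((Sm.const 2).mul N.phi1_sm).mul N.phi1_sm.cj))).congr fun x hx => ?_
  have := N.D_gamma x hx
  linear_combination -this

/-- The complex conjugate of the commutator of D and δ applied to f̄; the reality of ρ is used. -/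
theorem comm_D_db (hf : Sm T f) (hx : x ∈ T) :
    pd 1 (N.db f) x - N.db (pd 1 f) x =
      -conj (N.tau x) * pd 1 f x + N.rho x * N.db f x + conj (N.sigma x) * N.dl f x := by
  have h := congrArg conj (N.comm_D_delta _ hf.cj x hx)
  have e1 : N.db f = fun y => conj (dir (N.m y) (fun y => conj (f y)) y) := by
    funext y
    have := N.conj_dl (fun y => conj (f y)) y
    simp only [Complex.conj_conj] at this
    exact this.symm
  have e2 : N.dl f x = conj (dir (conjV (N.m x)) (fun y => conj (f y)) x) := by
    have := N.conj_db (fun y => conj (f y)) x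
    simp only [Complex.conj_conj] at this
    exact this.symm
  have e3 : N.db (pd 1 f) x = conj (dir (N.m x) (pd 1 fun y => conj (f y)) x) := by
    rw [conj_dir]
    have : (fun y => conj (pd 1 (fun y => conj (f y)) y)) = pd 1 f := by
      funext y; rw [pd_conj, Complex.conj_conj]
    rw [this]; rfl
  have e4 : N.db f x = conj (dir (N.m x) (fun y => conj (f y)) x) := congrFun e1 x
  rw [e2, e3, e4, e1, pd_conj]
  simp only [map_sub, map_add, map_mul, map_neg, pd_conj, Complex.conj_conj, N.rho_real x hx] at h
  simpa only [pd_conj, Complex.conj_conj] using h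

/-- The field m has no ∂_u component, so δ is tangent to u = 0. -/
theorem dl_slice₁ (hf : Sm T f) (hg : Sm T g) (h : ∀ y ∈ T, y 0 = 0 → f y = g y)
    (hx : x ∈ T) (h0 : x 0 = 0) : N.dl f x = N.dl g x :=
  dir_slice N.isOpen hf hg h hx h0 (N.m_zero x)

theorem db_slice₁ (hf : Sm T f) (hg : Sm T g) (h : ∀ y ∈ T, y 0 = 0 → f y = g y)
    (hx : x ∈ T) (h0 : x 0 = 0) : N.db f x = N.db g x :=
  dir_slice N.isOpen hf hg h hx h0 (by simp [conjV, N.m_zero])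

/-- The remaining components of n are tangent to u = 0, where f is constant, and the u-component of
n is 1. -/
theorem Delta_slice₁ {c : ℂ} (hf : Sm T f) (h : ∀ y ∈ T, y 0 = 0 → f y = c)
    (hx : x ∈ T) (h0 : x 0 = 0) : dir (N.n x) f x = pd 0 f x := by
  simp only [dir, Fin.sum_univ_four, N.n_zero,
    pd_slice_const N.isOpen hf h hx h0 (show (1 : Fin 4) ≠ 0 by decide),
    pd_slice_const N.isOpen hf h hx h0 (show (2 : Fin 4) ≠ 0 by decide),
    pd_slice_const N.isOpen hf h hx h0 (show (3 : Fin 4) ≠ 0 by decide)]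
  ring

/-- Both hypersurfaces `u = 0` and `r = 0` are ruled by complete coordinate lines, and they are
expansion and shear free. -/
structure Horizons (N : NPSystem T) : Prop where
  complete₁ : ∀ x ∈ T, x 0 = 0 → ∀ r, pt 0 r (x 2) (x 3) ∈ T
  complete₂ : ∀ x ∈ T, x 1 = 0 → ∀ u, pt u 0 (x 2) (x 3) ∈ T
  rho₁ : ∀ x ∈ T, x 0 = 0 → N.rho x = 0
  sigma₁ : ∀ x ∈ T, x 0 = 0 → N.sigma x = 0
  mu₂ : ∀ x ∈ T, x 1 = 0 → N.mu x = 0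
  lam₂ : ∀ x ∈ T, x 1 = 0 → N.lam x = 0
  nu₂ : ∀ x ∈ T, x 1 = 0 → N.nu x = 0
  gamma₂ : ∀ x ∈ T, x 1 = 0 → N.gamma x = 0
  n₂ : ∀ x ∈ T, x 1 = 0 → N.n x = ![1, 0, 0, 0]
  m₂ : ∀ x ∈ T, x 1 = 0 → N.m x 1 = 0

namespace Horizons

variable (H : N.Horizons)

include H

/-- Completeness of the generators is used here: the line from the point back to r = 0 stays in the
domain, so equal derivatives and equal initial values propagate. -/
theorem eq_on₁ (hf : Sm T f) (hg : Sm T g) (hd : ∀ y ∈ T, y 0 = 0 → pd 1 f y = pd 1 g y)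
    (hz : ∀ y ∈ T, y 0 = 0 → y 1 = 0 → f y = g y) (hx : x ∈ T) (h0 : x 0 = 0) : f x = g x := by
  have hl := H.complete₁ x hx h0
  have hD : ∀ r, HasDerivAt (fun s : ℝ => f (pt 0 s (x 2) (x 3)) - g (pt 0 s (x 2) (x 3))) 0 r := by
    intro r
    have := (hasDerivAt_pt_one hf N.isOpen (hl r)).sub (hasDerivAt_pt_one hg N.isOpen (hl r))
    rwa [hd _ (hl r) (by simp [pt]), sub_self] at this
  have hc := is_const_of_deriv_eq_zero (fun r => (hD r).differentiableAt)
    (fun r => (hD r).deriv) (x 1) 0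
  have hpt : pt 0 (x 1) (x 2) (x 3) = x := by rw [← h0, pt_eta]
  simp only [hpt] at hc
  rw [hz _ (hl 0) (by simp [pt]) (by simp [pt]), sub_self, sub_eq_zero] at hc
  exact hc

theorem eq_on₂ (hf : Sm T f) (hg : Sm T g) (hd : ∀ y ∈ T, y 1 = 0 → pd 0 f y = pd 0 g y)
    (hz : ∀ y ∈ T, y 0 = 0 → y 1 = 0 → f y = g y) (hx : x ∈ T) (h1 : x 1 = 0) : f x = g x := by
  have hl := H.complete₂ x hx h1
  have hD : ∀ r, HasDerivAt (fun s : ℝ => f (pt s 0 (x 2) (x 3)) - g (pt s 0 (x 2) (x 3))) 0 r := by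
    intro r
    have := (hasDerivAt_pt_zero hf N.isOpen (hl r)).sub (hasDerivAt_pt_zero hg N.isOpen (hl r))
    rwa [hd _ (hl r) (by simp [pt]), sub_self] at this
  have hc := is_const_of_deriv_eq_zero (fun r => (hD r).differentiableAt)
    (fun r => (hD r).deriv) (x 0) 0
  have hpt : pt (x 0) 0 (x 2) (x 3) = x := by rw [← h1, pt_eta]
  simp only [hpt] at hc
  rw [hz _ (hl 0) (by simp [pt]) (by simp [pt]), sub_self, sub_eq_zero] at hc
  exact hc

theorem dl_slice₂ (hf : Sm T f) (hg : Sm T g) (h : ∀ y ∈ T, y 1 = 0 → f y = g y)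
    (hx : x ∈ T) (h1 : x 1 = 0) : N.dl f x = N.dl g x :=
  dir_slice N.isOpen hf hg h hx h1 (H.m₂ x hx h1)

theorem db_slice₂ (hf : Sm T f) (hg : Sm T g) (h : ∀ y ∈ T, y 1 = 0 → f y = g y)
    (hx : x ∈ T) (h1 : x 1 = 0) : N.db f x = N.db g x :=
  dir_slice N.isOpen hf hg h hx h1 (by simp [conjV, H.m₂ x hx h1])

theorem Delta₂ (f : R4 → ℂ) (hx : x ∈ T) (h1 : x 1 = 0) : dir (N.n x) f x = pd 0 f x := by
  rw [H.n₂ x hx h1]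
  simp [dir, Fin.sum_univ_four]

end Horizons

end NPSystem

/-! ### Constant, linear and quadratic functions along the generators -/

theorem pd_coord_mul {T : Set R4} (hT : IsOpen T) {K : R4 → ℂ} (hK : Sm T K) {x : R4} (hx : x ∈ T)
    (i : Fin 4) : pd i (fun y => (y i : ℂ) * K y) x = K x + x i * pd i K x := by
  rw [pd_mul ((Sm.coord i).diff hT hx) (hK.diff hT hx), pd_coord, if_pos rfl, one_mul]

theorem pd_coord_sq_mul {T : Set R4} (hT : IsOpen T) {K : R4 → ℂ} (hK : Sm T K) {x : R4}
    (hx : x ∈ T) (i : Fin 4) : pd i (fun y => 1 / 2 * ((y i : ℂ) * ((y i : ℂ) * K y))) x =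
      x i * K x + 1 / 2 * x i * x i * pd i K x := by
  rw [pd_mul ((Sm.const _).diff hT hx)
    (((Sm.coord i).mul ((Sm.coord i).mul hK)).diff hT hx), pd_const,
    pd_coord_mul hT ((Sm.coord i).mul hK) hx, pd_coord_mul hT hK hx]
  ring

theorem dir_coord_mul {T : Set R4} (hT : IsOpen T) {K : R4 → ℂ} (hK : Sm T K) {x : R4} (hx : x ∈ T)
    (W : Fin 4 → ℂ) (i : Fin 4) :
    dir W (fun y => (y i : ℂ) * K y) x = W i * K x + x i * dir W K x := by
  rw [dir_mul hT hx W (Sm.coord i) hK, dir_coord]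

theorem dir_coord_sq_mul {T : Set R4} (hT : IsOpen T) {K : R4 → ℂ} (hK : Sm T K) {x : R4}
    (hx : x ∈ T) (W : Fin 4 → ℂ) (i : Fin 4) :
    dir W (fun y => 1 / 2 * ((y i : ℂ) * ((y i : ℂ) * K y))) x =
      x i * W i * K x + 1 / 2 * x i * x i * dir W K x := by
  rw [dir_mul hT hx W (Sm.const _) ((Sm.coord i).mul ((Sm.coord i).mul hK)), dir_const,
    dir_coord_mul hT ((Sm.coord i).mul hK) hx, dir_coord_mul hT hK hx]
  ring

/-- A smooth function whose derivative with respect to the coordinate `i` vanishes on the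
hypersurface on which the coordinate `j` vanishes. -/
def ConstOn (T : Set R4) (i j : Fin 4) (f : R4 → ℂ) : Prop :=
  Sm T f ∧ ∀ x ∈ T, x j = 0 → pd i f x = 0

namespace ConstOn

variable {T : Set R4} (hT : IsOpen T) {i j : Fin 4} {f g : R4 → ℂ}

theorem const (c : ℂ) : ConstOn T i j (fun _ => c) := ⟨Sm.const c, fun _ _ _ => pd_const c⟩

theorem cj (hf : ConstOn T i j f) : ConstOn T i j (fun x => (starRingEnd ℂ) (f x)) :=
  ⟨hf.1.cj, fun x hx h => by rw [pd_conj, hf.2 x hx h, map_zero]⟩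

include hT

theorem add (hf : ConstOn T i j f) (hg : ConstOn T i j g) : ConstOn T i j (fun x => f x + g x) :=
  ⟨hf.1.add hg.1, fun x hx h => by
    rw [pd_add (hf.1.diff hT hx) (hg.1.diff hT hx), hf.2 x hx h, hg.2 x hx h, add_zero]⟩

theorem sub (hf : ConstOn T i j f) (hg : ConstOn T i j g) : ConstOn T i j (fun x => f x - g x) :=
  ⟨hf.1.sub hg.1, fun x hx h => by
    rw [pd_sub (hf.1.diff hT hx) (hg.1.diff hT hx), hf.2 x hx h, hg.2 x hx h, sub_zero]⟩

theorem mul (hf : ConstOn T i j f) (hg : ConstOn T i j g) : ConstOn T i j (fun x => f x * g x) :=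
  ⟨hf.1.mul hg.1, fun x hx h => by
    rw [pd_mul (hf.1.diff hT hx) (hg.1.diff hT hx), hf.2 x hx h, hg.2 x hx h, mul_zero, zero_mul,
      add_zero]⟩

theorem congr (hij : i ≠ j) (hf : ConstOn T i j f) (hg : Sm T g)
    (h : ∀ x ∈ T, x j = 0 → g x = f x) : ConstOn T i j g :=
  ⟨hg, fun x hx hj => by rw [pd_slice hT hg hf.1 h hx hj hij, hf.2 x hx hj]⟩

end ConstOn

namespace NPSystem.Horizons

variable {T : Set R4} {N : NPSystem T} {f g K : R4 → ℂ} {x : R4}  (H : N.Horizons)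

include H

/-! ### The hypersurface `u = 0` -/

theorem const₁ (hf : ConstOn T 1 0 f) (hx : x ∈ T) (h0 : x 0 = 0) :
    f x = f (pt 0 0 (x 2) (x 3)) := by
  have hl := H.complete₁ x hx h0
  have hD : ∀ r, HasDerivAt (fun s : ℝ => f (pt 0 s (x 2) (x 3))) 0 r := by
    intro r
    have := hasDerivAt_pt_one hf.1 N.isOpen (hl r)
    rwa [hf.2 _ (hl r) (by simp [pt])] at this
  have hc := is_const_of_deriv_eq_zero (fun r => (hD r).differentiableAt)
    (fun r => (hD r).deriv) (x 1) 0
  rwa [← h0, pt_eta, h0] at hc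

theorem linear₁ (hf : Sm T f) (hK : ConstOn T 1 0 K) (hd : ∀ y ∈ T, y 0 = 0 → pd 1 f y = K y)
    (hz : ∀ y ∈ T, y 0 = 0 → y 1 = 0 → f y = 0) (hx : x ∈ T) (h0 : x 0 = 0) :
    f x = x 1 * K x := by
  refine H.eq_on₁ hf ((Sm.coord 1).mul hK.1) (fun y hy y0 => ?_) (fun y hy y0 y1 => ?_) hx h0
  · rw [pd_coord_mul N.isOpen hK.1 hy, hK.2 y hy y0, hd y hy y0, mul_zero, add_zero]
  · rw [hz y hy y0 y1, y1]; simp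

theorem quadratic₁ (hf : Sm T f) (hK : ConstOn T 1 0 K)
    (hd : ∀ y ∈ T, y 0 = 0 → pd 1 f y = y 1 * K y)
    (hz : ∀ y ∈ T, y 0 = 0 → y 1 = 0 → f y = 0) (hx : x ∈ T) (h0 : x 0 = 0) :
    f x = 1 / 2 * (x 1 * (x 1 * K x)) := by
  refine H.eq_on₁ hf ((Sm.const (1 / 2)).mul ((Sm.coord 1).mul ((Sm.coord 1).mul hK.1)))
    (fun y hy y0 => ?_) (fun y hy y0 y1 => ?_) hx h0
  · rw [pd_coord_sq_mul N.isOpen hK.1 hy, hK.2 y hy y0, hd y hy y0, mul_zero, add_zero]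
  · rw [hz y hy y0 y1, y1]; simp

/-- On u = 0 the right-hand side of [D, δ]f = -τDf + ρδf + σδ̄f vanishes, and so does δDf, because δ
is tangent to the hypersurface. Iterating this makes all coefficients below independent of r. -/
theorem dl_const₁ (hf : ConstOn T 1 0 f) : ConstOn T 1 0 (N.dl f) := by
  refine ⟨dl_sm hf.1, fun x hx h0 => ?_⟩
  have e := N.comm_D_delta f hf.1 x hx
  have e2 : dir (N.m x) (pd 1 f) x = 0 :=
    (dl_slice₁ (hf.1.pd N.isOpen 1) (Sm.const 0) hf.2 hx h0).trans (dir_const _ _ _)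
  change pd 1 (N.dl f) x - _ = _ at e
  rw [e2, hf.2 x hx h0, H.rho₁ x hx h0, H.sigma₁ x hx h0] at e
  simpa using e

theorem db_const₁ (hf : ConstOn T 1 0 f) : ConstOn T 1 0 (N.db f) := by
  refine ⟨db_sm hf.1, fun x hx h0 => ?_⟩
  have e := comm_D_db (N := N) hf.1 hx
  have e2 : N.db (pd 1 f) x = 0 :=
    (db_slice₁ (hf.1.pd N.isOpen 1) (Sm.const 0) hf.2 hx h0).trans (dir_const _ _ _)
  rw [e2, hf.2 x hx h0, H.rho₁ x hx h0, H.sigma₁ x hx h0] at e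
  simpa using e

/-- Raychaudhuri's equation: without expansion and shear the only source left is 2|φ₀|², which must
vanish. -/
theorem phi0₁ (hx : x ∈ T) (h0 : x 0 = 0) : N.phi0 x = 0 := by
  have e := N.D_rho x hx
  rw [pd_slice_const N.isOpen N.rho_sm H.rho₁ hx h0 (by decide), H.rho₁ x hx h0,
    H.sigma₁ x hx h0] at e
  simpa using e

theorem Psi0₁ (hx : x ∈ T) (h0 : x 0 = 0) : N.Psi0 x = 0 := by
  have e := N.D_sigma x hx
  rw [pd_slice_const N.isOpen N.sigma_sm H.sigma₁ hx h0 (by decide), H.rho₁ x hx h0] at e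
  simpa using e.symm

/-- The Codazzi-type equation for δρ - δ̄σ: all other terms contain ρ, σ or φ₀. -/
theorem Psi1₁ (hx : x ∈ T) (h0 : x 0 = 0) : N.Psi1 x = 0 := by
  have e := N.delta_rho x hx
  have e1 : dir (N.m x) N.rho x = 0 :=
    (dl_slice₁ N.rho_sm (Sm.const 0) H.rho₁ hx h0).trans (dir_const _ _ _)
  have e2 : dir (conjV (N.m x)) N.sigma x = 0 :=
    (db_slice₁ N.sigma_sm (Sm.const 0) H.sigma₁ hx h0).trans (dir_const _ _ _)
  rw [e1, e2, H.rho₁ x hx h0, H.sigma₁ x hx h0, H.phi0₁ hx h0] at e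
  simpa using e

theorem tau₁ : ConstOn T 1 0 N.tau := ⟨N.tau_sm, fun x hx h0 => by
  rw [N.D_tau x hx, H.rho₁ x hx h0, H.sigma₁ x hx h0, H.phi0₁ hx h0, H.Psi1₁ hx h0]; simp⟩

theorem alpha₁ : ConstOn T 1 0 N.alpha := ⟨N.alpha_sm, fun x hx h0 => by
  rw [N.D_alpha x hx, H.rho₁ x hx h0, H.sigma₁ x hx h0, H.phi0₁ hx h0]; simp⟩

theorem beta₁ : ConstOn T 1 0 N.beta := ⟨N.beta_sm, fun x hx h0 => by
  rw [N.D_beta x hx, H.rho₁ x hx h0, H.sigma₁ x hx h0, H.Psi1₁ hx h0]; simp⟩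

theorem phi1₁ : ConstOn T 1 0 N.phi1 := ⟨N.phi1_sm, fun x hx h0 => by
  have e := N.D_phi1 x hx
  have e1 : dir (conjV (N.m x)) N.phi0 x = 0 :=
    (db_slice₁ N.phi0_sm (Sm.const 0) (fun y hy y0 => H.phi0₁ hy y0) hx h0).trans (dir_const _ _ _)
  rw [e1, H.rho₁ x hx h0, H.phi0₁ hx h0] at e
  simpa using e⟩

/-- The equation for δα - δ̄β involves no r-derivative and can be solved for Ψ₂ in terms of
r-independent quantities. -/
theorem Psi2₁ : ConstOn T 1 0 N.Psi2 := by
  have o := N.isOpen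
  have a := H.alpha₁
  have b := H.beta₁
  refine ConstOn.congr o (by decide) (((((((a.mul o a.cj).add o (b.mul o b.cj)).sub o
    (((ConstOn.const 2).mul o a).mul o b)).add o (ConstOn.const N.L)).add o
    (((ConstOn.const 2).mul o H.phi1₁).mul o H.phi1₁.cj)).sub o (H.dl_const₁ a)).add o
    (H.db_const₁ b)) Psi2_sm fun x hx h0 => ?_
  have e := N.delta_alpha x hx
  rw [H.rho₁ x hx h0, H.sigma₁ x hx h0] at e
  change N.dl N.alpha x - N.db N.beta x = _ at e
  linear_combination e

/-- Applying [D, δ] to the coordinate r gives Dω = -τ on u = 0, and ω = 0 at r = 0. Thus δ acquires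
a ∂_r part away from the intersection, the origin of the τ̄ corrections to derivatives of functions
of r. -/
theorem m_one₁ (hx : x ∈ T) (h0 : x 0 = 0) : N.m x 1 = -(x 1 * N.tau x) := by
  have o := N.isOpen
  have e := H.linear₁ (f := fun y => N.m y 1) (K := fun y => -1 * N.tau y) (N.m_sm 1)
    ((ConstOn.const (-1)).mul o H.tau₁) (fun y hy y0 => ?_) (fun y hy _ y1 => H.m₂ y hy y1) hx h0
  · rw [e]; ring
  · have e := N.comm_D_delta _ (Sm.coord 1) y hy
    have e1 : pd 1 (fun y : R4 => ((y 1 : ℝ) : ℂ)) = fun _ => 1 := by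
      funext x; rw [pd_coord, if_pos rfl]
    simp only [dir_coord, e1, dir_const, H.rho₁ y hy y0, H.sigma₁ y hy y0] at e
    linear_combination e

/-- The function `Ψ₂ + 2L`, the derivative of `μ`. -/
theorem mu_deriv₁ : ConstOn T 1 0 (fun x => N.Psi2 x + 2 * N.L) :=
  H.Psi2₁.add N.isOpen (ConstOn.const _)

theorem mu₁ (hx : x ∈ T) (h0 : x 0 = 0) : N.mu x = x 1 * (N.Psi2 x + 2 * N.L) := by
  refine H.linear₁ N.mu_sm H.mu_deriv₁ (fun y hy y0 => ?_) (fun y hy _ y1 => H.mu₂ y hy y1) hx h0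
  rw [N.D_mu y hy, H.rho₁ y hy y0, H.sigma₁ y hy y0]; ring

theorem lam₁ (hx : x ∈ T) (h0 : x 0 = 0) : N.lam x = 0 := by
  refine (H.linear₁ N.lam_sm (K := fun _ => 0) (ConstOn.const 0) (fun y hy y0 => ?_)
    (fun y hy _ y1 => H.lam₂ y hy y1) hx h0).trans (mul_zero _)
  rw [N.D_lam y hy, H.rho₁ y hy y0, H.sigma₁ y hy y0, H.phi0₁ hy y0]; simp

/-- Raychaudhuri's equation for n on r = 0, which supplies the initial value of φ₂ for the radial
integration on u = 0. -/
theorem phi2₂ (hx : x ∈ T) (h1 : x 1 = 0) : N.phi2 x = 0 := by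
  have e := N.delta_nu x hx
  have e1 : dir (N.m x) N.nu x = 0 :=
    (H.dl_slice₂ N.nu_sm (Sm.const 0) H.nu₂ hx h1).trans (dir_const _ _ _)
  rw [e1, H.Delta₂ _ hx h1, pd_slice_const N.isOpen N.mu_sm H.mu₂ hx h1 (by decide),
    H.mu₂ x hx h1, H.lam₂ x hx h1, H.nu₂ x hx h1] at e
  simpa using e

theorem phi2₁ (hx : x ∈ T) (h0 : x 0 = 0) : N.phi2 x = x 1 * N.db N.phi1 x := by
  refine H.linear₁ N.phi2_sm (H.db_const₁ H.phi1₁) (fun y hy y0 => ?_)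
    (fun y hy _ y1 => H.phi2₂ hy y1) hx h0
  have e := N.D_phi2 y hy
  rw [H.rho₁ y hy y0, H.phi0₁ hy y0] at e
  change _ - N.db N.phi1 y = _ at e
  linear_combination e

/-- The extra term is δ̄r = ω̄ = -r τ̄. -/
theorem db_linear₁ (hf : Sm T f) (hK : Sm T K) (h : ∀ y ∈ T, y 0 = 0 → f y = y 1 * K y)
    (hx : x ∈ T) (h0 : x 0 = 0) :
    N.db f x = x 1 * (N.db K x - conj (N.tau x) * K x) := by
  rw [db_slice₁ hf ((Sm.coord 1).mul hK) h hx h0, db, dir_coord_mul N.isOpen hK hx, conjV,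
    H.m_one₁ hx h0, map_neg, map_mul, Complex.conj_ofReal, db]
  ring

theorem db_quadratic₁ (hf : Sm T f) (hK : Sm T K)
    (h : ∀ y ∈ T, y 0 = 0 → f y = 1 / 2 * (y 1 * (y 1 * K y))) (hx : x ∈ T) (h0 : x 0 = 0) :
    N.db f x = 1 / 2 * x 1 ^ 2 * (N.db K x - 2 * conj (N.tau x) * K x) := by
  rw [db_slice₁ hf ((Sm.const _).mul ((Sm.coord 1).mul ((Sm.coord 1).mul hK))) h hx h0, db,
    dir_coord_sq_mul N.isOpen hK hx, conjV,
    H.m_one₁ hx h0, map_neg, map_mul, Complex.conj_ofReal, db]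
  ring

omit H in
theorem conj_tau (hx : x ∈ T) : conj (N.tau x) = N.alpha x + conj (N.beta x) := by
  rw [N.tau_eq x hx]; simp

/-- Read from δλ - δ̄μ with λ = 0. The terms in μ(α + β̄) = μτ̄ cancel against the τ̄ correction of
δ̄μ, so that the cosmological constant drops out. -/
theorem Psi3₁ (hx : x ∈ T) (h0 : x 0 = 0) :
    N.Psi3 x = x 1 * (N.db N.Psi2 x + 2 * N.db N.phi1 x * conj (N.phi1 x)) := by
  have e := N.delta_lam x hx
  have e1 : dir (N.m x) N.lam x = 0 :=
    (dl_slice₁ N.lam_sm (Sm.const 0) (fun y hy y0 => H.lam₁ hy y0) hx h0).trans (dir_const _ _ _)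
  have e2 := H.db_linear₁ N.mu_sm H.mu_deriv₁.1 (fun y hy y0 => H.mu₁ hy y0) hx h0
  have e3 : N.db (fun x => N.Psi2 x + 2 * N.L) x = N.db N.Psi2 x := by
    rw [db, dir_add N.isOpen hx _ Psi2_sm (Sm.const _), dir_const, add_zero, db]
  change _ - N.db N.mu x = _ at e
  rw [e1, e2, e3, H.mu₁ hx h0, H.lam₁ hx h0, H.phi2₁ hx h0, conj_tau hx] at e
  linear_combination e

theorem nu_deriv₁ : ConstOn T 1 0 (fun x => conj (N.tau x) * (N.Psi2 x + 2 * N.L) + N.db N.Psi2 x +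
    4 * N.db N.phi1 x * conj (N.phi1 x)) :=
  have o := N.isOpen
  have a := (H.tau₁.cj.mul o H.mu_deriv₁).add o (H.db_const₁ H.Psi2₁)
  have b := ((ConstOn.const 4).mul o (H.db_const₁ H.phi1₁)).mul o H.phi1₁.cj
  a.add o b

theorem nu₁ (hx : x ∈ T) (h0 : x 0 = 0) :
    N.nu x = 1 / 2 * (x 1 * (x 1 * (conj (N.tau x) * (N.Psi2 x + 2 * N.L) + N.db N.Psi2 x +
      4 * N.db N.phi1 x * conj (N.phi1 x)))) := by
  have key := fun hd => H.quadratic₁ N.nu_sm H.nu_deriv₁ hd (fun y hy _ y1 => H.nu₂ y hy y1) hx h0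
  refine key fun y hy y0 => ?_
  rw [N.D_nu y hy, H.mu₁ hy y0, H.lam₁ hy y0, H.Psi3₁ hy y0, H.phi2₁ hy y0]
  ring

theorem Delta_sigma₁ (hx : x ∈ T) (h0 : x 0 = 0) :
    pd 0 N.sigma x = N.dl N.tau x - 2 * N.beta x * N.tau x := by
  have e := N.delta_tau x hx
  rw [Delta_slice₁ N.sigma_sm H.sigma₁ hx h0, H.rho₁ x hx h0, H.sigma₁ x hx h0,
    H.phi0₁ hx h0] at e
  have e2 := N.tau_eq x hx
  rw [dl]
  linear_combination -e - N.tau x * e2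

theorem Delta_phi0₁ (hx : x ∈ T) (h0 : x 0 = 0) :
    pd 0 N.phi0 x = N.dl N.phi1 x - 2 * N.tau x * N.phi1 x := by
  have e := N.delta_phi1 x hx
  rw [Delta_slice₁ N.phi0_sm (fun y hy y0 => H.phi0₁ hy y0) hx h0, H.sigma₁ x hx h0,
    H.phi0₁ hx h0] at e
  rw [dl]
  linear_combination -e

theorem Delta_lam_deriv₁ : ConstOn T 1 0 (fun x =>
    (conj (N.dl N.tau x) - 2 * conj (N.beta x) * conj (N.tau x)) * (N.Psi2 x + 2 * N.L) +
      2 * N.db N.phi1 x * (conj (N.dl N.phi1 x) - 2 * conj (N.tau x) * conj (N.phi1 x))) :=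
  have o := N.isOpen
  have c := ConstOn.const (T := T) (i := 1) (j := 0) 2
  have a := ((H.dl_const₁ H.tau₁).cj.sub o ((c.mul o H.beta₁.cj).mul o H.tau₁.cj)).mul o H.mu_deriv₁
  have b := (H.dl_const₁ H.phi1₁).cj.sub o ((c.mul o H.tau₁.cj).mul o H.phi1₁.cj)
  have d := (c.mul o (H.db_const₁ H.phi1₁)).mul o b
  a.add o d

/-- The equation for Dλ is differentiated in u and ∂_u, ∂_r are interchanged. Since ρ, σ, φ₀ and λ
vanish on u = 0, only μ ∂_u σ̄ and 2φ₂ ∂_u φ̄₀ survive, and both are linear in r. The initial value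
is zero because λ = 0 along r = 0. -/
theorem Delta_lam₁ (hx : x ∈ T) (h0 : x 0 = 0) :
    pd 0 N.lam x = 1 / 2 * (x 1 * (x 1 *
    ((conj (N.dl N.tau x) - 2 * conj (N.beta x) * conj (N.tau x)) * (N.Psi2 x + 2 * N.L) +
      2 * N.db N.phi1 x * (conj (N.dl N.phi1 x) - 2 * conj (N.tau x) * conj (N.phi1 x))))) := by
  have o := N.isOpen
  have key := fun hd => H.quadratic₁ (N.lam_sm.pd o 0) H.Delta_lam_deriv₁ hd
    (fun y hy _ y1 => pd_slice_const o N.lam_sm H.lam₂ hy y1 (by decide)) hx h0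
  refine key fun y hy y0 => ?_
  have s2 : Sm T (fun _ => (2 : ℂ)) := Sm.const 2
  rw [pd_comm o N.lam_sm hy, pd_congr o hy N.D_lam,
    pd_add (((N.rho_sm.mul N.lam_sm).add (N.sigma_sm.cj.mul N.mu_sm)).diff o hy)
      (((s2.mul N.phi2_sm).mul N.phi0_sm.cj).diff o hy),
    pd_add ((N.rho_sm.mul N.lam_sm).diff o hy) ((N.sigma_sm.cj.mul N.mu_sm).diff o hy),
    pd_mul (N.rho_sm.diff o hy) (N.lam_sm.diff o hy),
    pd_mul (N.sigma_sm.cj.diff o hy) (N.mu_sm.diff o hy),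
    pd_mul ((s2.mul N.phi2_sm).diff o hy) (N.phi0_sm.cj.diff o hy), pd_conj, pd_conj,
    H.Delta_sigma₁ hy y0, H.Delta_phi0₁ hy y0, H.rho₁ y hy y0, H.sigma₁ y hy y0, H.phi0₁ hy y0,
    H.lam₁ hy y0, H.mu₁ hy y0, H.phi2₁ hy y0]
  simp only [map_sub, map_mul, map_ofNat, map_zero]
  ring

/-- The equation for Δλ - δ̄ν is solved for Ψ₄. The contributions with Ψ₂ + 2L and with δτ cancel
once τ̄ = α + β̄ is inserted, leaving only derivatives of Ψ₂ and φ₁. -/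
theorem Psi4₁ (hx : x ∈ T) (h0 : x 0 = 0) :
    N.Psi4 x = 1 / 2 * x 1 ^ 2 * (N.db (N.db N.Psi2) x + 2 * N.alpha x * N.db N.Psi2 x +
      4 * (N.db (N.db N.phi1) x + 2 * N.alpha x * N.db N.phi1 x) * conj (N.phi1 x) +
      2 * N.db N.phi1 x * N.db (fun y => conj (N.phi1 y)) x -
      conj (N.tau x) * (N.db N.Psi2 x + 4 * N.db N.phi1 x * conj (N.phi1 x))) := by
  have o := N.isOpen
  have e := N.Delta_lam x hx
  change _ - N.db N.nu x = _ at e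
  rw [Delta_slice₁ N.lam_sm (fun y hy y0 => H.lam₁ hy y0) hx h0, H.Delta_lam₁ hx h0,
    H.db_quadratic₁ N.nu_sm H.nu_deriv₁.1 (fun y hy y0 => H.nu₁ hy y0) hx h0,
    H.nu₁ hx h0, H.lam₁ hx h0] at e
  have d1 : N.db (fun x => conj (N.tau x) * (N.Psi2 x + 2 * N.L) + N.db N.Psi2 x +
      4 * N.db N.phi1 x * conj (N.phi1 x)) x =
      conj (N.dl N.tau x) * (N.Psi2 x + 2 * N.L) + conj (N.tau x) * N.db N.Psi2 x +
      N.db (N.db N.Psi2) x + 4 * N.db (N.db N.phi1) x * conj (N.phi1 x) +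
      4 * N.db N.phi1 x * N.db (fun y => conj (N.phi1 y)) x := by
    have s4 : Sm T (fun _ => (4 : ℂ)) := Sm.const 4
    have p2 := db_sm (N := N) (Psi2_sm (N := N))
    have p1 := db_sm (N := N) N.phi1_sm
    rw [conj_dl]
    unfold db at *
    rw [dir_add o hx _ ((N.tau_sm.cj.mul H.mu_deriv₁.1).add p2) ((s4.mul p1).mul N.phi1_sm.cj),
      dir_add o hx _ (N.tau_sm.cj.mul H.mu_deriv₁.1) p2, dir_mul o hx _ N.tau_sm.cj H.mu_deriv₁.1,
      dir_add o hx _ Psi2_sm (Sm.const _), dir_mul o hx _ (s4.mul p1) N.phi1_sm.cj,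
      dir_mul o hx _ s4 p1, dir_const, dir_const]
    ring
  rw [d1, ← conj_dl N.phi1] at e
  rw [← conj_dl N.phi1]
  rw [conj_tau hx] at *
  linear_combination e

end NPSystem.Horizons

namespace NPSystem.Horizons

variable {T : Set R4} {N : NPSystem T} {f g K : R4 → ℂ} {x : R4} (H : N.Horizons)

include H

/-! ### The hypersurface `r = 0` -/

theorem const₂ (hf : ConstOn T 0 1 f) (hx : x ∈ T) (h1 : x 1 = 0) :
    f x = f (pt 0 0 (x 2) (x 3)) := by
  have hl := H.complete₂ x hx h1
  have hD : ∀ r, HasDerivAt (fun s : ℝ => f (pt s 0 (x 2) (x 3))) 0 r := by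
    intro r
    have := hasDerivAt_pt_zero hf.1 N.isOpen (hl r)
    rwa [hf.2 _ (hl r) (by simp [pt])] at this
  have hc := is_const_of_deriv_eq_zero (fun r => (hD r).differentiableAt)
    (fun r => (hD r).deriv) (x 0) 0
  rwa [← h1, pt_eta, h1] at hc

theorem linear₂ (hf : Sm T f) (hK : ConstOn T 0 1 K) (hd : ∀ y ∈ T, y 1 = 0 → pd 0 f y = K y)
    (hz : ∀ y ∈ T, y 0 = 0 → y 1 = 0 → f y = 0) (hx : x ∈ T) (h1 : x 1 = 0) :
    f x = x 0 * K x := by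
  refine H.eq_on₂ hf ((Sm.coord 0).mul hK.1) (fun y hy y1 => ?_) (fun y hy y0 y1 => ?_) hx h1
  · rw [pd_coord_mul N.isOpen hK.1 hy, hK.2 y hy y1, hd y hy y1, mul_zero, add_zero]
  · rw [hz y hy y0 y1, y0]; simp

theorem quadratic₂ (hf : Sm T f) (hK : ConstOn T 0 1 K)
    (hd : ∀ y ∈ T, y 1 = 0 → pd 0 f y = y 0 * K y)
    (hz : ∀ y ∈ T, y 0 = 0 → y 1 = 0 → f y = 0) (hx : x ∈ T) (h1 : x 1 = 0) :
    f x = 1 / 2 * (x 0 * (x 0 * K x)) := by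
  refine H.eq_on₂ hf ((Sm.const (1 / 2)).mul ((Sm.coord 0).mul ((Sm.coord 0).mul hK.1)))
    (fun y hy y1 => ?_) (fun y hy y0 y1 => ?_) hx h1
  · rw [pd_coord_sq_mul N.isOpen hK.1 hy, hK.2 y hy y1, hd y hy y1, mul_zero, add_zero]
  · rw [hz y hy y0 y1, y0]; simp

/-- Every coefficient in the commutator of Δ and δ vanishes on r = 0: ν, μ, λ by the geometry of the
horizon and γ by the gauge. Moreover Δ = ∂_u there and δ is tangent. -/
theorem dl_const₂ (hf : ConstOn T 0 1 f) : ConstOn T 0 1 (N.dl f) := by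
  refine ⟨dl_sm hf.1, fun x hx h1 => ?_⟩
  have e := N.comm_Delta_delta f hf.1 x hx
  have s : Sm T (fun y => dir (N.n y) f y) :=
    Sm.sum (s := Finset.univ) fun a _ => (N.n_sm a).mul (hf.1.pd N.isOpen a)
  have e2 : dir (N.m x) (fun y => dir (N.n y) f y) x = 0 :=
    (H.dl_slice₂ s (Sm.const 0)
      (fun y hy y1 => by rw [H.Delta₂ _ hy y1, hf.2 y hy y1]) hx h1).trans (dir_const _ _ _)
  rw [e2, H.Delta₂ _ hx h1, H.nu₂ x hx h1, H.gamma₂ x hx h1, H.mu₂ x hx h1, H.lam₂ x hx h1] at e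
  change pd 0 (N.dl f) x - _ = _ at e
  simpa using e

theorem db_const₂ (hf : ConstOn T 0 1 f) : ConstOn T 0 1 (N.db f) := by
  have e : N.db f = fun y => conj (N.dl (fun y => conj (f y)) y) := by
    funext y
    rw [conj_dl]
    simp only [Complex.conj_conj]
  rw [e]
  exact (H.dl_const₂ hf.cj).cj

/-- The counterpart of Ψ₁ = 0 on the other horizon, from the Codazzi-type equation for δλ - δ̄μ. -/
theorem Psi3₂ (hx : x ∈ T) (h1 : x 1 = 0) : N.Psi3 x = 0 := by
  have e := N.delta_lam x hx
  have e1 : dir (N.m x) N.lam x = 0 :=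
    (H.dl_slice₂ N.lam_sm (Sm.const 0) H.lam₂ hx h1).trans (dir_const _ _ _)
  have e2 : dir (conjV (N.m x)) N.mu x = 0 :=
    (H.db_slice₂ N.mu_sm (Sm.const 0) H.mu₂ hx h1).trans (dir_const _ _ _)
  rw [e1, e2, H.mu₂ x hx h1, H.lam₂ x hx h1, H.phi2₂ hx h1] at e
  simpa using e

theorem Psi4₂ (hx : x ∈ T) (h1 : x 1 = 0) : N.Psi4 x = 0 := by
  have e := N.Delta_lam x hx
  have e1 : dir (conjV (N.m x)) N.nu x = 0 :=
    (H.db_slice₂ N.nu_sm (Sm.const 0) H.nu₂ hx h1).trans (dir_const _ _ _)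
  rw [e1, H.Delta₂ _ hx h1, pd_slice_const N.isOpen N.lam_sm H.lam₂ hx h1 (by decide),
    H.mu₂ x hx h1, H.lam₂ x hx h1, H.nu₂ x hx h1] at e
  simpa using e

theorem alpha₂ : ConstOn T 0 1 N.alpha := ⟨N.alpha_sm, fun x hx h1 => by
  have e := N.Delta_alpha x hx
  have e1 : dir (conjV (N.m x)) N.gamma x = 0 :=
    (H.db_slice₂ N.gamma_sm (Sm.const 0) H.gamma₂ hx h1).trans (dir_const _ _ _)
  rw [e1, H.Delta₂ _ hx h1, H.mu₂ x hx h1, H.lam₂ x hx h1, H.nu₂ x hx h1, H.gamma₂ x hx h1,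
    H.Psi3₂ hx h1] at e
  simpa using e⟩

theorem beta₂ : ConstOn T 0 1 N.beta := ⟨N.beta_sm, fun x hx h1 => by
  have e := N.delta_gamma x hx
  have e1 : dir (N.m x) N.gamma x = 0 :=
    (H.dl_slice₂ N.gamma_sm (Sm.const 0) H.gamma₂ hx h1).trans (dir_const _ _ _)
  rw [e1, H.Delta₂ _ hx h1, H.mu₂ x hx h1, H.lam₂ x hx h1, H.nu₂ x hx h1, H.gamma₂ x hx h1,
    H.phi2₂ hx h1] at e
  simpa using e⟩

theorem tau₂ : ConstOn T 0 1 N.tau :=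
  (H.alpha₂.cj.add N.isOpen H.beta₂).congr N.isOpen (by decide) N.tau_sm
    fun x hx _ => N.tau_eq x hx

theorem phi1₂ : ConstOn T 0 1 N.phi1 := ⟨N.phi1_sm, fun x hx h1 => by
  have e := N.delta_phi2 x hx
  have e1 : dir (N.m x) N.phi2 x = 0 :=
    (H.dl_slice₂ N.phi2_sm (Sm.const 0) (fun y hy y1 => H.phi2₂ hy y1) hx h1).trans
      (dir_const _ _ _)
  rw [e1, H.Delta₂ _ hx h1, H.mu₂ x hx h1, H.nu₂ x hx h1, H.phi2₂ hx h1] at e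
  simpa using e⟩

theorem delta_alpha₂ (hx : x ∈ T) (h1 : x 1 = 0) : N.dl N.alpha x - N.db N.beta x =
    N.alpha x * conj (N.alpha x) + N.beta x * conj (N.beta x) - 2 * N.alpha x * N.beta x
      - N.Psi2 x + N.L + 2 * N.phi1 x * conj (N.phi1 x) := by
  have e := N.delta_alpha x hx
  rw [H.mu₂ x hx h1, H.lam₂ x hx h1] at e
  change N.dl N.alpha x - N.db N.beta x = _ at e
  linear_combination e

/-- As on u = 0, Ψ₂ is determined by tangential derivatives of α and β, which are now independent of
u. -/
theorem Psi2₂ : ConstOn T 0 1 N.Psi2 := by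
  have o := N.isOpen
  have a := H.alpha₂
  have b := H.beta₂
  refine ConstOn.congr o (by decide) (((((((a.mul o a.cj).add o (b.mul o b.cj)).sub o
    (((ConstOn.const 2).mul o a).mul o b)).add o (ConstOn.const N.L)).add o
    (((ConstOn.const 2).mul o H.phi1₂).mul o H.phi1₂.cj)).sub o (H.dl_const₂ a)).add o
    (H.db_const₂ b)) Psi2_sm fun x hx h1 => ?_
  linear_combination H.delta_alpha₂ hx h1

/-! ### Rates of change along the generators of r = 0 -/

/-- The `u`-derivative of `φ₀`. -/
noncomputable def phi0Rate (_ : N.Horizons) (x : R4) : ℂ :=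
  N.dl N.phi1 x - 2 * N.tau x * N.phi1 x

/-- The `u`-derivative of `ρ`. -/
noncomputable def rhoRate (_ : N.Horizons) (x : R4) : ℂ :=
  N.db N.tau x - 2 * N.alpha x * N.tau x - N.Psi2 x - 2 * N.L

/-- The `u`-derivative of `σ`. -/
noncomputable def sigmaRate (_ : N.Horizons) (x : R4) : ℂ :=
  N.dl N.tau x - 2 * N.beta x * N.tau x

/-- The `u`-derivative of `Ψ₁`. -/
noncomputable def Psi1Rate (_ : N.Horizons) (x : R4) : ℂ :=
  N.dl N.Psi2 x + 2 * N.dl N.phi1 x * conj (N.phi1 x) - 3 * N.tau x * N.Psi2 x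

/-- The `u`-derivative of `Dτ`. -/
noncomputable def DtauRate (x : R4) : ℂ :=
  N.tau x * H.rhoRate x + conj (N.tau x) * H.sigmaRate x + H.Psi1Rate x
    + 2 * H.phi0Rate x * conj (N.phi1 x)

theorem phi0Rate_const : ConstOn T 0 1 H.phi0Rate :=
  have o := N.isOpen
  (H.dl_const₂ H.phi1₂).sub o (((ConstOn.const 2).mul o H.tau₂).mul o H.phi1₂)

theorem rhoRate_const : ConstOn T 0 1 H.rhoRate :=
  have o := N.isOpen
  (((H.db_const₂ H.tau₂).sub o (((ConstOn.const 2).mul o H.alpha₂).mul o H.tau₂)).sub o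
    H.Psi2₂).sub o (ConstOn.const _)

theorem sigmaRate_const : ConstOn T 0 1 H.sigmaRate :=
  have o := N.isOpen
  (H.dl_const₂ H.tau₂).sub o (((ConstOn.const 2).mul o H.beta₂).mul o H.tau₂)

theorem Psi1Rate_const : ConstOn T 0 1 H.Psi1Rate :=
  have o := N.isOpen
  ((H.dl_const₂ H.Psi2₂).add o (((ConstOn.const 2).mul o (H.dl_const₂ H.phi1₂)).mul o
    H.phi1₂.cj)).sub o (((ConstOn.const 3).mul o H.tau₂).mul o H.Psi2₂)

theorem DtauRate_const : ConstOn T 0 1 H.DtauRate :=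
  have o := N.isOpen
  (((H.tau₂.mul o H.rhoRate_const).add o (H.tau₂.cj.mul o H.sigmaRate_const)).add o
    H.Psi1Rate_const).add o (((ConstOn.const 2).mul o H.phi0Rate_const).mul o H.phi1₂.cj)

theorem phi0₂ (hx : x ∈ T) (h1 : x 1 = 0) : N.phi0 x = x 0 * H.phi0Rate x := by
  refine H.linear₂ N.phi0_sm H.phi0Rate_const (fun y hy y1 => ?_)
    (fun y hy y0 _ => H.phi0₁ hy y0) hx h1
  have e := N.delta_phi1 y hy
  rw [H.Delta₂ _ hy y1, H.mu₂ y hy y1, H.gamma₂ y hy y1, H.phi2₂ hy y1] at e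
  rw [phi0Rate, dl]
  linear_combination -e

theorem Delta_rho₂ (hx : x ∈ T) (h1 : x 1 = 0) : pd 0 N.rho x = H.rhoRate x := by
  have e := N.Delta_rho x hx
  rw [H.Delta₂ _ hx h1, H.mu₂ x hx h1, H.gamma₂ x hx h1, H.lam₂ x hx h1, conj_tau hx,
    map_zero] at e
  rw [rhoRate, db]
  linear_combination e

theorem Delta_sigma₂ (hx : x ∈ T) (h1 : x 1 = 0) : pd 0 N.sigma x = H.sigmaRate x := by
  have e := N.delta_tau x hx
  rw [H.Delta₂ _ hx h1, H.mu₂ x hx h1, H.gamma₂ x hx h1, H.lam₂ x hx h1, H.phi2₂ hx h1,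
    map_zero] at e
  rw [sigmaRate, dl]
  have e2 := N.tau_eq x hx
  linear_combination -e - N.tau x * e2

theorem rho₂ (hx : x ∈ T) (h1 : x 1 = 0) : N.rho x = x 0 * H.rhoRate x :=
  H.linear₂ N.rho_sm H.rhoRate_const (fun _ hy y1 => H.Delta_rho₂ hy y1)
    (fun y hy y0 _ => H.rho₁ y hy y0) hx h1

theorem sigma₂ (hx : x ∈ T) (h1 : x 1 = 0) : N.sigma x = x 0 * H.sigmaRate x :=
  H.linear₂ N.sigma_sm H.sigmaRate_const (fun _ hy y1 => H.Delta_sigma₂ hy y1)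
    (fun y hy y0 _ => H.sigma₁ y hy y0) hx h1

/-- Invisible in the formula for the rate, this reality is inherited from ρ. It relates δ̄τ to its
conjugate and is needed to simplify ∂_u Ψ₀. -/
theorem conj_rhoRate (hx : x ∈ T) (h1 : x 1 = 0) : conj (H.rhoRate x) = H.rhoRate x := by
  rw [← H.Delta_rho₂ hx h1, ← pd_conj]
  exact pd_congr N.isOpen hx N.rho_real

theorem dl_linear₂ (hf : Sm T f) (hK : Sm T K) (h : ∀ y ∈ T, y 1 = 0 → f y = y 0 * K y)
    (hx : x ∈ T) (h1 : x 1 = 0) : N.dl f x = x 0 * N.dl K x := by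
  rw [H.dl_slice₂ hf ((Sm.coord 0).mul hK) h hx h1, dl, dir_coord_mul N.isOpen hK hx, N.m_zero, dl]
  ring

theorem db_linear₂ (hf : Sm T f) (hK : Sm T K) (h : ∀ y ∈ T, y 1 = 0 → f y = y 0 * K y)
    (hx : x ∈ T) (h1 : x 1 = 0) : N.db f x = x 0 * N.db K x := by
  rw [H.db_slice₂ hf ((Sm.coord 0).mul hK) h hx h1, db, dir_coord_mul N.isOpen hK hx, conjV,
    N.m_zero, db, map_zero]
  ring

/-- The commutator of δ and δ̄ on τ produces the second derivatives of τ on the left, and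
`delta_alpha₂` evaluates the combination δα - δ̄β that appears. The identity stands in for a Bianchi
identity and fixes the u-coefficient of Ψ₁. -/
theorem dl_rhoRate (hx : x ∈ T) (h1 : x 1 = 0) :
    N.dl H.rhoRate x - N.db H.sigmaRate x = H.rhoRate x * N.tau x
      - H.sigmaRate x * (3 * N.alpha x - conj (N.beta x)) - H.Psi1Rate x
      + 2 * H.phi0Rate x * conj (N.phi1 x) := by
  have o := N.isOpen
  have s2 : Sm T (fun _ => (2 : ℂ)) := Sm.const 2
  have ta := db_sm (N := N) N.tau_sm
  have tb := dl_sm (N := N) N.tau_sm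
  have a2 := s2.mul N.alpha_sm
  have b2 := s2.mul N.beta_sm
  have e1 : N.dl H.rhoRate x = N.dl (N.db N.tau) x - 2 * N.dl N.alpha x * N.tau x
      - 2 * N.alpha x * N.dl N.tau x - N.dl N.Psi2 x := by
    change N.dl (fun x => N.db N.tau x - 2 * N.alpha x * N.tau x - N.Psi2 x - 2 * N.L) x = _
    unfold dl
    rw [dir_sub o hx _ ((ta.sub (a2.mul N.tau_sm)).sub Psi2_sm) (Sm.const _),
      dir_sub o hx _ (ta.sub (a2.mul N.tau_sm)) Psi2_sm, dir_sub o hx _ ta (a2.mul N.tau_sm),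
      dir_mul o hx _ a2 N.tau_sm, dir_mul o hx _ s2 N.alpha_sm, dir_const, dir_const]
    ring
  have e2 : N.db H.sigmaRate x = N.db (N.dl N.tau) x - 2 * N.db N.beta x * N.tau x
      - 2 * N.beta x * N.db N.tau x := by
    change N.db (fun x => N.dl N.tau x - 2 * N.beta x * N.tau x) x = _
    unfold db
    rw [dir_sub o hx _ tb (b2.mul N.tau_sm), dir_mul o hx _ b2 N.tau_sm,
      dir_mul o hx _ s2 N.beta_sm, dir_const]
    ring
  have c := N.comm_delta_deltabar N.tau N.tau_sm x hx
  rw [H.mu₂ x hx h1] at c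
  change N.dl (N.db N.tau) x - N.db (N.dl N.tau) x = _ + _ * N.db N.tau x - _ * N.dl N.tau x at c
  have a := H.delta_alpha₂ hx h1
  have t := N.tau_eq x hx
  rw [e1, e2, rhoRate, sigmaRate, Psi1Rate, phi0Rate]
  rw [map_zero] at c
  rw [t] at *
  linear_combination c - 2 * (conj (N.alpha x) + N.beta x) * a

/-- In the equation for δρ - δ̄σ every other term is u times a rate, so comparison with `dl_rhoRate`
determines Ψ₁. -/
theorem Psi1₂ (hx : x ∈ T) (h1 : x 1 = 0) : N.Psi1 x = x 0 * H.Psi1Rate x := by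
  have e := N.delta_rho x hx
  change N.dl N.rho x - N.db N.sigma x = _ at e
  rw [H.dl_linear₂ N.rho_sm H.rhoRate_const.1 (fun _ hy y1 => H.rho₂ hy y1) hx h1,
    H.db_linear₂ N.sigma_sm H.sigmaRate_const.1 (fun _ hy y1 => H.sigma₂ hy y1) hx h1,
    H.rho₂ hx h1, H.sigma₂ hx h1, H.phi0₂ hx h1, ← N.tau_eq x hx] at e
  linear_combination e - x 0 * H.dl_rhoRate hx h1

/-- The commutator of D and Δ on r = 0. There γ = 0, so ∂_r n = τ̄ m + τ m̄. -/
theorem D_Delta₂ (hf : Sm T f) (hx : x ∈ T) (h1 : x 1 = 0) :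
    pd 1 (fun y => dir (N.n y) f y) x =
      pd 0 (pd 1 f) x + conj (N.tau x) * N.dl f x + N.tau x * N.db f x := by
  have o := N.isOpen
  have e : ∀ a, pd 1 (fun y => N.n y a * pd a f y) x =
      (conj (N.tau x) * N.m x a + N.tau x * conj (N.m x a)) * pd a f x
        + N.n x a * pd a (pd 1 f) x := by
    intro a
    rw [pd_mul ((N.n_sm a).diff o hx) ((hf.pd o a).diff o hx), N.D_n x hx, H.gamma₂ x hx h1,
      pd_comm o hf hx]
    simp
  simp only [dir]
  rw [pd_sum fun a _ => ((N.n_sm a).mul (hf.pd o a)).diff o hx]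
  simp only [e, H.n₂ x hx h1, dl, db, dir, conjV, Fin.sum_univ_four, Matrix.cons_val]
  ring

theorem D_mu₂ (hx : x ∈ T) (h1 : x 1 = 0) : pd 1 N.mu x = N.Psi2 x + 2 * N.L := by
  rw [N.D_mu x hx, H.mu₂ x hx h1, H.lam₂ x hx h1]; ring

theorem D_lam₂ (hx : x ∈ T) (h1 : x 1 = 0) : pd 1 N.lam x = 0 := by
  rw [N.D_lam x hx, H.mu₂ x hx h1, H.lam₂ x hx h1, H.phi2₂ hx h1]; ring

theorem D_phi2₂ (hx : x ∈ T) (h1 : x 1 = 0) : pd 1 N.phi2 x = N.db N.phi1 x := by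
  have e := N.D_phi2 x hx
  rw [H.lam₂ x hx h1, H.phi2₂ hx h1] at e
  rw [db]
  linear_combination e

theorem D_tau₂ (hx : x ∈ T) (h1 : x 1 = 0) : pd 1 N.tau x = x 0 * H.DtauRate x := by
  rw [N.D_tau x hx, H.rho₂ hx h1, H.sigma₂ hx h1, H.Psi1₂ hx h1, H.phi0₂ hx h1, DtauRate]; ring

theorem D_beta₂ (hx : x ∈ T) (h1 : x 1 = 0) : pd 1 N.beta x =
    x 0 * (N.alpha x * H.sigmaRate x + H.rhoRate x * N.beta x + H.Psi1Rate x) := by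
  rw [N.D_beta x hx, H.rho₂ hx h1, H.sigma₂ hx h1, H.Psi1₂ hx h1]; ring

omit H in
theorem Psi0_sm : Sm T N.Psi0 :=
  ((N.sigma_sm.pd N.isOpen 1).sub (((Sm.const 2).mul N.rho_sm).mul N.sigma_sm)).congr
    fun x hx => by linear_combination -(N.D_sigma x hx)

theorem D_dl_tau₂ (hx : x ∈ T) (h1 : x 1 = 0) : pd 1 (N.dl N.tau) x =
    x 0 * (N.dl H.DtauRate x - N.tau x * H.DtauRate x + H.rhoRate x * N.dl N.tau x
      + H.sigmaRate x * N.db N.tau x) := by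
  have e := N.comm_D_delta N.tau N.tau_sm x hx
  change pd 1 (N.dl N.tau) x - N.dl (pd 1 N.tau) x =
    _ + _ * N.dl N.tau x + _ * N.db N.tau x at e
  rw [H.dl_linear₂ (N.tau_sm.pd N.isOpen 1) H.DtauRate_const.1 (fun _ hy y1 => H.D_tau₂ hy y1) hx h1,
    H.D_tau₂ hx h1, H.rho₂ hx h1, H.sigma₂ hx h1] at e
  linear_combination e

/-- Here Ψ₀ = Dσ - 2ρσ is differentiated in u. The term ∂_u Dσ is exchanged for DΔσ by `D_Delta₂`,
Δσ is eliminated by the δτ equation, and the D-equations evaluate what remains. On r = 0 each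
surviving term contains a quantity proportional to u, whence the overall factor u. -/
theorem Delta_Psi0₂ (hx : x ∈ T) (h1 : x 1 = 0) : pd 0 N.Psi0 x =
    x 0 * ((N.dl H.DtauRate x - N.tau x * H.DtauRate x + H.rhoRate x * N.dl N.tau x
      + H.sigmaRate x * N.db N.tau x)
      - (N.Psi2 x + 2 * N.L) * H.sigmaRate x
      - 2 * N.tau x * (N.alpha x * H.sigmaRate x + H.rhoRate x * N.beta x + H.Psi1Rate x)
      - 2 * N.beta x * H.DtauRate x
      + (3 * pd 1 N.gamma x - conj (pd 1 N.gamma x)) * H.sigmaRate x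
      - 2 * H.phi0Rate x * conj (N.db N.phi1 x)
      - conj (N.tau x) * N.dl H.sigmaRate x - N.tau x * N.db H.sigmaRate x
      - 4 * H.rhoRate x * H.sigmaRate x) := by
  have o := N.isOpen
  have s2 : Sm T (fun _ => (2 : ℂ)) := Sm.const 2
  have s3 : Sm T (fun _ => (3 : ℂ)) := Sm.const 3
  have e0 : pd 0 N.Psi0 x = pd 0 (pd 1 N.sigma) x
      - 2 * (pd 0 N.rho x * N.sigma x + N.rho x * pd 0 N.sigma x) := by
    rw [pd_congr o hx (g := fun y => pd 1 N.sigma y - 2 * (N.rho y * N.sigma y)) fun y hy => by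
      linear_combination -(N.D_sigma y hy),
      pd_sub ((N.sigma_sm.pd o 1).diff o hx) ((s2.mul (N.rho_sm.mul N.sigma_sm)).diff o hx),
      pd_mul (s2.diff o hx) ((N.rho_sm.mul N.sigma_sm).diff o hx), pd_const,
      pd_mul (N.rho_sm.diff o hx) (N.sigma_sm.diff o hx)]
    ring
  have e1 := H.D_Delta₂ N.sigma_sm hx h1
  have t1 := N.mu_sm.mul N.sigma_sm
  have t2 := N.lam_sm.cj.mul N.rho_sm
  have t3 := (s2.mul N.beta_sm).mul N.tau_sm
  have t4' := (s3.mul N.gamma_sm).sub N.gamma_sm.cj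
  have t4 := t4'.mul N.sigma_sm
  have t5 := (s2.mul N.phi0_sm).mul N.phi2_sm.cj
  rw [pd_congr o hx (g := fun y => N.dl N.tau y - (N.mu y * N.sigma y + conj (N.lam y) * N.rho y
      + 2 * N.beta y * N.tau y - (3 * N.gamma y - conj (N.gamma y)) * N.sigma y
      + 2 * N.phi0 y * conj (N.phi2 y))) fun y hy => by
        have e := N.delta_tau y hy
        have e2 := N.tau_eq y hy
        rw [dl]
        linear_combination -e - N.tau y * e2,
    pd_sub ((dl_sm N.tau_sm).diff o hx) (((((t1.add t2).add t3).sub t4).add t5).diff o hx),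
    pd_add ((((t1.add t2).add t3).sub t4).diff o hx) (t5.diff o hx),
    pd_sub (((t1.add t2).add t3).diff o hx) (t4.diff o hx),
    pd_add ((t1.add t2).diff o hx) (t3.diff o hx), pd_add (t1.diff o hx) (t2.diff o hx),
    pd_mul (N.mu_sm.diff o hx) (N.sigma_sm.diff o hx),
    pd_mul (N.lam_sm.cj.diff o hx) (N.rho_sm.diff o hx),
    pd_mul ((s2.mul N.beta_sm).diff o hx) (N.tau_sm.diff o hx),
    pd_mul (s2.diff o hx) (N.beta_sm.diff o hx),
    pd_mul (t4'.diff o hx) (N.sigma_sm.diff o hx),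
    pd_sub ((s3.mul N.gamma_sm).diff o hx) (N.gamma_sm.cj.diff o hx),
    pd_mul (s3.diff o hx) (N.gamma_sm.diff o hx),
    pd_mul ((s2.mul N.phi0_sm).diff o hx) (N.phi2_sm.cj.diff o hx),
    pd_const, pd_const, pd_conj, pd_conj, pd_conj, H.D_mu₂ hx h1, H.D_lam₂ hx h1, H.D_phi2₂ hx h1,
    H.D_tau₂ hx h1, H.D_beta₂ hx h1, H.D_dl_tau₂ hx h1, H.mu₂ x hx h1, H.lam₂ x hx h1,
    H.gamma₂ x hx h1, H.phi2₂ hx h1, map_zero, H.phi0₂ hx h1, H.rho₂ hx h1, H.sigma₂ hx h1,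
    H.dl_linear₂ N.sigma_sm H.sigmaRate_const.1 (fun _ hy y1 => H.sigma₂ hy y1) hx h1,
    H.db_linear₂ N.sigma_sm H.sigmaRate_const.1 (fun _ hy y1 => H.sigma₂ hy y1) hx h1] at e1
  rw [e0, H.Delta_rho₂ hx h1, H.Delta_sigma₂ hx h1, H.rho₂ hx h1, H.sigma₂ hx h1]
  linear_combination -e1

/-- Twice the coefficient of `u²` in `Ψ₀`. -/
noncomputable def Psi0Coeff (x : R4) : ℂ :=
  N.dl (N.dl N.Psi2) x + (N.tau x - 2 * N.beta x) * N.dl N.Psi2 x +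
    4 * (N.dl (N.dl N.phi1) x - (N.tau x + 2 * N.beta x) * N.dl N.phi1 x) * conj (N.phi1 x) +
    2 * N.dl N.phi1 x * N.dl (fun y => conj (N.phi1 y)) x +
    8 * N.tau x * N.dl N.phi1 x * conj (N.phi1 x) - 8 * N.tau x * H.Psi1Rate x
    - 12 * N.tau x ^ 2 * N.Psi2 x

theorem dl_DtauRate (hx : x ∈ T) : N.dl H.DtauRate x =
    N.dl N.tau x * H.rhoRate x + N.tau x * N.dl H.rhoRate x
      + conj (N.db N.tau x) * H.sigmaRate x + conj (N.tau x) * N.dl H.sigmaRate x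
      + (N.dl (N.dl N.Psi2) x + 2 * N.dl (N.dl N.phi1) x * conj (N.phi1 x)
        + 2 * N.dl N.phi1 x * conj (N.db N.phi1 x) - 3 * N.dl N.tau x * N.Psi2 x
        - 3 * N.tau x * N.dl N.Psi2 x)
      + 2 * (N.dl (N.dl N.phi1) x - 2 * N.dl N.tau x * N.phi1 x - 2 * N.tau x * N.dl N.phi1 x)
        * conj (N.phi1 x) + 2 * H.phi0Rate x * conj (N.db N.phi1 x) := by
  have o := N.isOpen
  have s2 : Sm T (fun _ => (2 : ℂ)) := Sm.const 2
  have s3 : Sm T (fun _ => (3 : ℂ)) := Sm.const 3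
  have r := H.rhoRate_const.1
  have s := H.sigmaRate_const.1
  have p := H.Psi1Rate_const.1
  have q := H.phi0Rate_const.1
  have d1 := dl_sm (N := N) N.phi1_sm
  have d2 := dl_sm (N := N) (Psi2_sm (N := N))
  have e1 : N.dl H.Psi1Rate x = N.dl (N.dl N.Psi2) x + 2 * N.dl (N.dl N.phi1) x * conj (N.phi1 x)
        + 2 * N.dl N.phi1 x * conj (N.db N.phi1 x) - 3 * N.dl N.tau x * N.Psi2 x
        - 3 * N.tau x * N.dl N.Psi2 x := by
    rw [conj_db]
    change N.dl (fun x => N.dl N.Psi2 x + 2 * N.dl N.phi1 x * conj (N.phi1 x)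
      - 3 * N.tau x * N.Psi2 x) x = _
    unfold dl at *
    rw [dir_sub o hx _ (d2.add ((s2.mul d1).mul N.phi1_sm.cj)) ((s3.mul N.tau_sm).mul Psi2_sm),
      dir_add o hx _ d2 ((s2.mul d1).mul N.phi1_sm.cj),
      dir_mul o hx _ (s2.mul d1) N.phi1_sm.cj, dir_mul o hx _ s2 d1,
      dir_mul o hx _ (s3.mul N.tau_sm) Psi2_sm, dir_mul o hx _ s3 N.tau_sm, dir_const, dir_const]
    ring
  have e2 : N.dl H.phi0Rate x = N.dl (N.dl N.phi1) x - 2 * N.dl N.tau x * N.phi1 x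
      - 2 * N.tau x * N.dl N.phi1 x := by
    change N.dl (fun x => N.dl N.phi1 x - 2 * N.tau x * N.phi1 x) x = _
    unfold dl at *
    rw [dir_sub o hx _ d1 ((s2.mul N.tau_sm).mul N.phi1_sm),
      dir_mul o hx _ (s2.mul N.tau_sm) N.phi1_sm, dir_mul o hx _ s2 N.tau_sm, dir_const]
    ring
  rw [← e1, ← e2, conj_db, conj_db]
  change N.dl (fun x => N.tau x * H.rhoRate x + conj (N.tau x) * H.sigmaRate x + H.Psi1Rate x
    + 2 * H.phi0Rate x * conj (N.phi1 x)) x = _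
  clear e1 e2
  unfold dl
  rw [dir_add o hx _ (((N.tau_sm.mul r).add (N.tau_sm.cj.mul s)).add p)
      ((s2.mul q).mul N.phi1_sm.cj),
    dir_add o hx _ ((N.tau_sm.mul r).add (N.tau_sm.cj.mul s)) p,
    dir_add o hx _ (N.tau_sm.mul r) (N.tau_sm.cj.mul s), dir_mul o hx _ N.tau_sm r,
    dir_mul o hx _ N.tau_sm.cj s, dir_mul o hx _ (s2.mul q) N.phi1_sm.cj, dir_mul o hx _ s2 q,
    dir_const]
  ring

theorem Delta_Psi0_eq₂ (hx : x ∈ T) (h1 : x 1 = 0) : pd 0 N.Psi0 x = x 0 * H.Psi0Coeff x := by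
  rw [H.Delta_Psi0₂ hx h1]
  congr 1
  have r := H.conj_rhoRate hx h1
  have q := H.dl_rhoRate hx h1
  rw [H.dl_DtauRate hx, N.D_gamma x hx, Psi0Coeff, ← conj_db]
  have t := conj_tau (N := N) hx
  have t2 : conj (N.L) = N.L := N.L_real
  -- The commutator of D and Δ contributes τ̄, and δτ̄ contributes the conjugate of δ̄τ. Reality of
  -- the ρ-rate and the identity for its δ-derivative eliminate the terms in derivatives of τ.
  simp only [rhoRate, map_sub, map_mul, map_add, map_ofNat, t2, Complex.conj_conj] at r ⊢
  rw [DtauRate]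
  rw [rhoRate] at q ⊢
  rw [sigmaRate, Psi1Rate, phi0Rate] at *
  have t3 := N.tau_eq x hx
  rw [t] at *
  linear_combination N.tau x * q + (N.dl N.tau x - 2 * N.beta x * N.tau x) * r
    - (N.alpha x + conj (N.beta x)) * (N.dl N.tau x - 2 * N.beta x * N.tau x) * t3

theorem Psi0Coeff_const : ConstOn T 0 1 H.Psi0Coeff :=
  have o := N.isOpen
  have c := fun z : ℂ => ConstOn.const (T := T) (i := 0) (j := 1) z
  have p := H.phi1₂
  have dp := H.dl_const₂ p
  have dP := H.dl_const₂ H.Psi2₂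
  have t := H.tau₂
  have b2 := (c 2).mul o H.beta₂
  have x1 := (H.dl_const₂ dP).add o ((t.sub o b2).mul o dP)
  have x2 := ((c 4).mul o ((H.dl_const₂ dp).sub o ((t.add o b2).mul o dp))).mul o p.cj
  have x3 := ((c 2).mul o dp).mul o (H.dl_const₂ p.cj)
  have x4 := (((c 8).mul o t).mul o dp).mul o p.cj
  have x5 := ((c 8).mul o t).mul o H.Psi1Rate_const
  have x6 := ((c 12).mul o (t.mul o t)).mul o H.Psi2₂
  have x7 := ((((x1.add o x2).add o x3).add o x4).sub o x5).sub o x6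
  x7.congr o (by decide) (x7.1.congr fun x _ => by rw [Psi0Coeff]; ring)
    fun x _ _ => by rw [Psi0Coeff]; ring

/-- Of the coefficient integrated here, the last two terms, -8τ times the Ψ₁-rate and -12τ²Ψ₂, are
precisely those cancelled by the null rotation with b = uτ. -/
theorem Psi0₂ (hx : x ∈ T) (h1 : x 1 = 0) : N.Psi0 x = 1 / 2 * (x 0 * (x 0 * H.Psi0Coeff x)) :=
  H.quadratic₂ Psi0_sm H.Psi0Coeff_const (fun _ hy y1 => H.Delta_Psi0_eq₂ hy y1)
    (fun _ hy y0 _ => H.Psi0₁ hy y0) hx h1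

end NPSystem.Horizons

/-! ## The Newman-Penrose system of a Gaussian null patch -/

/-- The tetrad `(ℓ, n, m, m̄)` as a family. -/
noncomputable def TetradCoeffs.frame (t : TetradCoeffs) : Fin 4 → R4 → Fin 4 → ℂ :=
  ![t.l, t.n, t.m, t.mbar]

/-- The Christoffel symbols `Γ_{dbc}` with all indices down. -/
noncomputable def christoffelDown (G : MetricComp) (d b c : Fin 4) (x : R4) : ℝ :=
  ∑ a, G x d a * christoffel G a b c x

theorem ip_christoffel {G : MetricComp} {x : R4} (κ : Fin 4) (v W : Fin 4 → ℂ) :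
    ip G x v (fun a => ∑ b, W b * (christoffel G a b κ x : ℂ)) =
      ∑ b, ∑ d, W b * v d * (christoffelDown G d b κ x : ℂ) := by
  simp only [ip, Fin.sum_univ_four, christoffelDown]
  push_cast
  ring

/-- A symmetric deformation tensor without expansion and shear vanishes. -/
theorem nullDeformation_eq_zero {G : MetricComp} {κ : Fin 4} {x : R4}
    (hs : ∀ A B, nullDeformation G κ x A B = nullDeformation G κ x B A)
    (h1 : nullExpansion G κ x = 0) (h2 : nullShear G κ x = 0) (A B : Fin 2) :
    nullDeformation G κ x A B = 0 := by
  have h3 := congrFun (congrFun h2 A) B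
  rw [nullShear, h1] at h3
  simp [Matrix.transpose_apply, ← hs A B] at h3
  linarith

namespace GaugedTetrad

variable {T : Set R4} {G : MetricComp} {E : Fin 4 → R4 → Fin 4 → ℂ} (h : GaugedTetrad T G E)
  {x : R4}

include h

/-- The condition ℓ_a = (du)_a holds on the whole domain, not only on r = 0 where the coordinates
prescribe it. -/
theorem metric_one (hx : x ∈ T) (a : Fin 4) : G x 1 a = if a = 0 then 1 else 0 := by
  have e := h.ip_l hx (fun b => if b = a then 1 else 0)
  rw [h.l_eq] at e
  simp only [ip, Fin.sum_univ_four (f := fun c => ∑ b, (G x c b : ℂ) * _ * _), Matrix.cons_val] at e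
  simp at e
  have e' : (G x 1 a : ℂ) = ((if a = 0 then 1 else 0 : ℝ) : ℂ) := by
    rw [e]; fin_cases a <;> simp
  exact_mod_cast e'

theorem pd_metric_one (hx : x ∈ T) (μ a : Fin 4) : pd μ (fun y => G y 1 a) x = 0 := by
  have : (fun y => G y 1 a) =ᶠ[𝓝 x] fun _ => if a = 0 then 1 else 0 :=
    Filter.eventuallyEq_of_mem (h.isOpen.mem_nhds hx) fun y hy => h.metric_one hy a
  simp [pd, this.fderiv_eq]

theorem pd_metric_one' (hx : x ∈ T) (μ a : Fin 4) : pd μ (fun y => G y a 1) x = 0 := by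
  rw [← h.pd_metric_one hx μ a]
  exact congrArg (fun f => pd μ f x) (funext fun y => h.symm y a 1)

/-- The connection coefficients `m^a m̄^b ∇_b ℓ_a` and `m^a m^b ∇_b ℓ_a` vanish on a hypersurface on
which the deformation of the congruence `∂_r` vanishes. -/
theorem conn_l_eq_zero (hx : x ∈ T) (hr : ∀ a, christoffel G a 1 1 x = 0)
    (h1 : nullExpansion G 1 x = 0) (h2 : nullShear G 1 x = 0) (i j : Fin 4) (hi : E i x 0 = 0)
    (hj : E j x 0 = 0) : conn G E i 0 j x = 0 := by
  -- The shear controls only the symmetric part of the deformation tensor; symmetry must be supplied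
  -- separately, here from the constancy of the components g_{1a}.
  have hs : ∀ A B, nullDeformation G 1 x A B = nullDeformation G 1 x B A := by
    intro A B
    have e : ∀ A B, nullDeformation G 1 x A B =
        (1 / 2) * pd 1 (fun y => G y (crossIdx A) (crossIdx B)) x := by
      intro A B
      simp only [nullDeformation, Matrix.of_apply]
      rw [h.lower_christoffel hx, h.pd_metric_one' hx, h.pd_metric_one' hx,
        show (fun y => G y (crossIdx A) (crossIdx B)) = fun y => G y (crossIdx B) (crossIdx A) from
          funext fun y => h.symm y _ _]
      ring
    rw [e, e]
    exact congrArg (fun f => 1 / 2 * pd 1 f x) (funext fun y => h.symm y _ _)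
  have hB := nullDeformation_eq_zero hs h1 h2
  have b22 : christoffelDown G 2 2 1 x = 0 := hB 0 0
  have b23 : christoffelDown G 3 2 1 x = 0 := hB 0 1
  have b32 : christoffelDown G 2 3 1 x = 0 := hB 1 0
  have b33 : christoffelDown G 3 3 1 x = 0 := hB 1 1
  -- Together with the geodesic condition, this leaves only Christoffel symbols with two
  -- cross-section indices, which form the deformation tensor. A ∂_r part of the frame vectors
  -- therefore does no harm.
  have hd : ∀ b, christoffelDown G 1 b 1 x = 0 := by
    intro b
    rw [christoffelDown, h.lower_christoffel hx, h.pd_metric_one hx, h.pd_metric_one hx,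
      h.pd_metric_one' hx]
    ring
  have hb : ∀ d, christoffelDown G d 1 1 x = 0 := fun d => by simp [christoffelDown, hr]
  have e : covDeriv G (E i x) (E 0) x =
      fun a => ∑ b, E i x b * (christoffel G a b 1 x : ℂ) := by
    funext a
    simp only [covDeriv, h.l_eq, pd_const, zero_add]
    refine Finset.sum_congr rfl fun b _ => ?_
    rw [Fin.sum_univ_four]; simp
  rw [conn, e, ip_christoffel]
  simp only [Fin.sum_univ_four, hi, hj, hd, hb, b22, b23, b32, b33]
  simp

/-- Connection coefficients of `n` on a hypersurface on which `n = ∂_u` and the deformation of the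
congruence `∂_u` vanishes. -/
theorem conn_n_eq_zero (hn : ∀ y ∈ T, y 1 = 0 → E 1 y = ![1, 0, 0, 0]) (hx : x ∈ T) (hx1 : x 1 = 0)
    (hg : ∀ y ∈ T, y 1 = 0 → ∀ a : Fin 4, a ≠ 1 → G y 0 a = 0)
    (h1 : nullExpansion G 0 x = 0) (h2 : nullShear G 0 x = 0) (i j : Fin 4) (hi : E i x 0 = 0)
    (hj : E j x 0 = 0) (hi1 : E i x 1 = 0) (hj1 : E j x 1 = 0) : conn G E i 1 j x = 0 := by
  -- The components g_{0a} with a ≠ 1 vanish on r = 0, so their tangential derivatives vanish. The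
  -- exclusion of μ = 1 is essential, since nothing is known about transverse derivatives.
  have hz : ∀ μ a : Fin 4, μ ≠ 1 → a ≠ 1 → pd μ (fun y => G y a 0) x = 0 := by
    intro μ a hμ ha
    have e := pd_slice_const (μ := μ) h.isOpen (h.g_sm 0 a) (k := 0)
      (fun y hy y1 => by rw [hg y hy y1 a ha, Complex.ofReal_zero]) hx hx1 hμ
    rw [pd_ofReal (h.g_diff hx _ _), Complex.ofReal_eq_zero] at e
    rw [← e]
    exact congrArg (fun f => pd μ f x) (funext fun y => h.symm y _ _)
  have hc : ∀ A, crossIdx A ≠ 1 := by decide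
  have hs : ∀ A B, nullDeformation G 0 x A B = nullDeformation G 0 x B A := by
    intro A B
    have e : ∀ A B, nullDeformation G 0 x A B =
        (1 / 2) * pd 0 (fun y => G y (crossIdx A) (crossIdx B)) x := by
      intro A B
      simp only [nullDeformation, Matrix.of_apply]
      rw [h.lower_christoffel hx, hz _ _ (hc A) (hc B), hz _ _ (hc B) (hc A),
        show (fun y => G y (crossIdx A) (crossIdx B)) = fun y => G y (crossIdx B) (crossIdx A) from
          funext fun y => h.symm y _ _]
      ring
    rw [e, e]
    exact congrArg (fun f => 1 / 2 * pd 0 f x) (funext fun y => h.symm y _ _)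
  have hB := nullDeformation_eq_zero hs h1 h2
  have b22 : christoffelDown G 2 2 0 x = 0 := hB 0 0
  have b23 : christoffelDown G 3 2 0 x = 0 := hB 0 1
  have b32 : christoffelDown G 2 3 0 x = 0 := hB 1 0
  have b33 : christoffelDown G 3 3 0 x = 0 := hB 1 1
  have e : covDeriv G (E i x) (E 1) x =
      fun a => ∑ b, E i x b * (christoffel G a b 0 x : ℂ) := by
    funext a
    simp only [covDeriv]
    refine Finset.sum_congr rfl fun b _ => ?_
    by_cases hb : b = 1
    · rw [hb, hi1, zero_mul, zero_mul]
    · rw [pd_slice_const h.isOpen (h.e_smooth 1 a) (k := (![1, 0, 0, 0] : Fin 4 → ℂ) a)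
        (fun y hy y1 => by rw [hn y hy y1]) hx hx1 hb, hn x hx hx1, Fin.sum_univ_four]
      simp
  rw [conn, e, ip_christoffel]
  simp only [Fin.sum_univ_four, hi, hj, hi1, hj1, b22, b23, b32, b33]
  simp

/-- `∂_u` is geodesic. -/
theorem covDeriv_n_n (hn : ∀ y ∈ T, y 1 = 0 → E 1 y = ![1, 0, 0, 0]) (hx : x ∈ T) (hx1 : x 1 = 0)
    (hu : ∀ a, christoffel G a 0 0 x = 0) : covDeriv G (E 1 x) (E 1) x = 0 := by
  funext a
  simp only [covDeriv]
  rw [hn x hx hx1, Fin.sum_univ_four,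
    pd_slice_const h.isOpen (h.e_smooth 1 a) (k := (![1, 0, 0, 0] : Fin 4 → ℂ) a)
      (fun y hy y1 => by rw [hn y hy y1]) hx hx1 (show (0 : Fin 4) ≠ 1 by decide)]
  simp [Fin.sum_univ_four, hu]

end GaugedTetrad

/-! ### The adapted tetrad and its horizons -/

section patch

variable {M : Type*} [TopologicalSpace M] [ChartedSpace R4 M] [IsManifold 𝓘(ℝ, R4) ∞ M]
  {S : Electrovacuum M} {H₁ H₂ : Set M} {P : GaussianNullPatch S H₁ H₂} {t : TetradCoeffs}

theorem covDeriv_conjV (G : MetricComp) (W : Fin 4 → ℂ) (V : R4 → Fin 4 → ℂ) (x : R4) :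
    covDeriv G (conjV W) (fun y => conjV (V y)) x = conjV (covDeriv G W V x) := by
  funext a
  simp only [conjV, covDeriv, map_sum, map_mul, map_add, Complex.conj_ofReal, pd_conj]

theorem IsNullTetradAt.gram {G : MetricComp} {x : R4} (hs : ∀ x a b, G x a b = G x b a)
    {l n m : Fin 4 → ℂ} (h : IsNullTetradAt G x l n m) (i j : Fin 4) :
    ip G x ((![l, n, m, conjV m] : Fin 4 → Fin 4 → ℂ) i)
      ((![l, n, m, conjV m] : Fin 4 → Fin 4 → ℂ) j) = eta i j := by
  obtain ⟨hl, hn, ll, nn, mm, ln, mb, lm, nm⟩ := h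
  have c := fun v w => ip_comm (x := x) hs v w
  have lb : ip G x l (conjV m) = 0 := by
    have := conj_ip (G := G) (x := x) l m
    rw [lm, hl, map_zero] at this
    exact this.symm
  have nb : ip G x n (conjV m) = 0 := by
    have := conj_ip (G := G) (x := x) n m
    rw [nm, hn, map_zero] at this
    exact this.symm
  have bb : ip G x (conjV m) (conjV m) = 0 := by rw [← conj_ip, mm, map_zero]
  fin_cases i <;> fin_cases j <;>
    simp [eta, ll, nn, mm, ln, mb, lm, nm, lb, nb, bb, c n l, c m l, c m n, c (conjV m) l,
      c (conjV m) n, c (conjV m) m]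

theorem chartComp_symm (S : Electrovacuum M) (φ : OpenPartialHomeomorph M R4) (x : R4)
    (a b : Fin 4) : chartComp S.g φ x a b = chartComp S.g φ x b a := by
  simp only [chartComp, Matrix.of_apply]
  exact S.g_symm _ _ _

theorem TetradCoeffs.conjV_l (t : TetradCoeffs) (x : R4) : conjV (t.l x) = t.l x := by
  funext a; fin_cases a <;> simp [conjV, TetradCoeffs.l]

theorem TetradCoeffs.conjV_n (t : TetradCoeffs) (x : R4) : conjV (t.n x) = t.n x := by
  funext a; fin_cases a <;> simp [conjV, TetradCoeffs.n]

theorem TetradCoeffs.frame_apply (t : TetradCoeffs) (i : Fin 4) (x : R4) :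
    t.frame i x = (![t.l x, t.n x, t.m x, conjV (t.m x)] : Fin 4 → Fin 4 → ℂ) i :=
  match i with
  | 0 => rfl
  | 1 => rfl
  | 2 => rfl
  | 3 => rfl

namespace IsAdaptedTetrad

variable (ht : IsAdaptedTetrad P t)

include ht

theorem m_smooth (a : Fin 4) : Sm P.chart.target (fun x => t.m x a) :=
  match a with
  | 0 => Sm.const 0
  | 1 => ht.om_smooth
  | 2 => contDiffOn_pi.1 ht.xi_smooth 0
  | 3 => contDiffOn_pi.1 ht.xi_smooth 1

theorem n_smooth (a : Fin 4) : Sm P.chart.target (fun x => t.n x a) :=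
  match a with
  | 0 => Sm.const 1
  | 1 => Sm.ofReal ht.U_smooth
  | 2 => Sm.ofReal (contDiffOn_pi.1 ht.X_smooth 0)
  | 3 => Sm.ofReal (contDiffOn_pi.1 ht.X_smooth 1)

theorem frame_smooth (i a : Fin 4) : Sm P.chart.target (fun x => t.frame i x a) :=
  match i with
  | 0 => Sm.const _
  | 1 => ht.n_smooth a
  | 2 => ht.m_smooth a
  | 3 => (ht.m_smooth a).cj

theorem smoothTetrad : SmoothTetrad P.chart.target (chartComp S.g P.chart) t.frame where
  isOpen := P.chart.open_target
  symm := chartComp_symm S P.chart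
  g_smooth a b := S.g_smooth P.chart P.chart_mem a b
  e_smooth := ht.frame_smooth
  gram x hx i j := by
    rw [t.frame_apply, t.frame_apply]
    exact (ht.nullTetrad x hx).gram (chartComp_symm S P.chart) i j
  real x i := by
    fin_cases i
    · exact t.conjV_l x
    · exact t.conjV_n x
    · rfl
    · exact conjV_conjV _

theorem gaugedTetrad : GaugedTetrad P.chart.target (chartComp S.g P.chart) t.frame where
  toSmoothTetrad := ht.smoothTetrad
  parallel x hx j k := by
    have e : covDeriv (chartComp S.g P.chart) (t.frame 0 x) (t.frame j) x = 0 := by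
      fin_cases j
      · exact ht.parallel_l x hx
      · exact ht.parallel_n x hx
      · exact ht.parallel_m x hx
      · have h1 := covDeriv_conjV (chartComp S.g P.chart) (t.frame 0 x) t.m x
        rw [ht.smoothTetrad.real x 0] at h1
        refine h1.trans ?_
        rw [show covDeriv (chartComp S.g P.chart) (t.frame 0 x) t.m x = 0 from ht.parallel_m x hx]
        funext a; simp [conjV]
    rw [conn, e, ip_zero_right]
  u_comp x i := by
    fin_cases i <;> simp [TetradCoeffs.frame, TetradCoeffs.l, TetradCoeffs.n, TetradCoeffs.m,
      TetradCoeffs.mbar, conjV]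
  l_eq _ := rfl

omit ht in
theorem electrovacuumOn : ElectrovacuumOn P.chart.target (chartComp S.g P.chart)
    (chartComp S.F P.chart) S.cosm where
  F_smooth := S.F_smooth P.chart P.chart_mem
  F_antisymm x a b := by
    simp only [chartComp, Matrix.of_apply]
    exact S.F_antisymm _ _ _
  maxwell_div := S.maxwell_div P.chart P.chart_mem
  maxwell_closed := S.maxwell_closed P.chart P.chart_mem
  einstein := S.einstein P.chart P.chart_mem

/-- The Newman-Penrose system of the patch. -/
noncomputable def np : NPSystem P.chart.target :=
  ht.gaugedTetrad.npSystem (electrovacuumOn (P := P))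

theorem n_H₂ {x : R4} (hx : x ∈ P.chart.target) (h1 : x 1 = 0) : t.n x = ![1, 0, 0, 0] := by
  obtain ⟨hU, hX, -⟩ := ht.on_H₂ x hx h1
  simp [TetradCoeffs.n, hU, hX]

/-- Translates the geometric hypotheses: vanishing deformation of ∂_r gives ρ = σ = 0, vanishing
deformation of ∂_u gives μ = λ = 0, and affine geodesy of ∂_u gives ν = 0. -/
theorem horizons (hexp₁ : ∀ x ∈ P.chart.target, x 0 = 0 → nullExpansion (chartComp S.g P.chart) 1 x = 0)
    (hshear₁ : ∀ x ∈ P.chart.target, x 0 = 0 → nullShear (chartComp S.g P.chart) 1 x = 0)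
    (hexp₂ : ∀ x ∈ P.chart.target, x 1 = 0 → nullExpansion (chartComp S.g P.chart) 0 x = 0)
    (hshear₂ : ∀ x ∈ P.chart.target, x 1 = 0 → nullShear (chartComp S.g P.chart) 0 x = 0) :
    ht.np.Horizons := by
  have h := ht.gaugedTetrad
  have m0 : ∀ x, t.frame 2 x 0 = 0 := fun x => h.u_comp x 2
  have b0 : ∀ x, t.frame 3 x 0 = 0 := fun x => h.u_comp x 3
  have m1 : ∀ x ∈ P.chart.target, x 1 = 0 → t.frame 2 x 1 = 0 := fun x hx h1 =>
    (ht.on_H₂ x hx h1).2.2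
  have b1 : ∀ x ∈ P.chart.target, x 1 = 0 → t.frame 3 x 1 = 0 := fun x hx h1 => by
    change conj (t.frame 2 x 1) = 0
    rw [m1 x hx h1, map_zero]
  have hn : ∀ y ∈ P.chart.target, y 1 = 0 → t.frame 1 y = ![1, 0, 0, 0] := fun y hy y1 =>
    ht.n_H₂ hy y1
  have c₁ := fun x hx h0 => h.conn_l_eq_zero hx (P.r_geodesic x hx) (hexp₁ x hx h0)
    (hshear₁ x hx h0)
  have c₂ := fun x hx (h1 : x 1 = 0) => h.conn_n_eq_zero hn hx h1 P.u_null (hexp₂ x hx h1)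
    (hshear₂ x hx h1)
  refine ⟨fun x hx h0 r => ?_, fun x hx h1 u => ?_, fun x hx h0 => c₁ x hx h0 3 2 (b0 x) (m0 x),
    fun x hx h0 => c₁ x hx h0 2 2 (m0 x) (m0 x), fun x hx h1 => ?_, fun x hx h1 => ?_,
    fun x hx h1 => ?_, fun x hx h1 => ht.gamma_H₂ x hx h1, hn, m1⟩
  · refine P.complete_H₁ _ _ ?_ r
    -- Scaling r by 0 slides the point along its generator to the intersection surface, where
    -- completeness is assumed.
    have := P.from_H₂ 0 (x 1) (x 2) (x 3) (by rwa [← h0, pt_eta]) 0 (by simp)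
    simpa using this
  · exact P.complete_H₂ _ _ (P.from_Z (x 0) _ _ (by rwa [← h1, pt_eta])) u
  · exact neg_eq_zero.2 (c₂ x hx h1 2 3 (m0 x) (b0 x) (m1 x hx h1) (b1 x hx h1))
  · exact neg_eq_zero.2 (c₂ x hx h1 3 3 (b0 x) (b0 x) (b1 x hx h1) (b1 x hx h1))
  · refine neg_eq_zero.2 ?_
    rw [conn, h.covDeriv_n_n hn hx h1 (P.u_geodesic x hx h1), ip_zero_right]

end IsAdaptedTetrad

end patch

/-! ## Null rotations about `n` -/

section linear

variable (G : MetricComp) (x : R4) (c : ℂ) (v v' w y z : Fin 4 → ℂ)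

theorem riemC_lin₁ : riemC G x (v + c • v') w y z = riemC G x v w y z + c * riemC G x v' w y z := by
  simp only [riemC, Finset.mul_sum, ← Finset.sum_add_distrib]
  refine Finset.sum_congr rfl fun _ _ => Finset.sum_congr rfl fun _ _ => Finset.sum_congr rfl
    fun _ _ => Finset.sum_congr rfl fun _ _ => ?_
  simp only [Pi.add_apply, Pi.smul_apply, smul_eq_mul]; ring

theorem riemC_lin₂ : riemC G x w (v + c • v') y z = riemC G x w v y z + c * riemC G x w v' y z := by
  simp only [riemC, Finset.mul_sum, ← Finset.sum_add_distrib]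
  refine Finset.sum_congr rfl fun _ _ => Finset.sum_congr rfl fun _ _ => Finset.sum_congr rfl
    fun _ _ => Finset.sum_congr rfl fun _ _ => ?_
  simp only [Pi.add_apply, Pi.smul_apply, smul_eq_mul]; ring

theorem riemC_lin₃ : riemC G x w y (v + c • v') z = riemC G x w y v z + c * riemC G x w y v' z := by
  simp only [riemC, Finset.mul_sum, ← Finset.sum_add_distrib]
  refine Finset.sum_congr rfl fun _ _ => Finset.sum_congr rfl fun _ _ => Finset.sum_congr rfl
    fun _ _ => Finset.sum_congr rfl fun _ _ => ?_
  simp only [Pi.add_apply, Pi.smul_apply, smul_eq_mul]; ring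

theorem riemC_lin₄ : riemC G x w y z (v + c • v') = riemC G x w y z v + c * riemC G x w y z v' := by
  simp only [riemC, Finset.mul_sum, ← Finset.sum_add_distrib]
  refine Finset.sum_congr rfl fun _ _ => Finset.sum_congr rfl fun _ _ => Finset.sum_congr rfl
    fun _ _ => Finset.sum_congr rfl fun _ _ => ?_
  simp only [Pi.add_apply, Pi.smul_apply, smul_eq_mul]; ring

theorem ricciC_lin₁ : ricciC G x (v + c • v') w = ricciC G x v w + c * ricciC G x v' w := by
  simp only [ricciC, contr2, Finset.mul_sum, ← Finset.sum_add_distrib]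
  refine Finset.sum_congr rfl fun _ _ => Finset.sum_congr rfl fun _ _ => ?_
  simp only [Pi.add_apply, Pi.smul_apply, smul_eq_mul]; ring

theorem ricciC_lin₂ : ricciC G x w (v + c • v') = ricciC G x w v + c * ricciC G x w v' := by
  simp only [ricciC, contr2, Finset.mul_sum, ← Finset.sum_add_distrib]
  refine Finset.sum_congr rfl fun _ _ => Finset.sum_congr rfl fun _ _ => ?_
  simp only [Pi.add_apply, Pi.smul_apply, smul_eq_mul]; ring

end linear

/-- The null rotation of `m` about `n`. -/
def rotM (E : Fin 4 → R4 → Fin 4 → ℂ) (x : R4) (b : ℂ) : Fin 4 → ℂ := E 2 x + b • E 1 x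

/-- The null rotation of `ℓ` about `n`. -/
noncomputable def rotL (E : Fin 4 → R4 → Fin 4 → ℂ) (x : R4) (b : ℂ) : Fin 4 → ℂ :=
  E 0 x + conj b • E 2 x + b • E 3 x + (b * conj b) • E 1 x

namespace GaugedTetrad

variable {T : Set R4} {G : MetricComp} {E : Fin 4 → R4 → Fin 4 → ℂ} (h : GaugedTetrad T G E)
  {F : R4 → Matrix (Fin 4) (Fin 4) ℝ} {Λ : ℝ} (hF : ElectrovacuumOn T G F Λ) {x : R4}

include h

theorem conj_rotL (b : ℂ) : conjV (rotL E x b) = rotL E x b := by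
  have e : ∀ i a, conj (E i x a) = E (bar i) x a := fun i a => congrFun (h.real x i) a
  funext a
  simp only [rotL, conjV, Pi.add_apply, Pi.smul_apply, smul_eq_mul, map_add, map_mul,
    Complex.conj_conj, e]
  simp only [bar, Matrix.cons_val]
  ring

theorem conj_rotM (b : ℂ) : conjV (rotM E x b) = E 3 x + conj b • E 1 x := by
  have e : ∀ i a, conj (E i x a) = E (bar i) x a := fun i a => congrFun (h.real x i) a
  funext a
  simp only [rotM, conjV, Pi.add_apply, Pi.smul_apply, smul_eq_mul, map_add, map_mul, e]
  simp only [bar, Matrix.cons_val]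

variable (hx : x ∈ T)

include hx

theorem ricciC_symm (i j : Fin 4) : ricciC G x (E i x) (E j x) = ricciC G x (E j x) (E i x) := by
  rw [h.ricciC_frame hx, h.ricciC_frame hx]
  have e : ∀ p q, riemC G x (E p x) (E i x) (E j x) (E q x) =
      riemC G x (E q x) (E j x) (E i x) (E p x) := by
    intro p q
    rw [h.riemC_pair hx, h.riemC_antisymm_left hx, h.riemC_antisymm_right hx, neg_neg]
  rw [e 0 1, e 1 0, e 2 3, e 3 2]; ring

/-- Null rotations about n are Lorentz transformations for every complex b; the quadratic
coefficient b b̄ in `rotL` is what keeps the rotated ℓ null. -/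
theorem isNullTetradAt_rot (b : ℂ) : IsNullTetradAt G x (rotL E x b) (E 1 x) (rotM E x b) := by
  have g := h.gram x hx
  refine ⟨h.conj_rotL b, h.real x 1, ?_, ?_, ?_, ?_, ?_, ?_, ?_⟩ <;>
    (try rw [h.conj_rotM]) <;>
    simp only [rotL, rotM, ip_add_left, ip_add_right, ip_smul_left, ip_smul_right, g] <;>
    simp [eta] <;> ring

include hF

/-- The Ricci components in the rotated tetrad where `φ₂ = 0`. -/
theorem ricci_rot (f0 f1 b : ℂ) (h0 : contr2 (F x) (E 0 x) (E 2 x) = f0)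
    (h1 : maxwellPhi1 E F x = f1) (h2 : contr2 (F x) (E 3 x) (E 1 x) = 0) :
    ricciC G x (rotL E x b) (rotL E x b) = -4 * (f0 + 2 * b * f1) * conj (f0 + 2 * b * f1) ∧
    ricciC G x (rotL E x b) (rotM E x b) = -4 * (f0 + 2 * b * f1) * conj f1 := by
  obtain ⟨-, r00, r02, r03, r11, r12, r13, r22, r33, r01, r23⟩ :=
    h.ricci_values hF hx f0 f1 0 h0.symm h1.symm h2.symm
  have s := h.ricciC_symm hx
  have r10 := s 1 0
  have r20 := s 2 0
  have r30 := s 3 0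
  have r21 := s 2 1
  have r31 := s 3 1
  have r32 := s 3 2
  rw [r01] at r10
  rw [r02] at r20
  rw [r03] at r30
  rw [r12] at r21
  rw [r13] at r31
  rw [r23] at r32
  constructor <;>
    simp only [rotL, rotM, ricciC_lin₁, ricciC_lin₂, r00, r01, r02, r03, r10, r11, r12, r13, r20,
      r21, r22, r23, r30, r31, r32, r33, map_zero, map_add, map_mul, map_ofNat] <;> ring

/-- The Weyl components in the rotated tetrad where `φ₂ = Ψ₃ = Ψ₄ = 0`. -/
theorem weyl_rot (f0 f1 P0 P1 P2 b : ℂ) (h0 : contr2 (F x) (E 0 x) (E 2 x) = f0)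
    (h1 : maxwellPhi1 E F x = f1) (h2 : contr2 (F x) (E 3 x) (E 1 x) = 0)
    (p0 : -weylC G x (E 0 x) (E 2 x) (E 0 x) (E 2 x) = P0)
    (p1 : -weylC G x (E 0 x) (E 1 x) (E 0 x) (E 2 x) = P1) (p2 : weylPsi2 G E x = P2)
    (p3 : -weylC G x (E 1 x) (E 0 x) (E 1 x) (E 3 x) = 0)
    (p4 : -weylC G x (E 1 x) (E 3 x) (E 1 x) (E 3 x) = 0) :
    -weylC G x (rotL E x b) (rotM E x b) (rotL E x b) (rotM E x b) =
      P0 + 4 * b * P1 + 6 * b ^ 2 * P2 ∧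
    -weylC G x (rotL E x b) (E 1 x) (rotL E x b) (rotM E x b) = P1 + 3 * b * P2 := by
  obtain ⟨r1, r2, r3, r4, r5, r6, r7, r8, r9, r10, r11, r12, r13, r14, r15, r16, r17, r18⟩ :=
    h.riemann_values hF hx f0 f1 0 (Λ / 6) h0.symm h1.symm h2.symm rfl _ rfl P0 P1 P2 0 0
    p0.symm p1.symm p2.symm p3.symm p4.symm
  obtain ⟨q1, q2⟩ := h.ricci_rot hF hx f0 f1 b h0 h1 h2
  obtain ⟨-, -, ll, nn, mm, ln, -, lm, nm⟩ := h.isNullTetradAt_rot hx b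
  have c := fun v w => ip_comm (x := x) h.symm v w
  rw [weylC_eq, weylC_eq, ll, mm, lm, c (E 1 x), ln, nm, q2, c (rotM E x b), lm]
  have hL := h.riemC_antisymm_left hx
  have hR := h.riemC_antisymm_right hx
  have hP := h.riemC_pair hx
  -- The bivector identity ℓ'∧m' = ℓ∧m + b(ℓ∧n + m̄∧m) + b² m̄∧n: the terms with b̄ cancel by
  -- antisymmetry.
  have hr : ∀ i j, riemC G x (E i x) (E j x) (rotL E x b) (rotM E x b) =
      riemC G x (E i x) (E j x) (E 0 x) (E 2 x)
      + b * (riemC G x (E i x) (E j x) (E 0 x) (E 1 x) + riemC G x (E i x) (E j x) (E 3 x) (E 2 x))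
      + b ^ 2 * riemC G x (E i x) (E j x) (E 3 x) (E 1 x) := by
    intro i j
    simp only [rotL, rotM, riemC_lin₃, riemC_lin₄]
    have a1 := hR i j 2 2
    have a2 := hR i j 1 1
    have a3 := hR i j 2 1
    linear_combination (1 / 2) * conj b * a1 + (1 / 2) * b ^ 2 * conj b * a2 + b * conj b * a3
  -- The same expansion in the first pair. The terms with b̄ stay for now, because antisymmetry is
  -- available only when all four arguments are frame vectors.
  have hl : ∀ y z, riemC G x (rotL E x b) (rotM E x b) y z =
      riemC G x (E 0 x) (E 2 x) y z
      + b * (riemC G x (E 0 x) (E 1 x) y z + riemC G x (E 3 x) (E 2 x) y z)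
      + b ^ 2 * riemC G x (E 3 x) (E 1 x) y z
      + conj b * (riemC G x (E 2 x) (E 2 x) y z
        + b * (riemC G x (E 2 x) (E 1 x) y z + riemC G x (E 1 x) (E 2 x) y z)
        + b ^ 2 * riemC G x (E 1 x) (E 1 x) y z) := by
    intro y z
    simp only [rotL, rotM, riemC_lin₁, riemC_lin₂]
    ring
  have hn : ∀ y z, riemC G x (rotL E x b) (E 1 x) y z =
      riemC G x (E 0 x) (E 1 x) y z + conj b * riemC G x (E 2 x) (E 1 x) y z
      + b * riemC G x (E 3 x) (E 1 x) y z + b * conj b * riemC G x (E 1 x) (E 1 x) y z := by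
    intro y z
    simp only [rotL, riemC_lin₁]
  rw [hl, hn]
  simp only [hr]
  have hz : ∀ i k l, riemC G x (E i x) (E i x) (E k x) (E l x) = 0 := fun i k l => by
    linear_combination (1 / 2) * hL i i k l
  simp only [hz, hL 1 2]
  simp only [map_zero, mul_zero, zero_mul] at r9 r10 r13 r14 r15 r16 r18
  have a1 : riemC G x (E 0 x) (E 2 x) (E 0 x) (E 2 x) = -P0 := by
    linear_combination hL 0 2 0 2 - r2
  have a2 : riemC G x (E 0 x) (E 2 x) (E 0 x) (E 1 x) + riemC G x (E 0 x) (E 2 x) (E 3 x) (E 2 x) =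
      -2 * P1 := by
    linear_combination hP 0 2 0 1 + hL 0 1 0 2 + hP 0 2 3 2 - 2 * r5
  have a3 : riemC G x (E 0 x) (E 2 x) (E 3 x) (E 1 x) = -P2 - 2 * (Λ / 6) := by
    linear_combination hP 0 2 3 1 - r8
  have b1 : riemC G x (E 0 x) (E 1 x) (E 0 x) (E 2 x) + riemC G x (E 3 x) (E 2 x) (E 0 x) (E 2 x) =
      -2 * P1 := by
    linear_combination hL 0 1 0 2 - 2 * r5
  have b2 : riemC G x (E 0 x) (E 1 x) (E 0 x) (E 1 x) + riemC G x (E 0 x) (E 1 x) (E 3 x) (E 2 x)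
      + (riemC G x (E 3 x) (E 2 x) (E 0 x) (E 1 x) + riemC G x (E 3 x) (E 2 x) (E 3 x) (E 2 x)) =
      -4 * P2 + 4 * (Λ / 6) := by
    linear_combination hL 0 1 0 1 - 2 * r6 + hL 0 1 3 2 - hR 1 0 3 2 + hR 3 2 3 2 + 2 * r12
  have b3 : riemC G x (E 0 x) (E 1 x) (E 3 x) (E 1 x) + riemC G x (E 3 x) (E 2 x) (E 3 x) (E 1 x) =
      0 := by
    linear_combination hL 0 1 3 1 - hR 1 0 3 1 + hR 3 2 3 1 + 2 * r18
  have c2 : riemC G x (E 3 x) (E 1 x) (E 0 x) (E 1 x) + riemC G x (E 3 x) (E 1 x) (E 3 x) (E 2 x) =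
      0 := by
    linear_combination hR 3 1 3 2 + r13 - r9
  have c3 : riemC G x (E 3 x) (E 1 x) (E 3 x) (E 1 x) = 0 := by
    linear_combination hR 3 1 3 1 + r10
  have d1 : riemC G x (E 0 x) (E 1 x) (E 0 x) (E 2 x) = -P1 - 2 * f0 * conj f1 := by
    linear_combination hL 2 0 0 1 - hP 0 2 0 1 - r3
  have d2 : riemC G x (E 0 x) (E 1 x) (E 0 x) (E 1 x) + riemC G x (E 0 x) (E 1 x) (E 3 x) (E 2 x) =
      -2 * (P2 - Λ / 6 + 2 * f1 * conj f1) := by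
    linear_combination hL 0 1 0 1 - 2 * r6 + hP 0 1 3 2
  have d3 : riemC G x (E 0 x) (E 1 x) (E 3 x) (E 1 x) = 0 := by
    linear_combination hP 0 1 3 1 - r9
  have e1 : riemC G x (E 2 x) (E 1 x) (E 0 x) (E 2 x) = 0 := by
    linear_combination hP 2 1 0 2 + hL 0 2 2 1 - r16
  have e2 : riemC G x (E 2 x) (E 1 x) (E 0 x) (E 1 x) + riemC G x (E 2 x) (E 1 x) (E 3 x) (E 2 x) =
      0 := by
    linear_combination hP 2 1 0 1 + hL 0 1 2 1 + hP 2 1 3 2 - 2 * r15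
  have e3 : riemC G x (E 2 x) (E 1 x) (E 3 x) (E 1 x) = 0 := by
    linear_combination hP 2 1 3 1 - r14
  constructor
  · linear_combination -a1 - b * a2 - b ^ 2 * a3 - b * b1 - b ^ 2 * b2 - b ^ 3 * b3 + b ^ 2 * r8
      - b ^ 3 * c2 - b ^ 4 * c3
  · linear_combination -d1 - b * d2 - b ^ 2 * d3 - conj b * (e1 + b * e2 + b ^ 2 * e3) + b * r8
      - b ^ 2 * c2 - b ^ 3 * c3

end GaugedTetrad

/-! ## Parallel propagation along the generators -/

section parallel

variable {T : Set R4} {G : MetricComp} {a b : ℝ} {V : R4 → Fin 4 → ℂ}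

theorem isParallelAlong_r (hT : IsOpen T) (hV : ∀ i, Sm T (fun y => V y i))
    (hl : ∀ r, pt 0 r a b ∈ T) (hp : ∀ r, covDeriv G ![0, 1, 0, 0] V (pt 0 r a b) = 0) :
    IsParallelAlong G (fun r => pt 0 r a b) (fun r => V (pt 0 r a b)) := by
  intro s i
  have hd := hasDerivAt_pt_one (hV i) hT (hl s)
  have e := congrFun (hp s) i
  have d0 : ∀ j, deriv (fun t : ℝ => ((pt 0 t a b j : ℝ) : ℂ)) s = if j = 1 then 1 else 0 := by
    have h1 : deriv (fun t : ℝ => (t : ℂ)) s = 1 := by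
      simpa using ((hasDerivAt_id s).ofReal_comp).deriv
    intro j; fin_cases j <;> simp [pt, h1]
  simp only [covDeriv, Fin.sum_univ_four (f := fun b => (![0, 1, 0, 0] : Fin 4 → ℂ) b * _),
    Matrix.cons_val, Pi.zero_apply] at e
  simp only [d0]
  rw [Fin.sum_univ_four]
  simp
  convert hd using 1
  linear_combination -e

theorem isParallelAlong_u (hT : IsOpen T) (hV : ∀ i, Sm T (fun y => V y i))
    (hl : ∀ u, pt u 0 a b ∈ T) (hp : ∀ u, covDeriv G ![1, 0, 0, 0] V (pt u 0 a b) = 0) :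
    IsParallelAlong G (fun u => pt u 0 a b) (fun u => V (pt u 0 a b)) := by
  intro s i
  have hd := hasDerivAt_pt_zero (hV i) hT (hl s)
  have e := congrFun (hp s) i
  have d0 : ∀ j, deriv (fun t : ℝ => ((pt t 0 a b j : ℝ) : ℂ)) s = if j = 0 then 1 else 0 := by
    have h1 : deriv (fun t : ℝ => (t : ℂ)) s = 1 := by
      simpa using ((hasDerivAt_id s).ofReal_comp).deriv
    intro j; fin_cases j <;> simp [pt, h1]
  simp only [covDeriv, Fin.sum_univ_four (f := fun b => (![1, 0, 0, 0] : Fin 4 → ℂ) b * _),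
    Matrix.cons_val, Pi.zero_apply] at e
  simp only [d0]
  rw [Fin.sum_univ_four]
  simp
  convert hd using 1
  linear_combination -e

theorem covDeriv_add_smul (hT : IsOpen T) {x : R4} (hx : x ∈ T) (W : Fin 4 → ℂ)
    {V U : R4 → Fin 4 → ℂ} {f : R4 → ℂ} (hV : ∀ i, Sm T (fun y => V y i))
    (hU : ∀ i, Sm T (fun y => U y i)) (hf : Sm T f) :
    covDeriv G W (fun y => V y + f y • U y) x =
      covDeriv G W V x + dir W f x • U x + f x • covDeriv G W U x := by
  funext i
  have e : ∀ c, pd c (fun y => V y i + f y * U y i) x =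
      pd c (fun y => V y i) x + (pd c f x * U x i + f x * pd c (fun y => U y i) x) := by
    intro c
    rw [pd_add ((hV i).diff hT hx) ((hf.mul (hU i)).diff hT hx),
      pd_mul (hf.diff hT hx) ((hU i).diff hT hx)]
  simp only [covDeriv, dir, Pi.add_apply, Pi.smul_apply, smul_eq_mul, e, Fin.sum_univ_four]
  ring

end parallel

/-! ## Divergence of linear and quadratic functions -/

/-- The norm is |s|^p ‖c‖, so the parity of p is irrelevant and both ends diverge alike. -/
theorem tendsto_norm_pow_mul {c : ℂ} (hc : c ≠ 0) {p : ℕ} (hp : p ≠ 0) {f : ℝ → ℝ}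
    (hf : ∀ s : ℝ, f s = ‖(s : ℂ) ^ p * c‖) : Tendsto f atTop atTop ∧ Tendsto f atBot atTop := by
  have e : f = fun s => |s| ^ p * ‖c‖ := by
    funext s
    rw [hf, norm_mul, norm_pow, Complex.norm_real, Real.norm_eq_abs]
  have h := fun (l : Filter ℝ) (hl : Tendsto (fun s : ℝ => |s|) l atTop) =>
    ((tendsto_pow_atTop hp).comp hl).atTop_mul_const (norm_pos_iff.2 hc)
  rw [e]
  exact ⟨h _ tendsto_abs_atTop_atTop, h _ tendsto_abs_atBot_atTop⟩

section patch

variable {M : Type*} [TopologicalSpace M] [ChartedSpace R4 M] [IsManifold 𝓘(ℝ, R4) ∞ M]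
  {S : Electrovacuum M} {H₁ H₂ : Set M} {P : GaussianNullPatch S H₁ H₂} {t : TetradCoeffs}

namespace IsAdaptedTetrad

variable (ht : IsAdaptedTetrad P t)

include ht

theorem isParallelNullTetrad₁ {a b : ℝ} (hl : ∀ r, pt 0 r a b ∈ P.chart.target) :
    IsParallelNullTetrad (chartComp S.g P.chart) (fun r => pt 0 r a b) (fun r => t.l (pt 0 r a b))
      (fun r => t.n (pt 0 r a b)) (fun r => t.m (pt 0 r a b)) :=
  ⟨fun r => ht.nullTetrad _ (hl r),
    isParallelAlong_r P.chart.open_target (ht.frame_smooth 0) hl fun r => ht.parallel_l _ (hl r),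
    isParallelAlong_r P.chart.open_target ht.n_smooth hl fun r => ht.parallel_n _ (hl r),
    isParallelAlong_r P.chart.open_target ht.m_smooth hl fun r => ht.parallel_m _ (hl r)⟩

omit ht in
theorem m'_eq (G : MetricComp) (x : R4) : t.m' G x = rotM t.frame x (x 0 * t.tau G x) := by
  funext a
  simp only [rotM, TetradCoeffs.m', Pi.add_apply, Pi.smul_apply, smul_eq_mul]
  rfl

omit ht in
theorem l'_eq (G : MetricComp) (x : R4) : t.l' G x = rotL t.frame x (x 0 * t.tau G x) := by
  funext a
  simp only [rotL, TetradCoeffs.l', Pi.add_apply, Pi.smul_apply, smul_eq_mul, map_mul,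
    Complex.conj_ofReal]
  change _ = t.l x a + x 0 * conj (t.tau G x) * t.m x a + x 0 * t.tau G x * t.mbar x a +
    x 0 * t.tau G x * (x 0 * conj (t.tau G x)) * t.n x a
  ring

/-- On r = 0 one has ∇_n n = 0, ∇_n m = -τ n and ∇_n ℓ = -τ̄ m - τ m̄. The function b = uτ satisfies
Δb = τ because τ does not depend on u, so the derivatives of the rotation coefficients cancel these
terms. -/
theorem isParallelNullTetrad₂ (H : ht.np.Horizons) {a b : ℝ}
    (hl : ∀ u, pt u 0 a b ∈ P.chart.target) :
    IsParallelNullTetrad (chartComp S.g P.chart) (fun u => pt u 0 a b)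
      (fun u => t.l' (chartComp S.g P.chart) (pt u 0 a b)) (fun u => t.n (pt u 0 a b))
      (fun u => t.m' (chartComp S.g P.chart) (pt u 0 a b)) := by
  set G := chartComp S.g P.chart with hG
  have h := ht.gaugedTetrad
  have o := P.chart.open_target
  have ts : Sm P.chart.target (t.tau G) := ht.np.tau_sm
  have hb : Sm P.chart.target (fun y => (y 0 : ℂ) * t.tau G y) := (Sm.coord 0).mul ts
  have hcb := hb.cj
  have s := ht.frame_smooth
  have x1 : ∀ u, pt u 0 a b 1 = 0 := fun u => by simp [pt]
  have hn : ∀ u, t.n (pt u 0 a b) = ![1, 0, 0, 0] := fun u => ht.n_H₂ (hl u) (x1 u)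
  have hτ : ∀ u, dir (t.frame 1 (pt u 0 a b)) (fun y => (y 0 : ℂ) * t.tau G y) (pt u 0 a b) =
      t.tau G (pt u 0 a b) := by
    intro u
    change dir (t.n (pt u 0 a b)) _ _ = _
    rw [hn u, dir_coord_mul o ts (hl u)]
    have e := H.tau₂.2 _ (hl u) (x1 u)
    have e2 : dir ![1, 0, 0, 0] (t.tau G) (pt u 0 a b) = pd 0 (t.tau G) (pt u 0 a b) := by
      simp [dir, Fin.sum_univ_four]
    have e3 : pd 0 (t.tau G) (pt u 0 a b) = 0 := e
    rw [e2, e3]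
    simp
  have hτc : ∀ u, dir (t.frame 1 (pt u 0 a b)) (fun y => conj ((y 0 : ℂ) * t.tau G y)) (pt u 0 a b) =
      conj (t.tau G (pt u 0 a b)) := by
    intro u
    have e := conj_dir (t.frame 1 (pt u 0 a b)) (fun y => (y 0 : ℂ) * t.tau G y) (pt u 0 a b)
    rw [hτ, h.real _ 1] at e
    exact e.symm
  have hv : ∀ u, conn G t.frame 1 1 2 (pt u 0 a b) = 0 ∧ conn G t.frame 1 1 3 (pt u 0 a b) = 0 ∧
      spinGamma G t.frame (pt u 0 a b) = 0 := by
    intro u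
    have e : conn G t.frame 1 1 3 (pt u 0 a b) = 0 := neg_eq_zero.1 (H.nu₂ _ (hl u) (x1 u))
    have v := (h.conn_values (hl u)).2.2.2.2.1
    refine ⟨by rw [v, e, map_zero], e, H.gamma₂ _ (hl u) (x1 u)⟩
  have nn : ∀ u, covDeriv G (t.frame 1 (pt u 0 a b)) (t.frame 1) (pt u 0 a b) = 0 := fun u => by
    obtain ⟨v1, v2, v3⟩ := hv u
    obtain ⟨-, -, w1, -, -, -, -, w2, -, -, w3, -, -, -⟩ := h.conn_values (hl u)
    rw [h.covDeriv_frame (hl u), h.conn_self (hl u), h.conn_antisymm (hl u) 1 1 0, w2, v3, v1, v2]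
    simp
  have nl : ∀ u, covDeriv G (t.frame 1 (pt u 0 a b)) (t.frame 0) (pt u 0 a b) =
      -(conj (t.tau G (pt u 0 a b)) • t.frame 2 (pt u 0 a b))
        - t.tau G (pt u 0 a b) • t.frame 3 (pt u 0 a b) := fun u => by
    obtain ⟨v1, v2, v3⟩ := hv u
    obtain ⟨-, -, w1, -, -, -, -, w2, -⟩ := h.conn_values (hl u)
    rw [h.covDeriv_frame (hl u), h.conn_self (hl u), w1, w2, v3,
      show conn G t.frame 1 0 2 (pt u 0 a b) = t.tau G (pt u 0 a b) from rfl]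
    simp
  have nm : ∀ u, covDeriv G (t.frame 1 (pt u 0 a b)) (t.frame 2) (pt u 0 a b) =
      -(t.tau G (pt u 0 a b) • t.frame 1 (pt u 0 a b)) := fun u => by
    obtain ⟨v1, v2, v3⟩ := hv u
    obtain ⟨-, -, w1, -, -, -, -, w2, -, -, w3, -⟩ := h.conn_values (hl u)
    rw [h.covDeriv_frame (hl u), h.conn_self (hl u), h.conn_antisymm (hl u) 1 2 1, v1, w3, v3,
      h.conn_antisymm (hl u) 1 2 0,
      show conn G t.frame 1 0 2 (pt u 0 a b) = t.tau G (pt u 0 a b) from rfl]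
    simp
  have nb : ∀ u, covDeriv G (t.frame 1 (pt u 0 a b)) (t.frame 3) (pt u 0 a b) =
      -(conj (t.tau G (pt u 0 a b)) • t.frame 1 (pt u 0 a b)) := fun u => by
    obtain ⟨v1, v2, v3⟩ := hv u
    obtain ⟨-, -, w1, -, -, -, -, w2, -, -, w3, -⟩ := h.conn_values (hl u)
    rw [h.covDeriv_frame (hl u), h.conn_self (hl u), h.conn_antisymm (hl u) 1 3 1, v2,
      h.conn_antisymm (hl u) 1 3 2, w3, v3, h.conn_antisymm (hl u) 1 3 0, w1,
      show conn G t.frame 1 0 2 (pt u 0 a b) = t.tau G (pt u 0 a b) from rfl]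
    simp
  have sadd : ∀ {V U : R4 → Fin 4 → ℂ} {f : R4 → ℂ},
      (∀ i, Sm P.chart.target (fun y => V y i)) → (∀ i, Sm P.chart.target (fun y => U y i)) →
      Sm P.chart.target f → ∀ i, Sm P.chart.target (fun y => (V y + f y • U y) i) :=
    fun hV hU hf i => (hV i).add (hf.mul (hU i))
  have s1 := sadd (s 0) (s 2) hcb
  have s2 := sadd s1 (s 3) hb
  have s3 := sadd s2 (s 1) (hb.mul hcb)
  have sm := sadd (s 2) (s 1) hb
  have hm' : t.m' G = fun y => t.frame 2 y + ((y 0 : ℂ) * t.tau G y) • t.frame 1 y := by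
    funext y; exact m'_eq G y
  have hl' : t.l' G = fun y => t.frame 0 y + conj ((y 0 : ℂ) * t.tau G y) • t.frame 2 y
      + ((y 0 : ℂ) * t.tau G y) • t.frame 3 y
      + ((y 0 : ℂ) * t.tau G y * conj ((y 0 : ℂ) * t.tau G y)) • t.frame 1 y := by
    funext y; exact l'_eq G y
  refine ⟨fun u => ?_, ?_, ?_, ?_⟩
  · beta_reduce
    rw [l'_eq, m'_eq]
    exact h.isNullTetradAt_rot (hl u) _
  · rw [hl']
    refine isParallelAlong_u o s3 hl fun u => ?_
    rw [← hn u]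
    change covDeriv G (t.frame 1 (pt u 0 a b)) _ _ = 0
    rw [covDeriv_add_smul o (hl u) _ s2 (s 1) (hb.mul hcb),
      covDeriv_add_smul o (hl u) _ s1 (s 3) hb, covDeriv_add_smul o (hl u) _ (s 0) (s 2) hcb,
      dir_mul o (hl u) _ hb hcb, hτ, hτc, nn, nl, nm, nb]
    funext i
    simp only [Pi.add_apply, Pi.sub_apply, Pi.neg_apply, Pi.smul_apply, smul_eq_mul, Pi.zero_apply,
      map_mul]
    ring
  · refine isParallelAlong_u o (s 1) hl fun u => ?_
    rw [← hn u]
    exact nn u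
  · rw [hm']
    refine isParallelAlong_u o sm hl fun u => ?_
    rw [← hn u]
    change covDeriv G (t.frame 1 (pt u 0 a b)) _ _ = 0
    rw [covDeriv_add_smul o (hl u) _ (s 2) (s 1) hb, hτ, nn, nm]
    simp

end IsAdaptedTetrad

end patch

/-! ### Components along the generators with coefficients at the point `z` -/

section patch

variable {M : Type*} [TopologicalSpace M] [ChartedSpace R4 M] [IsManifold 𝓘(ℝ, R4) ∞ M]
  {S : Electrovacuum M} {H₁ H₂ : Set M} {P : GaussianNullPatch S H₁ H₂} {t : TetradCoeffs}

namespace IsAdaptedTetrad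

variable (ht : IsAdaptedTetrad P t) (H : ht.np.Horizons) {a b : ℝ}

include H

theorem const_r {f : R4 → ℂ} (hf : ConstOn P.chart.target 1 0 f)
    (hl : ∀ r, pt 0 r a b ∈ P.chart.target) (r : ℝ) : f (pt 0 r a b) = f (pt 0 0 a b) :=
  H.const₁ hf (hl r) (by simp [pt])

theorem const_u {f : R4 → ℂ} (hf : ConstOn P.chart.target 0 1 f)
    (hl : ∀ u, pt u 0 a b ∈ P.chart.target) (u : ℝ) : f (pt u 0 a b) = f (pt 0 0 a b) :=
  H.const₂ hf (hl u) (by simp [pt])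

/-- The Weyl and Ricci components along the generators of `H₁`. -/
theorem components₁ (hl : ∀ r, pt 0 r a b ∈ P.chart.target) {G : MetricComp}
    (hG : G = chartComp S.g P.chart) {F : R4 → Matrix (Fin 4) (Fin 4) ℝ}
    (hF : F = chartComp S.F P.chart) {z : R4} (hz : z = pt 0 0 a b) (r : ℝ) :
    -weylC G (pt 0 r a b) (t.n (pt 0 r a b)) (t.l (pt 0 r a b)) (t.n (pt 0 r a b))
      (t.mbar (pt 0 r a b)) = r * t.Psit3 G F z ∧
    -(1 / 2) * ricciC G (pt 0 r a b) (t.n (pt 0 r a b)) (t.m (pt 0 r a b)) =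
      r * (TetradCoeffs.k * t.phi1 F z * conj (t.dltbar (t.phi1 F) z)) ∧
    -weylC G (pt 0 r a b) (t.n (pt 0 r a b)) (t.mbar (pt 0 r a b)) (t.n (pt 0 r a b))
      (t.mbar (pt 0 r a b)) =
      (1 / 2) * (r : ℂ) ^ 2 * (t.Psit4 G F z - conj (t.tau G z) *
        (t.Psit3 G F z + TetradCoeffs.k * t.dltbar (t.phi1 F) z * conj (t.phi1 F z))) ∧
    -(1 / 2) * ricciC G (pt 0 r a b) (t.n (pt 0 r a b)) (t.n (pt 0 r a b)) =
      (r : ℂ) ^ 2 *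
        (TetradCoeffs.k * t.dltbar (t.phi1 F) z * conj (t.dltbar (t.phi1 F) z)) := by
  subst hG hF hz
  set G := chartComp S.g P.chart
  set F := chartComp S.F P.chart
  set x := pt 0 r a b with hxdef
  have hx : x ∈ P.chart.target := hl r
  have x0 : x 0 = 0 := by simp [hxdef, pt]
  have x1 : x 1 = r := by simp [hxdef, pt]
  -- All coefficients are independent of r, so they may be evaluated at the intersection surface.
  have c := fun {f} (hf : ConstOn P.chart.target 1 0 f) => ht.const_r H hf hl r
  have p1 := H.phi1₁
  have p2 := H.Psi2₁
  have dp1 := H.db_const₁ p1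
  have dp2 := H.db_const₁ p2
  have e1 : t.phi1 F x = t.phi1 F (pt 0 0 a b) := c p1
  have e2 : t.dltbar (t.phi1 F) x = t.dltbar (t.phi1 F) (pt 0 0 a b) := c dp1
  have e3 : t.dltbar (t.Psi2 G) x = t.dltbar (t.Psi2 G) (pt 0 0 a b) := c dp2
  have e4 : t.dltbar (t.dltbar (t.phi1 F)) x = t.dltbar (t.dltbar (t.phi1 F)) (pt 0 0 a b) :=
    c (H.db_const₁ dp1)
  have e5 : t.dltbar (t.dltbar (t.Psi2 G)) x = t.dltbar (t.dltbar (t.Psi2 G)) (pt 0 0 a b) :=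
    c (H.db_const₁ dp2)
  have e6 : t.dltbar (fun y => conj (t.phi1 F y)) x =
      t.dltbar (fun y => conj (t.phi1 F y)) (pt 0 0 a b) := c (H.db_const₁ p1.cj)
  have e7 : t.tau G x = t.tau G (pt 0 0 a b) := c H.tau₁
  have e8 : t.alpha G x = t.alpha G (pt 0 0 a b) := c H.alpha₁
  have f2 : contr2 (F x) (t.mbar x) (t.n x) = x 1 * t.dltbar (t.phi1 F) x := H.phi2₁ hx x0
  have w3 : -weylC G x (t.n x) (t.l x) (t.n x) (t.mbar x) = x 1 * (t.dltbar (t.Psi2 G) x +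
      2 * t.dltbar (t.phi1 F) x * conj (t.phi1 F x)) := H.Psi3₁ hx x0
  have w4 : -weylC G x (t.n x) (t.mbar x) (t.n x) (t.mbar x) = 1 / 2 * (x 1 : ℂ) ^ 2 *
      (t.dltbar (t.dltbar (t.Psi2 G)) x + 2 * t.alpha G x * t.dltbar (t.Psi2 G) x +
      4 * (t.dltbar (t.dltbar (t.phi1 F)) x + 2 * t.alpha G x * t.dltbar (t.phi1 F) x)
        * conj (t.phi1 F x) +
      2 * t.dltbar (t.phi1 F) x * t.dltbar (fun y => conj (t.phi1 F y)) x -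
      conj (t.tau G x) * (t.dltbar (t.Psi2 G) x + 4 * t.dltbar (t.phi1 F) x * conj (t.phi1 F x))) :=
    H.Psi4₁ hx x0
  obtain ⟨-, -, -, -, r11, r12, -⟩ := ht.gaugedTetrad.ricci_values electrovacuumOn hx
    (contr2 (F x) (t.l x) (t.m x)) (t.phi1 F x) (contr2 (F x) (t.mbar x) (t.n x)) rfl rfl rfl
  have r11' : ricciC G x (t.n x) (t.n x) = _ := r11
  have r12' : ricciC G x (t.n x) (t.m x) = _ := r12
  rw [w3, w4, r11', r12', f2, TetradCoeffs.Psit3, TetradCoeffs.Psit4, TetradCoeffs.k, e1, e2, e3, e4,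
    e5, e6, e7, e8, x1]
  refine ⟨by ring, ?_, by ring, ?_⟩ <;> rw [map_mul, Complex.conj_ofReal] <;> ring

/-- The Weyl and Ricci components along the generators of `H₂`. -/
theorem components₂ (hl : ∀ u, pt u 0 a b ∈ P.chart.target) {G : MetricComp}
    (hG : G = chartComp S.g P.chart) {F : R4 → Matrix (Fin 4) (Fin 4) ℝ}
    (hF : F = chartComp S.F P.chart) {z : R4} (hz : z = pt 0 0 a b) (u : ℝ) :
    -weylC G (pt u 0 a b) (t.l' G (pt u 0 a b)) (t.n (pt u 0 a b)) (t.l' G (pt u 0 a b))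
      (t.m' G (pt u 0 a b)) = u * t.Psit1' G F z ∧
    -(1 / 2) * ricciC G (pt u 0 a b) (t.l' G (pt u 0 a b)) (t.m' G (pt u 0 a b)) =
      u * (TetradCoeffs.k * t.dlt (t.phi1 F) z * conj (t.phi1 F z)) ∧
    -weylC G (pt u 0 a b) (t.l' G (pt u 0 a b)) (t.m' G (pt u 0 a b)) (t.l' G (pt u 0 a b))
      (t.m' G (pt u 0 a b)) = (1 / 2) * (u : ℂ) ^ 2 * (t.Psit0' G F z +
        4 * TetradCoeffs.k * t.tau G z * t.dlt (t.phi1 F) z * conj (t.phi1 F z)) ∧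
    -(1 / 2) * ricciC G (pt u 0 a b) (t.l' G (pt u 0 a b)) (t.l' G (pt u 0 a b)) =
      (u : ℂ) ^ 2 * (TetradCoeffs.k * t.dlt (t.phi1 F) z * conj (t.dlt (t.phi1 F) z)) := by
  subst hG hF hz
  set G := chartComp S.g P.chart
  set F := chartComp S.F P.chart
  set x := pt u 0 a b with hxdef
  have hx : x ∈ P.chart.target := hl u
  have x0 : x 0 = u := by simp [hxdef, pt]
  have x1 : x 1 = 0 := by simp [hxdef, pt]
  have c := fun {f} (hf : ConstOn P.chart.target 0 1 f) => ht.const_u H hf hl u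
  have p1 := H.phi1₂
  have p2 := H.Psi2₂
  have dp1 := H.dl_const₂ p1
  have dp2 := H.dl_const₂ p2
  have e1 : t.phi1 F x = t.phi1 F (pt 0 0 a b) := c p1
  have e2 : t.dlt (t.phi1 F) x = t.dlt (t.phi1 F) (pt 0 0 a b) := c dp1
  have e3 : t.dlt (t.Psi2 G) x = t.dlt (t.Psi2 G) (pt 0 0 a b) := c dp2
  have e4 : t.dlt (t.dlt (t.phi1 F)) x = t.dlt (t.dlt (t.phi1 F)) (pt 0 0 a b) :=
    c (H.dl_const₂ dp1)
  have e5 : t.dlt (t.dlt (t.Psi2 G)) x = t.dlt (t.dlt (t.Psi2 G)) (pt 0 0 a b) :=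
    c (H.dl_const₂ dp2)
  have e6 : t.dlt (fun y => conj (t.phi1 F y)) x =
      t.dlt (fun y => conj (t.phi1 F y)) (pt 0 0 a b) := c (H.dl_const₂ p1.cj)
  have e7 : t.tau G x = t.tau G (pt 0 0 a b) := c H.tau₂
  have e8 : t.beta G x = t.beta G (pt 0 0 a b) := c H.beta₂
  have e9 : t.Psi2 G x = t.Psi2 G (pt 0 0 a b) := c p2
  have f0 : contr2 (F x) (t.l x) (t.m x) =
      x 0 * (t.dlt (t.phi1 F) x - 2 * t.tau G x * t.phi1 F x) := H.phi0₂ hx x1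
  have w1 : -weylC G x (t.l x) (t.n x) (t.l x) (t.m x) = x 0 * (t.dlt (t.Psi2 G) x +
      2 * t.dlt (t.phi1 F) x * conj (t.phi1 F x) - 3 * t.tau G x * t.Psi2 G x) := H.Psi1₂ hx x1
  have w0 : -weylC G x (t.l x) (t.m x) (t.l x) (t.m x) = 1 / 2 * (x 0 * (x 0 *
      (t.dlt (t.dlt (t.Psi2 G)) x + (t.tau G x - 2 * t.beta G x) * t.dlt (t.Psi2 G) x +
      4 * (t.dlt (t.dlt (t.phi1 F)) x - (t.tau G x + 2 * t.beta G x) * t.dlt (t.phi1 F) x)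
        * conj (t.phi1 F x) +
      2 * t.dlt (t.phi1 F) x * t.dlt (fun y => conj (t.phi1 F y)) x +
      8 * t.tau G x * t.dlt (t.phi1 F) x * conj (t.phi1 F x) - 8 * t.tau G x *
        (t.dlt (t.Psi2 G) x + 2 * t.dlt (t.phi1 F) x * conj (t.phi1 F x) -
          3 * t.tau G x * t.Psi2 G x) - 12 * t.tau G x ^ 2 * t.Psi2 G x))) := H.Psi0₂ hx x1
  -- With b = uτ the rotated φ₀ becomes u(δφ₁ - 2τφ₁) + 2uτφ₁ = u δφ₁.
  obtain ⟨q1, q2⟩ := ht.gaugedTetrad.ricci_rot electrovacuumOn hx _ _ (x 0 * t.tau G x) f0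
    (rfl : _ = t.phi1 F x) (H.phi2₂ hx x1)
  obtain ⟨q3, q4⟩ := ht.gaugedTetrad.weyl_rot electrovacuumOn hx _ _ _ _ _ (x 0 * t.tau G x) f0
    (rfl : _ = t.phi1 F x) (H.phi2₂ hx x1) w0 w1 (rfl : _ = t.Psi2 G x) (H.Psi3₂ hx x1)
    (H.Psi4₂ hx x1)
  rw [l'_eq, m'_eq, show t.n x = t.frame 1 x from rfl, q1, q2, q3, q4, TetradCoeffs.Psit1', TetradCoeffs.Psit0', TetradCoeffs.k, e1, e2,
    e3, e4, e5, e6, e7, e8, e9, x0]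
  refine ⟨by ring, by ring, by ring, ?_⟩
  simp only [map_add, map_mul, map_sub, map_ofNat, Complex.conj_ofReal]
  ring

end IsAdaptedTetrad

end patch

theorem proposition5p1 {M : Type*} [TopologicalSpace M] [ChartedSpace R4 M]
    [IsManifold 𝓘(ℝ, R4) ∞ M] (S : Electrovacuum M) (H₁ H₂ : Set M)
    (P : GaussianNullPatch S H₁ H₂)
    (G : MetricComp) (hG : G = chartComp S.g P.chart)
    (F : R4 → Matrix (Fin 4) (Fin 4) ℝ) (hF : F = chartComp S.F P.chart)
    -- the generators of `H₁` (tangent `∂_r`) and of `H₂` (tangent `∂_u`) are expansion and shear free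
    (hexp₁ : ∀ x ∈ P.chart.target, x 0 = 0 → nullExpansion G 1 x = 0)
    (hshear₁ : ∀ x ∈ P.chart.target, x 0 = 0 → nullShear G 1 x = 0)
    (hexp₂ : ∀ x ∈ P.chart.target, x 1 = 0 → nullExpansion G 0 x = 0)
    (hshear₂ : ∀ x ∈ P.chart.target, x 1 = 0 → nullShear G 0 x = 0)
    (t : TetradCoeffs) (ht : IsAdaptedTetrad P t)
    -- a point `z` of `Z`, the generators of `H₁` and of `H₂` through it
    (a b : ℝ) (z : R4) (hz : z = pt 0 0 a b) (hzt : z ∈ P.chart.target)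
    (c₁ c₂ : ℝ → R4) (hc₁ : c₁ = fun r => pt 0 r a b) (hc₂ : c₂ = fun u => pt u 0 a b) :
    -- parallelly propagated tetrads along the two generators
    IsParallelNullTetrad G c₁ (fun r => t.l (c₁ r)) (fun r => t.n (c₁ r)) (fun r => t.m (c₁ r)) ∧
    IsParallelNullTetrad G c₂
      (fun u => t.l' G (c₂ u)) (fun u => t.n (c₂ u)) (fun u => t.m' G (c₂ u)) ∧
    -- blow up along the generator of `H₁`
    (t.Psit3 G F z ≠ 0 ∨ t.Psit4 G F z ≠ 0 ∨ t.dltbar (t.phi1 F) z ≠ 0 →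
      WeylBlowsUp G c₁ (fun r => t.l (c₁ r)) (fun r => t.n (c₁ r)) (fun r => t.m (c₁ r)) ∨
      RicciBlowsUp G c₁ (fun r => t.l (c₁ r)) (fun r => t.n (c₁ r)) (fun r => t.m (c₁ r))) ∧
    -- blow up along the generator of `H₂`
    (t.Psit0' G F z ≠ 0 ∨ t.Psit1' G F z ≠ 0 ∨ t.dlt (t.phi1 F) z ≠ 0 →
      WeylBlowsUp G c₂
        (fun u => t.l' G (c₂ u)) (fun u => t.n (c₂ u)) (fun u => t.m' G (c₂ u)) ∨
      RicciBlowsUp G c₂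
        (fun u => t.l' G (c₂ u)) (fun u => t.n (c₂ u)) (fun u => t.m' G (c₂ u))) ∧
    -- `Ψ₃`, `Φ₁₂` are linear and `Ψ₄`, `Φ₂₂` are quadratic in `r` on the generator of `H₁`
    (∀ r : ℝ,
      -weylC G (c₁ r) (t.n (c₁ r)) (t.l (c₁ r)) (t.n (c₁ r)) (t.mbar (c₁ r)) =
        r * t.Psit3 G F z ∧
      -(1 / 2) * ricciC G (c₁ r) (t.n (c₁ r)) (t.m (c₁ r)) =
        r * (TetradCoeffs.k * t.phi1 F z * conj (t.dltbar (t.phi1 F) z)) ∧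
      -weylC G (c₁ r) (t.n (c₁ r)) (t.mbar (c₁ r)) (t.n (c₁ r)) (t.mbar (c₁ r)) =
        (1 / 2) * (r : ℂ) ^ 2 * (t.Psit4 G F z - conj (t.tau G z) *
          (t.Psit3 G F z + TetradCoeffs.k * t.dltbar (t.phi1 F) z * conj (t.phi1 F z))) ∧
      -(1 / 2) * ricciC G (c₁ r) (t.n (c₁ r)) (t.n (c₁ r)) =
        (r : ℂ) ^ 2 *
          (TetradCoeffs.k * t.dltbar (t.phi1 F) z * conj (t.dltbar (t.phi1 F) z))) ∧
    -- `Ψ'₁`, `Φ'₀₁` are linear and `Ψ'₀`, `Φ'₀₀` are quadratic in `u` on the generator of `H₂`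
    (∀ u : ℝ,
      -weylC G (c₂ u) (t.l' G (c₂ u)) (t.n (c₂ u)) (t.l' G (c₂ u)) (t.m' G (c₂ u)) =
        u * t.Psit1' G F z ∧
      -(1 / 2) * ricciC G (c₂ u) (t.l' G (c₂ u)) (t.m' G (c₂ u)) =
        u * (TetradCoeffs.k * t.dlt (t.phi1 F) z * conj (t.phi1 F z)) ∧
      -weylC G (c₂ u) (t.l' G (c₂ u)) (t.m' G (c₂ u)) (t.l' G (c₂ u)) (t.m' G (c₂ u)) =
        (1 / 2) * (u : ℂ) ^ 2 * (t.Psit0' G F z +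
          4 * TetradCoeffs.k * t.tau G z * t.dlt (t.phi1 F) z * conj (t.phi1 F z)) ∧
      -(1 / 2) * ricciC G (c₂ u) (t.l' G (c₂ u)) (t.l' G (c₂ u)) =
        (u : ℂ) ^ 2 * (TetradCoeffs.k * t.dlt (t.phi1 F) z * conj (t.dlt (t.phi1 F) z))) := by
  have H := ht.horizons (hG ▸ hexp₁) (hG ▸ hshear₁) (hG ▸ hexp₂) (hG ▸ hshear₂)
  have hl₁ : ∀ r, pt 0 r a b ∈ P.chart.target := P.complete_H₁ a b (hz ▸ hzt)
  have hl₂ : ∀ u, pt u 0 a b ∈ P.chart.target := P.complete_H₂ a b (hz ▸ hzt)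
  have k₁ := ht.components₁ H hl₁ hG hF hz
  have k₂ := ht.components₂ H hl₂ hG hF hz
  subst hc₁ hc₂
  have k0 : TetradCoeffs.k ≠ 0 := two_ne_zero
  refine ⟨hG ▸ ht.isParallelNullTetrad₁ hl₁, hG ▸ ht.isParallelNullTetrad₂ H hl₂, fun hne => ?_,
    fun hne => ?_, k₁, k₂⟩
  -- A nonzero δ̄φ₁ is detected by Φ₂₂ alone. If it vanishes, the correction to Ψ₄ reduces to
  -- -τ̄Ψ̃₃, and either Ψ̃₃ ≠ 0 makes Ψ₃ diverge or Ψ₄ is governed by Ψ̃₄.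
  · by_cases hφ : t.dltbar (t.phi1 F) z = 0
    · left
      by_cases h3 : t.Psit3 G F z = 0
      · have h4 : t.Psit4 G F z ≠ 0 := by tauto
        refine ⟨1, 3, 1, 3, tendsto_norm_pow_mul (c := 1 / 2 * t.Psit4 G F z) (by simpa using h4)
          two_ne_zero fun r => ?_⟩
        have e := (k₁ r).2.2.1
        rw [h3, hφ] at e
        rw [← norm_neg]
        refine congrArg norm (e.trans ?_)
        ring
      · refine ⟨1, 0, 1, 3, tendsto_norm_pow_mul h3 one_ne_zero fun r => ?_⟩
        rw [← norm_neg]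
        refine congrArg norm ((k₁ r).1.trans ?_)
        ring
    · right
      refine ⟨1, 1, tendsto_norm_pow_mul (c := -2 * (TetradCoeffs.k * t.dltbar (t.phi1 F) z *
        conj (t.dltbar (t.phi1 F) z))) (by simp [hφ, k0]) two_ne_zero fun r => ?_⟩
      refine congrArg norm (?_ : ricciC G (pt 0 r a b) (t.n (pt 0 r a b)) (t.n (pt 0 r a b)) = _)
      linear_combination -2 * (k₁ r).2.2.2
  -- Here the correction to Ψ₀' is itself a multiple of δφ₁, so it vanishes in this case without any
  -- condition on Ψ̃₁'.
  · by_cases hφ : t.dlt (t.phi1 F) z = 0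
    · left
      by_cases h3 : t.Psit1' G F z = 0
      · have h4 : t.Psit0' G F z ≠ 0 := by tauto
        refine ⟨0, 2, 0, 2, tendsto_norm_pow_mul (c := 1 / 2 * t.Psit0' G F z) (by simpa using h4)
          two_ne_zero fun u => ?_⟩
        have e := (k₂ u).2.2.1
        rw [hφ] at e
        rw [← norm_neg]
        refine congrArg norm (e.trans ?_)
        ring
      · refine ⟨0, 1, 0, 2, tendsto_norm_pow_mul h3 one_ne_zero fun u => ?_⟩
        rw [← norm_neg]
        refine congrArg norm ((k₂ u).1.trans ?_)
        ring
    · right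
      refine ⟨0, 0, tendsto_norm_pow_mul (c := -2 * (TetradCoeffs.k * t.dlt (t.phi1 F) z *
        conj (t.dlt (t.phi1 F) z))) (by simp [hφ, k0]) two_ne_zero fun u => ?_⟩
      refine congrArg norm (?_ : ricciC G (pt u 0 a b) (t.l' G (pt u 0 a b))
        (t.l' G (pt u 0 a b)) = _)
      linear_combination -2 * (k₂ u).2.2.2
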